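/- **Theorem.** Let $\mathbf k$ be a field, let $\mathfrak h\subset\mathfrak g$ be an inclusion of Lie algebras over $\mathbf k$ (of arbitrary dimension), and let $\mathfrak n=\mathfrak g/\mathfrak h$ be the quotient $\mathfrak h$-module. Let $\mathbf L(\mathfrak g)$ be the free Lie algebra generated by the vector space $\mathfrak g$, and put $$\mathfrak h^{(1)}=\mathbf L(\mathfrak g)\big/\big\langle [h,g]-[h,g]_{\mathfrak g}\ :\ h\in\mathfrak h,\ g\in\mathfrak g\big\rangle ,$$ with its natural Lie algebra maps $\mathfrak h\to\mathfrak h^{(1)}\to\mathfrak g$. Let $\mathfrak h$ act on $\mathbf T(\mathfrak n)$ and $\mathbf S(\mathfrak n)$ by derivations, and on $\mathbf U(\mathfrak h^{(1)})/\mathbf U(\mathfrak h^{(1)})\mathfrak h$ and $\mathbf U(\mathfrak g)/\mathbf U(\mathfrak g)\mathfrak h$ (quotients by the left ideals generated by $\mathfrak h$) by left multiplication. Both of the latter are quotients of $\mathbf T(\mathfrak g)$; let $F^k$, respectively $R^k$, be the $\mathfrak h$-submodule of elements that have a lift to $\mathbf T(\mathfrak g)$ of degree at most $k$, and put $F^{-1}=R^{-1}=0$.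 Let $\alpha\in\mathrm{Ext}^1_{\mathfrak h}(\mathfrak n\otimes\mathfrak n,\mathfrak n)$ be the class of the extension $0\to\mathfrak h\otimes\mathfrak n\to\mathfrak g\otimes\mathfrak n\to\mathfrak n\otimes\mathfrak n\to0$ composed with the action map $\mathfrak h\otimes\mathfrak n\to\mathfrak n$. Then: 1. The map $\mathfrak h\to\mathfrak h^{(1)}$ is injective. 2. For every $k\ge 0$ there are isomorphisms of $\mathfrak h$-modules $F^k/F^{k-1}\cong\mathbf T^k(\mathfrak n)$ and $R^k/R^{k-1}\cong \mathbf S^k(\mathfrak n)$ that send the class of $t\in\mathbf T^k(\mathfrak g)$ to the image of $t$ in $\mathbf T^k(\mathfrak n)$, respectively $\mathbf S^k(\mathfrak n)$. Suppose moreover that $\mathbf k$ has characteristic zero. 3. The following are equivalent: (a) $\alpha=0$; (b) the filtration $F$ splits, that is, each sequence of $\mathfrak h$-modules $0\to F^{k-1}\to F^k\to F^k/F^{k-1}\to0$ splits; (c) the filtration $R$ splits, in the same sense; (d) there is a representation of $\mathfrak h^{(1)}$ on the vector space $\mathfrak n$ whose restriction to $\mathfrak h$ is the given action on $\mathfrak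 n$. 4. The projection $\mathbf T(\mathfrak n)\to\mathbf S(\mathfrak n)$ has a graded $\mathfrak h$-linear section. 5. (Explicit splittings; a representation $\rho$ as below exists exactly when $\alpha=0$.) For every representation $\rho$ of $\mathfrak h^{(1)}$ on $\mathfrak n$ as in (d), there is an isomorphism of $\mathfrak h$-modules $s:\mathbf T(\mathfrak n)\to\mathbf U(\mathfrak h^{(1)})/\mathbf U(\mathfrak h^{(1)})\mathfrak h$ that satisfies $$s(1)=1,\qquad s(\bar a\otimes w)=a\,s(w)-s(\rho(a)w)\qquad(a\in\mathfrak g,\ w\in\mathbf T(\mathfrak n)),$$ where $\bar a$ is the class of $a$ in $\mathfrak n$ and $\rho(a)$ acts on $\mathbf T(\mathfrak n)$ as a derivation; and $s$ splits $F$, that is, it maps $\mathbf T^k(\mathfrak n)$ to $F^k$ and induces the inverse of the isomorphism in 2. 6. For every graded $\mathfrak h$-linear section $\sigma$ of $\mathbf T(\mathfrak n)\to\mathbf S(\mathfrak n)$ and every $\mathfrak h$-linear map $s:\mathbf T(\mathfrak n)\to\mathbf U(\mathfrak h^{(1)})/\mathbf U(\mathfrak h^{(1)})\mathfrak h$ that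 splits $F$ (in particular those in 5), the composition $$I:\ \mathbf S(\mathfrak n)\xrightarrow{\ \sigma\ }\mathbf T(\mathfrak n)\xrightarrow{\ s\ }\mathbf U(\mathfrak h^{(1)})/\mathbf U(\mathfrak h^{(1)})\mathfrak h\longrightarrow\mathbf U(\mathfrak g)/\mathbf U(\mathfrak g)\mathfrak h$$ is an isomorphism of $\mathfrak h$-modules that splits $R$ (it maps $\mathbf S^k(\mathfrak n)$ to $R^k$ and induces the inverse of the isomorphism in 2). -/

import Mathlib

noncomputable section

namespace LiePBW

open CategoryTheory

universe u v w w'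

attribute [local instance] LieRing.ofAssociativeRing

/-! ### Tensor and symmetric algebras of a Lie module -/

section Derivations

variable {K : Type u} [Field K] {M : Type w} [AddCommGroup M] [Module K M]

/-- For a linear map `i : M → A` into an algebra and an endomorphism `f` of `M`, the linear map
`M → A[ε]`, `m ↦ i(m) + ε i(f(m))`. -/
def dualMap {A : Type w'} [Ring A] [Algebra K A] (i : M →ₗ[K] A) (f : M →ₗ[K] M) :
    M →ₗ[K] DualNumber A :=
  (TrivSqZeroExt.inlAlgHom K A A).toLinearMap ∘ₗ i +
    (TrivSqZeroExt.inrHom A A).restrictScalars K ∘ₗ i ∘ₗ f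

/-- The unique derivation of the tensor algebra `T(M)` that extends the endomorphism `f` of `M`:
the coefficient of `ε` in the algebra morphism `T(M) → T(M)[ε]`, `m ↦ m + ε f(m)`. -/
def derT (f : M →ₗ[K] M) : TensorAlgebra K M →ₗ[K] TensorAlgebra K M :=
  (TrivSqZeroExt.sndHom (TensorAlgebra K M) (TensorAlgebra K M)).restrictScalars K ∘ₗ
    (TensorAlgebra.lift K (dualMap (TensorAlgebra.ι K) f)).toLinearMap

/-- The unique derivation of the symmetric algebra `S(M)` that extends the endomorphism `f` of
`M`: the coefficient of `ε` in the algebra morphism `S(M) → S(M)[ε]`, `m ↦ m + ε f(m)`. -/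
def derS (f : M →ₗ[K] M) : SymmetricAlgebra K M →ₗ[K] SymmetricAlgebra K M :=
  (TrivSqZeroExt.sndHom (SymmetricAlgebra K M) (SymmetricAlgebra K M)).restrictScalars K ∘ₗ
    (SymmetricAlgebra.lift (dualMap (SymmetricAlgebra.ι K M) f)).toLinearMap

theorem derT_ι (f : M →ₗ[K] M) (m : M) :
    derT f (TensorAlgebra.ι K m) = TensorAlgebra.ι K (f m) := by
  simp [derT, dualMap]

theorem derS_ι (f : M →ₗ[K] M) (m : M) :
    derS f (SymmetricAlgebra.ι K M m) = SymmetricAlgebra.ι K M (f m) := by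
  simp [derS, dualMap]

theorem derT_algebraMap (f : M →ₗ[K] M) (r : K) :
    derT f (algebraMap K (TensorAlgebra K M) r) = 0 := by
  simp [derT, TrivSqZeroExt.algebraMap_eq_inl']

theorem derS_algebraMap (f : M →ₗ[K] M) (r : K) :
    derS f (algebraMap K (SymmetricAlgebra K M) r) = 0 := by
  simp [derS, TrivSqZeroExt.algebraMap_eq_inl']

theorem fst_liftT (f : M →ₗ[K] M) (t : TensorAlgebra K M) :
    (TensorAlgebra.lift K (dualMap (TensorAlgebra.ι K) f) t).fst = t := by
  induction t using TensorAlgebra.induction with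
  | algebraMap r => simp [TrivSqZeroExt.algebraMap_eq_inl']
  | ι m => simp [dualMap]
  | mul a b ha hb => simp [ha, hb]
  | add a b ha hb => simp [ha, hb]

theorem fst_liftS (f : M →ₗ[K] M) (t : SymmetricAlgebra K M) :
    (SymmetricAlgebra.lift (dualMap (SymmetricAlgebra.ι K M) f) t).fst = t := by
  induction t using SymmetricAlgebra.induction with
  | algebraMap r => simp [TrivSqZeroExt.algebraMap_eq_inl']
  | ι m => simp [dualMap]
  | mul a b ha hb => simp [ha, hb]
  | add a b ha hb => simp [ha, hb]

theorem derT_mul (f : M →ₗ[K] M) (a b : TensorAlgebra K M) :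
    derT f (a * b) = derT f a * b + a * derT f b := by
  have h : ∀ t, derT f t = (TensorAlgebra.lift K (dualMap (TensorAlgebra.ι K) f) t).snd :=
    fun _ => rfl
  simp [h, fst_liftT, add_comm]

theorem derS_mul (f : M →ₗ[K] M) (a b : SymmetricAlgebra K M) :
    derS f (a * b) = derS f a * b + a * derS f b := by
  have h : ∀ t, derS f t =
    (SymmetricAlgebra.lift (dualMap (SymmetricAlgebra.ι K M) f) t).snd := fun _ => rfl
  simp [h, fst_liftS, add_comm, mul_comm]

theorem derT_add (f g : M →ₗ[K] M) (t : TensorAlgebra K M) :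
    derT (f + g) t = derT f t + derT g t := by
  induction t using TensorAlgebra.induction with
  | algebraMap r => simp [derT_algebraMap]
  | ι m => simp [derT_ι]
  | mul a b ha hb => simp only [derT_mul, ha, hb, add_mul, mul_add]; abel
  | add a b ha hb => simp only [map_add, ha, hb]; abel

theorem derS_add (f g : M →ₗ[K] M) (t : SymmetricAlgebra K M) :
    derS (f + g) t = derS f t + derS g t := by
  induction t using SymmetricAlgebra.induction with
  | algebraMap r => simp [derS_algebraMap]
  | ι m => simp [derS_ι]
  | mul a b ha hb => simp only [derS_mul, ha, hb]; ring
  | add a b ha hb => simp only [map_add, ha, hb]; abel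

theorem derT_smul (c : K) (f : M →ₗ[K] M) (t : TensorAlgebra K M) :
    derT (c • f) t = c • derT f t := by
  induction t using TensorAlgebra.induction with
  | algebraMap r => simp [derT_algebraMap]
  | ι m => simp [derT_ι]
  | mul a b ha hb => simp [derT_mul, ha, hb]
  | add a b ha hb => simp only [map_add, ha, hb, smul_add]

theorem derS_smul (c : K) (f : M →ₗ[K] M) (t : SymmetricAlgebra K M) :
    derS (c • f) t = c • derS f t := by
  induction t using SymmetricAlgebra.induction with
  | algebraMap r => simp [derS_algebraMap]
  | ι m => simp [derS_ι]
  | mul a b ha hb => simp [derS_mul, ha, hb]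
  | add a b ha hb => simp only [map_add, ha, hb, smul_add]

theorem derT_lie (f g : Module.End K M) (t : TensorAlgebra K M) :
    derT (f * g - g * f) t = derT f (derT g t) - derT g (derT f t) := by
  induction t using TensorAlgebra.induction with
  | algebraMap r => simp [derT_algebraMap]
  | ι m => simp [derT_ι]
  | mul a b ha hb => simp only [derT_mul, map_add, ha, hb, sub_mul, mul_sub]; abel
  | add a b ha hb => simp only [map_add, ha, hb]; abel

theorem derS_lie (f g : Module.End K M) (t : SymmetricAlgebra K M) :
    derS (f * g - g * f) t = derS f (derS g t) - derS g (derS f t) := by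
  induction t using SymmetricAlgebra.induction with
  | algebraMap r => simp [derS_algebraMap]
  | ι m => simp [derS_ι]
  | mul a b ha hb => simp only [derS_mul, map_add, ha, hb]; ring
  | add a b ha hb => simp only [map_add, ha, hb]; abel

variable (K M) in
/-- `T^k(M) = M^{⊗k}`, the degree `k` part of the tensor algebra. -/
def tensorDeg (k : ℕ) : Submodule K (TensorAlgebra K M) :=
  LinearMap.range (TensorAlgebra.ι K : M →ₗ[K] TensorAlgebra K M) ^ k

variable (K M) in
/-- `S^k(M)`, the degree `k` part of the symmetric algebra. -/
def symDeg (k : ℕ) : Submodule K (SymmetricAlgebra K M) :=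
  LinearMap.range (SymmetricAlgebra.ι K M) ^ k

theorem derT_mem (f : M →ₗ[K] M) {k : ℕ} {t : TensorAlgebra K M} (ht : t ∈ tensorDeg K M k) :
    derT f t ∈ tensorDeg K M k := by
  unfold tensorDeg at *
  induction ht using Submodule.pow_induction_on_left' with
  | algebraMap r => rw [derT_algebraMap]; exact zero_mem _
  | add x y i hx hy ihx ihy => rw [map_add]; exact add_mem ihx ihy
  | mem_mul m hm i x hx ih =>
    obtain ⟨m, rfl⟩ := hm
    rw [derT_mul, derT_ι, pow_succ']
    exact add_mem (Submodule.mul_mem_mul ⟨_, rfl⟩ hx) (Submodule.mul_mem_mul ⟨_, rfl⟩ ih)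

theorem derS_mem (f : M →ₗ[K] M) {k : ℕ} {t : SymmetricAlgebra K M} (ht : t ∈ symDeg K M k) :
    derS f t ∈ symDeg K M k := by
  unfold symDeg at *
  induction ht using Submodule.pow_induction_on_left' with
  | algebraMap r => rw [derS_algebraMap]; exact zero_mem _
  | add x y i hx hy ihx ihy => rw [map_add]; exact add_mem ihx ihy
  | mem_mul m hm i x hx ih =>
    obtain ⟨m, rfl⟩ := hm
    rw [derS_mul, derS_ι, pow_succ']
    exact add_mem (Submodule.mul_mem_mul ⟨_, rfl⟩ hx) (Submodule.mul_mem_mul ⟨_, rfl⟩ ih)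

end Derivations

section LieActions

variable {K : Type u} [Field K] {L : Type v} [LieRing L] [LieAlgebra K L]
variable {M : Type w} [AddCommGroup M] [Module K M] [LieRingModule L M] [LieModule K L M]

/-- The Lie algebra `L` acts on `T(M)` by the derivations that extend its action on `M`. -/
instance : LieRingModule L (TensorAlgebra K M) where
  bracket x t := derT (LieModule.toEnd K L M x) t
  add_lie x y t := by simp only [map_add, derT_add]
  lie_add x s t := map_add _ s t
  leibniz_lie x y t := by
    simp only [LieHom.map_lie, LieRing.of_associative_ring_bracket, derT_lie]; abel

instance : LieModule K L (TensorAlgebra K M) where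
  smul_lie c x t := by
    change derT _ _ = c • derT _ _
    rw [map_smul, derT_smul]
  lie_smul c x t := map_smul (derT _) c t

/-- The Lie algebra `L` acts on `S(M)` by the derivations that extend its action on `M`. -/
instance : LieRingModule L (SymmetricAlgebra K M) where
  bracket x t := derS (LieModule.toEnd K L M x) t
  add_lie x y t := by simp only [map_add, derS_add]
  lie_add x s t := map_add _ s t
  leibniz_lie x y t := by
    simp only [LieHom.map_lie, LieRing.of_associative_ring_bracket, derS_lie]; abel

instance : LieModule K L (SymmetricAlgebra K M) where
  smul_lie c x t := by
    change derS _ _ = c • derS _ _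
    rw [map_smul, derS_smul]
  lie_smul c x t := map_smul (derS _) c t

variable (K L M) in
/-- `T^k(M) = M^{⊗k}` as a Lie submodule of `T(M)`. -/
def tensorPow (k : ℕ) : LieSubmodule K L (TensorAlgebra K M) :=
  { tensorDeg K M k with lie_mem := fun h => derT_mem _ h }

variable (K L M) in
/-- `S^k(M)` as a Lie submodule of `S(M)`. -/
def symPow (k : ℕ) : LieSubmodule K L (SymmetricAlgebra K M) :=
  { symDeg K M k with lie_mem := fun h => derS_mem _ h }

end LieActions

/-! ### Filtered Lie modules -/

section Filtrations

variable {K : Type u} [Field K] {L : Type v} [LieRing L] [LieAlgebra K L]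
variable {V : Type w} [AddCommGroup V] [Module K V] [LieRingModule L V] [LieModule K L V]

/-- `F^{k-1}`, with `F^{-1} = 0`. -/
def prev (F : ℕ → LieSubmodule K L V) : ℕ → LieSubmodule K L V
  | 0 => ⊥
  | k + 1 => F k

/-- The `k`-th graded piece `F^k / F^{k-1}`. -/
abbrev Gr (F : ℕ → LieSubmodule K L V) (k : ℕ) : Type w :=
  F k ⧸ (prev F k).comap (F k).incl

/-- The projection `F^k → F^k / F^{k-1}`. -/
def grMk (F : ℕ → LieSubmodule K L V) (k : ℕ) : F k →ₗ⁅K,L⁆ Gr F k :=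
  LieSubmodule.Quotient.mk' _

/-- The filtration `F` splits: each of the exact sequences
`0 → F^{k-1} → F^k → F^k / F^{k-1} → 0` of `L`-modules splits. -/
def Splits (F : ℕ → LieSubmodule K L V) : Prop :=
  ∀ k, ∃ s : Gr F k →ₗ⁅K,L⁆ F k, ∀ y, grMk F k (s y) = y

end Filtrations

/-! ### The quotient of an enveloping algebra by the left ideal of a subalgebra -/

section Induced

variable {K : Type u} [Field K] {H : Type v} [LieRing H] [LieAlgebra K H]
variable {L : Type w} [LieRing L] [LieAlgebra K L]

/-- The left ideal `U(L)H` of `U(L)` generated by the image of `H` under `φ : H → L`. -/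
def leftIdeal (φ : H →ₗ⁅K⁆ L) : Ideal (UniversalEnvelopingAlgebra K L) :=
  Ideal.span (Set.range fun x : H => UniversalEnvelopingAlgebra.ι K (φ x))

/-- The `U(L)`-module `U(L)/U(L)H`. -/
abbrev Ind (φ : H →ₗ⁅K⁆ L) : Type (max u w) :=
  UniversalEnvelopingAlgebra K L ⧸ leftIdeal φ

/-- The class in `U(L)/U(L)H` of an element of `U(L)`. -/
def indMk (φ : H →ₗ⁅K⁆ L) : UniversalEnvelopingAlgebra K L →ₗ[K] Ind φ :=
  (leftIdeal φ).mkQ.restrictScalars K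

/-- `H` acts on `U(L)/U(L)H` through left multiplication in `U(L)`. -/
instance (φ : H →ₗ⁅K⁆ L) : LieRingModule H (Ind φ) where
  bracket x m := UniversalEnvelopingAlgebra.ι K (φ x) • m
  add_lie x y m := by simp only [map_add, add_smul]
  lie_add x m n := smul_add _ m n
  leibniz_lie x y m := by
    simp only [LieHom.map_lie, LieRing.of_associative_ring_bracket, sub_smul, mul_smul]
    abel

instance (φ : H →ₗ⁅K⁆ L) : LieModule K H (Ind φ) where
  smul_lie c x m := by
    change UniversalEnvelopingAlgebra.ι K (φ (c • x)) • m =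
      c • (UniversalEnvelopingAlgebra.ι K (φ x) • m)
    rw [map_smul, map_smul, smul_assoc]
  lie_smul c x m := by
    change UniversalEnvelopingAlgebra.ι K (φ x) • c • m =
      c • (UniversalEnvelopingAlgebra.ι K (φ x) • m)
    exact smul_comm _ _ _

/-- For a linear map `θ : V → L`, the map `T(V) → U(L) → U(L)/U(L)H`. -/
def ofTensor {V : Type w'} [AddCommGroup V] [Module K V] (φ : H →ₗ⁅K⁆ L) (θ : V →ₗ[K] L) :
    TensorAlgebra K V →ₗ[K] Ind φ :=
  indMk φ ∘ₗ
    (TensorAlgebra.lift K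
      ((UniversalEnvelopingAlgebra.ι K : L →ₗ⁅K⁆ UniversalEnvelopingAlgebra K L).toLinearMap
        ∘ₗ θ)).toLinearMap

theorem lie_ofTensor {V : Type w'} [AddCommGroup V] [Module K V] [LieRingModule H V]
    [LieModule K H V] (φ : H →ₗ⁅K⁆ L) (θ : V →ₗ[K] L)
    (hθ : ∀ (x : H) (y : V), θ ⁅x, y⁆ = ⁅φ x, θ y⁆) (x : H) (t : TensorAlgebra K V) :
    ⁅x, ofTensor φ θ t⁆ = ofTensor φ θ ⁅x, t⁆ := by
  set p := TensorAlgebra.lift K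
      ((UniversalEnvelopingAlgebra.ι K : L →ₗ⁅K⁆ UniversalEnvelopingAlgebra K L).toLinearMap
        ∘ₗ θ) with hp
  set a := UniversalEnvelopingAlgebra.ι K (φ x) with ha
  have key : ∀ t, a * p t - p t * a = p (derT (LieModule.toEnd K H V x) t) := by
    intro t
    induction t using TensorAlgebra.induction with
    | algebraMap r => simp [derT_algebraMap, Algebra.commutes]
    | ι m =>
      simp only [hp, derT_ι, TensorAlgebra.lift_ι_apply, LinearMap.comp_apply,
        LieModule.toEnd_apply_apply, hθ]
      exact (LieHom.map_lie (UniversalEnvelopingAlgebra.ι K) (φ x) (θ m)).symm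
    | mul s t hs ht =>
      rw [derT_mul, map_add, map_mul, map_mul, map_mul, ← hs, ← ht]; noncomm_ring
    | add s t hs ht => rw [map_add, map_add, map_add, ← hs, ← ht]; noncomm_ring
  have h1 : indMk φ (p t * a) = 0 :=
    (Submodule.Quotient.mk_eq_zero _).2
      (Ideal.mul_mem_left _ _ (Ideal.subset_span ⟨x, rfl⟩))
  change indMk φ (a * p t) = indMk φ (p (derT (LieModule.toEnd K H V x) t))
  rw [← key, map_sub, h1, sub_zero]

/-- The degree filtration of `U(L)/U(L)H`: its `k`-th step consists of the elements that have a
lift to `T(V)` of degree at most `k`. -/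
def degFil {V : Type w'} [AddCommGroup V] [Module K V] [LieRingModule H V]
    [LieModule K H V] (φ : H →ₗ⁅K⁆ L) (θ : V →ₗ[K] L)
    (hθ : ∀ (x : H) (y : V), θ ⁅x, y⁆ = ⁅φ x, θ y⁆) (k : ℕ) : LieSubmodule K H (Ind φ) :=
  { (⨆ i ≤ k, tensorDeg K V i).map (ofTensor φ θ) with
    lie_mem := by
      rintro x _ ⟨t, ht, rfl⟩
      refine ⟨derT (LieModule.toEnd K H V x) t, ?_, (lie_ofTensor φ θ hθ x t).symm⟩
      have h : (⨆ i ≤ k, tensorDeg K V i) ≤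
          (⨆ i ≤ k, tensorDeg K V i).comap (derT (LieModule.toEnd K H V x)) :=
        iSup₂_le fun i hi s hs => Submodule.mem_iSup_of_mem i
          (Submodule.mem_iSup_of_mem hi (derT_mem _ hs))
      exact h ht }

end Induced

/-! ### The first order neighbourhood Lie algebra -/

section Neighbourhood

variable {K : Type u} [Field K]

/-- The linearity relations between the generators of the free Lie algebra on a set `V`. -/
inductive LinRel (K : Type u) [Field K] (V : Type v) [AddCommGroup V] [Module K V] :
    FreeLieAlgebra K V → Prop
  | add (a b : V) : LinRel K V
      (FreeLieAlgebra.of K (a + b) - (FreeLieAlgebra.of K a + FreeLieAlgebra.of K b))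
  | smul (c : K) (a : V) : LinRel K V
      (FreeLieAlgebra.of K (c • a) - c • FreeLieAlgebra.of K a)

variable (K) in
/-- The free Lie algebra `L(V)` generated by the vector space `V`. -/
abbrev FreeLie (V : Type v) [AddCommGroup V] [Module K V] : Type (max u v) :=
  FreeLieAlgebra K V ⧸
    LieSubmodule.lieSpan K (FreeLieAlgebra K V) {z | LinRel K V z}

variable (K) in
/-- The inclusion of generators `V → L(V)`. -/
def FreeLie.of (V : Type v) [AddCommGroup V] [Module K V] : V →ₗ[K] FreeLie K V where
  toFun a := LieSubmodule.Quotient.mk (FreeLieAlgebra.of K a)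
  map_add' a b := (Submodule.Quotient.eq _).2 (LieSubmodule.subset_lieSpan (LinRel.add a b))
  map_smul' c a := (Submodule.Quotient.eq _).2 (LieSubmodule.subset_lieSpan (LinRel.smul c a))

/-- The morphism out of a quotient Lie algebra induced by a morphism that kills the ideal. -/
def quotLift {L : Type v} [LieRing L] [LieAlgebra K L] {L' : Type w} [LieRing L']
    [LieAlgebra K L'] (I : LieIdeal K L) (f : L →ₗ⁅K⁆ L') (hf : I ≤ f.ker) : L ⧸ I →ₗ⁅K⁆ L' :=
  { I.toSubmodule.liftQ f.toLinearMap (fun x hx => LieHom.mem_ker.1 (hf hx)) with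
    map_lie' := by
      intro x y
      induction x using Submodule.Quotient.induction_on
      induction y using Submodule.Quotient.induction_on
      exact LieHom.map_lie f _ _ }

/-- The morphism `L(V) → L` that extends the linear map `f : V → L`. -/
def FreeLie.lift {V : Type v} [AddCommGroup V] [Module K V] {L : Type w} [LieRing L]
    [LieAlgebra K L] (f : V →ₗ[K] L) : FreeLie K V →ₗ⁅K⁆ L :=
  quotLift _ (FreeLieAlgebra.lift K f) <| LieSubmodule.lieSpan_le.2 <| by
    rintro _ (⟨a, b⟩ | ⟨c, a⟩) <;> simp [LieHom.mem_ker]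

theorem FreeLie.lift_of {V : Type v} [AddCommGroup V] [Module K V] {L : Type w} [LieRing L]
    [LieAlgebra K L] (f : V →ₗ[K] L) (a : V) : FreeLie.lift f (FreeLie.of K V a) = f a :=
  FreeLieAlgebra.lift_of_apply f a

variable {g : Type v} [LieRing g] [LieAlgebra K g] (h : LieSubalgebra K g)

/-- The elements `[x, y] - [x, y]_g` of `L(g)`, for `x` in `h` and `y` in `g`. -/
def nbhdRel : Set (FreeLie K g) :=
  {z | ∃ (x : h) (y : g),
    z = ⁅FreeLie.of K g x, FreeLie.of K g y⁆ - FreeLie.of K g ⁅(x : g), y⁆}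

/-- The first order neighbourhood Lie algebra `h⁽¹⁾ = L(g) / ⟨[x, y] - [x, y]_g⟩`. -/
def Nbhd : Type (max u v) :=
  FreeLie K g ⧸ LieSubmodule.lieSpan K (FreeLie K g) (nbhdRel h)

instance : LieRing (Nbhd h) :=
  inferInstanceAs (LieRing (FreeLie K g ⧸ LieSubmodule.lieSpan K (FreeLie K g) (nbhdRel h)))

instance : LieAlgebra K (Nbhd h) :=
  inferInstanceAs
    (LieAlgebra K (FreeLie K g ⧸ LieSubmodule.lieSpan K (FreeLie K g) (nbhdRel h)))

/-- The linear map `g → h⁽¹⁾`. -/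
def nbhdOf : g →ₗ[K] Nbhd h :=
  (LieSubmodule.lieSpan K (FreeLie K g) (nbhdRel h)).toSubmodule.mkQ ∘ₗ FreeLie.of K g

theorem nbhdOf_lie (x : h) (y : g) : nbhdOf h ⁅(x : g), y⁆ = ⁅nbhdOf h x, nbhdOf h y⁆ := by
  have hz : ⁅FreeLie.of K g x, FreeLie.of K g y⁆ - FreeLie.of K g ⁅(x : g), y⁆ ∈
      LieSubmodule.lieSpan K (FreeLie K g) (nbhdRel h) :=
    LieSubmodule.subset_lieSpan ⟨x, y, rfl⟩
  exact ((Submodule.Quotient.eq _).2 hz).symm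

/-- The morphism of Lie algebras `j : h → h⁽¹⁾`. -/
def nbhdIncl : h →ₗ⁅K⁆ Nbhd h :=
  { nbhdOf h ∘ₗ h.toSubmodule.subtype with map_lie' := fun {x y} => nbhdOf_lie h x y }

/-- The morphism of Lie algebras `h⁽¹⁾ → g` that is the identity on generators. -/
def nbhdProj : Nbhd h →ₗ⁅K⁆ g :=
  quotLift _ (FreeLie.lift LinearMap.id) <| LieSubmodule.lieSpan_le.2 <| by
    rintro _ ⟨x, y, rfl⟩
    simp [LieHom.mem_ker, FreeLie.lift_of]

theorem nbhdProj_of (a : g) : nbhdProj h (nbhdOf h a) = a :=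
  FreeLie.lift_of LinearMap.id a

/-- A representation of `h⁽¹⁾` on the vector space `E`. -/
abbrev NbhdRep (E : Type w) [AddCommGroup E] [Module K E] : Type (max u v w) :=
  Nbhd h →ₗ⁅K⁆ Module.End K E

/-- The `h`-module structure on `E` given by the Lie bracket is the restriction along
`j : h → h⁽¹⁾` of the representation `ρ` of `h⁽¹⁾` on the vector space `E`. -/
def IsExtension {E : Type w} [AddCommGroup E] [Module K E] [LieRingModule h E]
    [LieModule K h E] (ρ : NbhdRep h E) : Prop :=
  ∀ (x : h) (e : E), ρ (nbhdIncl h x) e = ⁅x, e⁆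

/-- The quotient `h`-module `n = g/h`. -/
abbrev NormalMod : Type v := g ⧸ h.toLieSubmodule

/-- The projection `g → n`. -/
def normalMk : g →ₗ⁅K,h⁆ NormalMod h := LieSubmodule.Quotient.mk' h.toLieSubmodule

/-- `U(h⁽¹⁾)/U(h⁽¹⁾)h`, an `h`-module. -/
abbrev UNbhd : Type (max u v) := Ind (nbhdIncl h)

/-- `U(g)/U(g)h`, an `h`-module. -/
abbrev UQuot : Type (max u v) := Ind h.incl

/-- The projection `T(g) → U(h⁽¹⁾)/U(h⁽¹⁾)h`. -/
def projF : TensorAlgebra K g →ₗ[K] UNbhd h := ofTensor (nbhdIncl h) (nbhdOf h)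

/-- The projection `T(g) → U(g)/U(g)h`. -/
def projR : TensorAlgebra K g →ₗ[K] UQuot h := ofTensor h.incl LinearMap.id

/-- The filtration `F` of `U(h⁽¹⁾)/U(h⁽¹⁾)h`: the image of the degree filtration of `T(g)`. -/
def filF : ℕ → LieSubmodule K h (UNbhd h) :=
  degFil (nbhdIncl h) (nbhdOf h) fun x y => nbhdOf_lie h x y

/-- The filtration `R` of `U(g)/U(g)h`: the image of the degree filtration of `T(g)`. -/
def filR : ℕ → LieSubmodule K h (UQuot h) :=
  degFil h.incl LinearMap.id fun _ _ => rfl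

/-- The map `T(g) → T(n)` induced by `g → n`. -/
def toTN : TensorAlgebra K g →ₐ[K] TensorAlgebra K (NormalMod h) :=
  TensorAlgebra.lift K (TensorAlgebra.ι K ∘ₗ (normalMk h).toLinearMap)

/-- The map `T(g) → S(n)` induced by `g → n`. -/
def toSN : TensorAlgebra K g →ₐ[K] SymmetricAlgebra K (NormalMod h) :=
  (SymmetricAlgebra.algHom K (NormalMod h)).comp (toTN h)

/-- The map `U(h⁽¹⁾) → U(g)` induced by `h⁽¹⁾ → g`. -/
def envMap : UniversalEnvelopingAlgebra K (Nbhd h) →ₐ[K] UniversalEnvelopingAlgebra K g :=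
  UniversalEnvelopingAlgebra.lift K ((UniversalEnvelopingAlgebra.ι K).comp (nbhdProj h))

theorem leftIdeal_le_comap :
    leftIdeal (nbhdIncl h) ≤ (leftIdeal h.incl).comap (envMap h) := by
  refine Ideal.span_le.2 ?_
  rintro _ ⟨x, rfl⟩
  refine Ideal.subset_span ⟨x, ?_⟩
  change _ = envMap h (UniversalEnvelopingAlgebra.ι K (nbhdOf h x))
  rw [envMap, UniversalEnvelopingAlgebra.lift_ι_apply, LieHom.comp_apply, nbhdProj_of]
  rfl

/-- The `h`-linear map `U(h⁽¹⁾)/U(h⁽¹⁾)h → U(g)/U(g)h` induced by `h⁽¹⁾ → g`. -/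
def indMap : UNbhd h →ₗ⁅K,h⁆ UQuot h :=
  { (((leftIdeal (nbhdIncl h)).restrictScalars K).liftQ
      (indMk h.incl ∘ₗ (envMap h).toLinearMap)
      (fun _ hx => (Submodule.Quotient.mk_eq_zero _).2 (leftIdeal_le_comap h hx))) ∘ₗ
      (Submodule.Quotient.restrictScalarsEquiv K (leftIdeal (nbhdIncl h))).symm.toLinearMap with
    map_lie' := by
      intro x m
      induction m using Submodule.Quotient.induction_on with
      | H a =>
        have e : envMap h (UniversalEnvelopingAlgebra.ι K (nbhdIncl h x)) =
            UniversalEnvelopingAlgebra.ι K (x : g) := by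
          rw [envMap, UniversalEnvelopingAlgebra.lift_ι_apply, LieHom.comp_apply]
          exact congrArg _ (nbhdProj_of h x)
        change indMk h.incl (envMap h (UniversalEnvelopingAlgebra.ι K (nbhdIncl h x) * a)) =
          indMk h.incl (UniversalEnvelopingAlgebra.ι K (x : g) * envMap h a)
        rw [map_mul, e] }

/-- The linear map `s : T(n) → U(h⁽¹⁾)/U(h⁽¹⁾)h` splits the filtration `F`: on `T^k(n)` it takes
values in `F^k` and is a section of `F^k → F^k/F^{k-1} = T^k(n)`. Equivalently, the class of a
homogeneous `t ∈ T^k(g)` and the value of `s` at the image of `t` in `T^k(n)` differ by an element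
of `F^{k-1}`. -/
def SplitsF (s : TensorAlgebra K (NormalMod h) →ₗ[K] UNbhd h) : Prop :=
  ∀ k, ∀ t ∈ tensorDeg K g k, s (toTN h t) - projF h t ∈ prev (filF h) k

/-- The linear map `I : S(n) → U(g)/U(g)h` splits the filtration `R`: on `S^k(n)` it takes values
in `R^k` and is a section of `R^k → R^k/R^{k-1} = S^k(n)`. -/
def SplitsR (I : SymmetricAlgebra K (NormalMod h) →ₗ[K] UQuot h) : Prop :=
  ∀ k, ∀ t ∈ tensorDeg K g k, I (toSN h t) - projR h t ∈ prev (filR h) k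

/-- `σ` is a graded splitting of the projection `T(n) → S(n)` of `h`-modules. -/
structure IsGradedSection
    (σ : SymmetricAlgebra K (NormalMod h) →ₗ⁅K,h⁆ TensorAlgebra K (NormalMod h)) : Prop where
  section_apply : ∀ x, SymmetricAlgebra.algHom K (NormalMod h) (σ x) = x
  graded : ∀ k, ∀ x ∈ symDeg K (NormalMod h) k, σ x ∈ tensorDeg K (NormalMod h) k

/-- The map `s : T(n) → U(h⁽¹⁾)/U(h⁽¹⁾)h` attached to a representation `ρ` of `h⁽¹⁾` on `n`. It is
determined by `s(1) = 1` and `s(ā ⊗ w) = a s(w) - s(ρ(a) w)` for `a ∈ g` with class `ā` in `n`,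
where `a` acts on `T(n)` by the derivation that extends `ρ(a)`. For instance
`s(ā ⊗ b̄) = ab - ρ(a)b̄`. -/
structure IsPBWMap (ρ : NbhdRep h (NormalMod h))
    (s : TensorAlgebra K (NormalMod h) →ₗ[K] UNbhd h) : Prop where
  one : s 1 = indMk (nbhdIncl h) 1
  mul : ∀ (a : g) (w : TensorAlgebra K (NormalMod h)),
    s (TensorAlgebra.ι K (normalMk h a) * w) =
      UniversalEnvelopingAlgebra.ι K (nbhdOf h a) • s w - s (derT (ρ (nbhdOf h a)) w)

end Neighbourhood

/-! ### The extension class -/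

section ExtensionClass

attribute [local instance] CategoryStruct.toQuiver

variable {K : Type u} [Field K]

section Modules

variable {L : Type v} [LieRing L] [LieAlgebra K L]

/-- The `U(L)`-module structure on a Lie module over `L`. -/
abbrev envModule (K : Type u) [Field K] (L : Type v) [LieRing L] [LieAlgebra K L]
    (E : Type w) [AddCommGroup E] [Module K E] [LieRingModule L E] [LieModule K L E] :
    Module (UniversalEnvelopingAlgebra K L) E :=
  Module.compHom E (UniversalEnvelopingAlgebra.lift K (LieModule.toEnd K L E)).toRingHom

/-- A Lie module over `L`, as an object of the category of `U(L)`-modules. -/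
def envObj (K : Type u) [Field K] (L : Type v) [LieRing L] [LieAlgebra K L]
    (E : Type w) [AddCommGroup E] [Module K E] [LieRingModule L E] [LieModule K L E] :
    ModuleCat.{w} (UniversalEnvelopingAlgebra K L) :=
  letI := envModule K L E
  ModuleCat.of (UniversalEnvelopingAlgebra K L) E

variable {E : Type w} [AddCommGroup E] [Module K E] [LieRingModule L E] [LieModule K L E]
variable {E' : Type w} [AddCommGroup E'] [Module K E'] [LieRingModule L E'] [LieModule K L E']

theorem env_map_smul (f : E →ₗ⁅K,L⁆ E') (a : UniversalEnvelopingAlgebra K L) (e : E) :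
    f (UniversalEnvelopingAlgebra.lift K (LieModule.toEnd K L E) a e) =
      UniversalEnvelopingAlgebra.lift K (LieModule.toEnd K L E') a (f e) := by
  obtain ⟨t, rfl⟩ : ∃ t, UniversalEnvelopingAlgebra.mkAlgHom K L t = a :=
    Quotient.exists_rep a
  induction t using TensorAlgebra.induction generalizing e with
  | algebraMap r => simp [Module.algebraMap_end_apply]
  | ι m => simp
  | mul s t hs ht => simp only [map_mul, Module.End.mul_apply, hs, ht]
  | add s t hs ht => simp only [map_add, LinearMap.add_apply, hs, ht]

/-- A morphism of Lie modules over `L`, as a morphism of `U(L)`-modules. -/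
def envHom (f : E →ₗ⁅K,L⁆ E') : envObj K L E ⟶ envObj K L E' :=
  letI := envModule K L E
  letI := envModule K L E'
  ModuleCat.ofHom
    { toFun := f
      map_add' := map_add f
      map_smul' := fun a e => env_map_smul f a e }

/-- `Ext^1_L(E, E')`, in the abelian category of modules over `U(L)`. -/
abbrev ExtOne (K : Type u) [Field K] (L : Type v) [LieRing L] [LieAlgebra K L]
    (E : Type w) [AddCommGroup E] [Module K E] [LieRingModule L E] [LieModule K L E]
    (E' : Type w) [AddCommGroup E'] [Module K E'] [LieRingModule L E'] [LieModule K L E'] :=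
  haveI := HasExt.standard (ModuleCat.{w} (UniversalEnvelopingAlgebra K L))
  Abelian.Ext (envObj K L E) (envObj K L E') 1

end Modules

open scoped TensorProduct

variable {g : Type v} [LieRing g] [LieAlgebra K g] (h : LieSubalgebra K g)
variable (E : Type v) [AddCommGroup E] [Module K E] [LieRingModule h E] [LieModule K h E]

/-- The map `h ⊗ E → g ⊗ E`. -/
def inclTensor : h ⊗[K] E →ₗ⁅K,h⁆ g ⊗[K] E :=
  TensorProduct.LieModule.map h.incl' LieModuleHom.id

/-- The map `g ⊗ E → n ⊗ E`. -/
def projTensor : g ⊗[K] E →ₗ⁅K,h⁆ NormalMod h ⊗[K] E :=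
  TensorProduct.LieModule.map (normalMk h) LieModuleHom.id

theorem inclTensor_injective : Function.Injective (inclTensor h E) :=
  Module.Flat.rTensor_preserves_injective_linearMap h.toSubmodule.subtype
    Subtype.val_injective

theorem projTensor_surjective : Function.Surjective (projTensor h E) :=
  LinearMap.rTensor_surjective E (g := h.toSubmodule.mkQ) h.toSubmodule.mkQ_surjective

theorem tensor_exact : Function.Exact (inclTensor h E) (projTensor h E) :=
  rTensor_exact E (LinearMap.exact_subtype_mkQ h.toSubmodule) h.toSubmodule.mkQ_surjective

/-- The sequence `0 → h ⊗ E → g ⊗ E → n ⊗ E → 0` of `h`-modules. -/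
def tensorSeq : ShortComplex (ModuleCat.{v} (UniversalEnvelopingAlgebra K h)) where
  X₁ := envObj K h (h ⊗[K] E)
  X₂ := envObj K h (g ⊗[K] E)
  X₃ := envObj K h (NormalMod h ⊗[K] E)
  f := envHom (inclTensor h E)
  g := envHom (projTensor h E)
  zero := by
    ext x
    exact (tensor_exact h E).apply_apply_eq_zero x

theorem tensorSeq_shortExact : (tensorSeq h E).ShortExact where
  exact := (ShortComplex.ShortExact.moduleCat_exact_iff_function_exact _).2 (tensor_exact h E)
  mono_f := (ModuleCat.mono_iff_injective _).2 (inclTensor_injective h E)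
  epi_g := (ModuleCat.epi_iff_surjective _).2 (projTensor_surjective h E)

/-- The class `α_E ∈ Ext^1_h(n ⊗ E, E)`: the class of `0 → h ⊗ E → g ⊗ E → n ⊗ E → 0` composed
with the action map `h ⊗ E → E`. -/
def alphaClass : ExtOne K h (NormalMod h ⊗[K] E) E :=
  haveI := HasExt.standard (ModuleCat.{v} (UniversalEnvelopingAlgebra K h))
  (tensorSeq_shortExact h E).extClass.comp
    (Abelian.Ext.mk₀ (envHom (LieModule.toModuleHom K h E))) (add_zero 1)

/-- The class `α = α_n ∈ Ext^1_h(n ⊗ n, n)`. -/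
def alpha : ExtOne K h (NormalMod h ⊗[K] NormalMod h) (NormalMod h) := alphaClass h (NormalMod h)

end ExtensionClass

end LiePBW

end

open LiePBW

/-! Both quotients are compared with a graded algebra G, namely T(n) or S(n). Modulo F^{k-1}, an
element of F^k depends only on the symbol in G^k of a lift of degree k (`isSymbolMap_toTN`,
`isSymbolMap_toSN`): modulo the left ideal, x t with x in h equals [x, t], which has the degree of
t, and in U(g) reordering factors costs only lower terms. So G^k maps onto F^k/F^{k-1}.

Injectivity is the Poincaré–Birkhoff–Witt part. It follows from an action on G of the Lie algebra in
question, in which h kills 1 and a in g acts as multiplication by its class plus an operator that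
does not raise degree. The orbit map u ↦ u·1 then recovers symbols
(`isFilteredRetraction_orbitMap`), and `exists_symbolEquiv` gives the isomorphisms of h-modules. For
h⁽¹⁾ and G = T(n) such an action is easy to find, since the only relations are brackets of h with g:
a complement of h acts by left multiplication, and this forces the action of h (`gAct_lie`). For g
and G = S(n) it is built by recursion on ordered monomials, a version relative to h of the classical
proof (`defect_mon`).

By the long exact sequence, α = 0 exactly when the action map extends to an h-linear map g ⊗ n → n,
and such an extension is the same as a representation ρ of h⁽¹⁾ on n
(`alphaClass_eq_zero_iff_exists_bilinear`, `exists_bilinear_iff_exists_rep`). Given ρ, let a act on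
T(n) by left multiplication by its class plus the derivation ρ(a). Here h acts by its natural
derivations, so the orbit map is h-linear; its inverse is the splitting s (`exists_isPBWMap`).
Composing s with a graded section of T(n) → S(n) splits R (`exists_symEquiv`); in characteristic
zero symmetrization divided by k! is such a section.

Conversely, a splitting in degree 2 of either filtration projects the product a c onto the first
step modulo the zeroth, which is n. For a in h the product is already [a, c], so this projection is
an h-linear extension of the action map (`exists_bilinear_of_splits`). -/

noncomputable section

namespace LiePBW

open CategoryTheory

universe u v w w'

attribute [local instance] LieRing.ofAssociativeRing

/-! ### Algebras graded by a space of generators -/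

section Graded

variable {K : Type*} [Field K] {N : Type*} [AddCommGroup N] [Module K N]
variable {G : Type*} [Ring G] [Algebra K G]

/-- The span of the products of `k` generators. -/
def powDeg (j : N →ₗ[K] G) (k : ℕ) : Submodule K G := LinearMap.range j ^ k

/-- The span of the products of fewer than `k` generators. -/
def belowDeg (j : N →ₗ[K] G) (k : ℕ) : Submodule K G := ⨆ i, ⨆ (_ : i < k), powDeg j i

/-- The algebra `G` is generated by `j(N)` and it carries a grading for which `j(N)` has
degree one. -/
structure IsGradedBy (j : N →ₗ[K] G) : Prop where
  -- The grading is encoded as a coaction: the coefficient of X^k is the component of degree k. For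
  -- T and S it comes directly from the universal property.
  exists_hom : ∃ γ : G →ₐ[K] Polynomial G, ∀ v, γ (j v) = Polynomial.monomial 1 (j v)
  lift_surjective : Function.Surjective (TensorAlgebra.lift K j)

theorem one_mem_powDeg (j : N →ₗ[K] G) : (1 : G) ∈ powDeg j 0 := by
  rw [powDeg, pow_zero]
  exact Submodule.one_le.1 le_rfl

theorem mul_mem_powDeg (j : N →ₗ[K] G) {k : ℕ} (v : N) {w : G} (hw : w ∈ powDeg j k) :
    j v * w ∈ powDeg j (k + 1) := by
  rw [powDeg, pow_succ']
  exact Submodule.mul_mem_mul ⟨v, rfl⟩ hw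

/-- Induction on an element of degree `k`. -/
theorem powDeg_induction {j : N →ₗ[K] G} {C : ℕ → G → Prop}
    (one : C 0 1) (smul : ∀ k, ∀ c : K, ∀ w : G, C k w → C k (c • w))
    (add : ∀ k w w', C k w → C k w' → C k (w + w'))
    (mul : ∀ i, ∀ v, ∀ w ∈ powDeg j i, C i w → C (i + 1) (j v * w)) {k : ℕ} {w : G}
    (hw : w ∈ powDeg j k) : C k w := by
  unfold powDeg at hw
  induction hw using Submodule.pow_induction_on_left' with
  | algebraMap r => rw [Algebra.algebraMap_eq_smul_one]; exact smul _ _ _ one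
  | add x y i hx hy ihx ihy => exact add _ _ _ ihx ihy
  | mem_mul m hm i x hx ih =>
    obtain ⟨m, rfl⟩ := hm
    exact mul _ _ _ hx ih

/-- The strict bound in `belowDeg` makes its index agree with that of `prev`: index 0 corresponds to
F^{-1} = 0. -/
theorem belowDeg_zero (j : N →ₗ[K] G) : belowDeg j 0 = ⊥ := by
  simp [belowDeg]

theorem powDeg_le_belowDeg (j : N →ₗ[K] G) {i k : ℕ} (h : i < k) :
    powDeg j i ≤ belowDeg j k :=
  le_iSup₂_of_le i h le_rfl

theorem belowDeg_mono (j : N →ₗ[K] G) {k l : ℕ} (h : k ≤ l) : belowDeg j k ≤ belowDeg j l :=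
  iSup₂_le fun _ hi => powDeg_le_belowDeg j (hi.trans_le h)

theorem belowDeg_succ (j : N →ₗ[K] G) (k : ℕ) :
    belowDeg j (k + 1) = belowDeg j k ⊔ powDeg j k := by
  refine le_antisymm (iSup₂_le fun i hi => ?_)
    (sup_le (belowDeg_mono j k.le_succ) (powDeg_le_belowDeg j k.lt_succ_self))
  rcases (Nat.lt_succ_iff_lt_or_eq.1 hi) with hi | rfl
  · exact (powDeg_le_belowDeg j hi).trans le_sup_left
  · exact le_sup_right

theorem mem_belowDeg_succ {j : N →ₗ[K] G} {k : ℕ} {w : G} (hw : w ∈ belowDeg j (k + 1)) :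
    ∃ w₀ ∈ belowDeg j k, ∃ w₁ ∈ powDeg j k, w₀ + w₁ = w := by
  rwa [belowDeg_succ, Submodule.mem_sup] at hw

theorem mul_mem_belowDeg (j : N →ₗ[K] G) {k : ℕ} (v : N) {w : G} (hw : w ∈ belowDeg j k) :
    j v * w ∈ belowDeg j (k + 1) := by
  have : belowDeg j k ≤ (belowDeg j (k + 1)).comap (LinearMap.mulLeft K (j v)) :=
    iSup₂_le fun i hi x hx =>
      powDeg_le_belowDeg j (Nat.succ_lt_succ hi) (mul_mem_powDeg j v hx)
  exact this hw

theorem mul_mem_powDeg_right (j : N →ₗ[K] G) {k : ℕ} (v : N) {w : G} (hw : w ∈ powDeg j k) :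
    w * j v ∈ powDeg j (k + 1) := by
  rw [powDeg, pow_succ]
  exact Submodule.mul_mem_mul hw ⟨v, rfl⟩

theorem mul_mem_belowDeg_right (j : N →ₗ[K] G) {k : ℕ} (v : N) {w : G}
    (hw : w ∈ belowDeg j k) : w * j v ∈ belowDeg j (k + 1) := by
  have : belowDeg j k ≤ (belowDeg j (k + 1)).comap (LinearMap.mulRight K (j v)) :=
    iSup₂_le fun i hi x hx =>
      powDeg_le_belowDeg j (Nat.succ_lt_succ hi) (mul_mem_powDeg_right j v hx)
  exact this hw

theorem powDeg_map {G' : Type*} [Ring G'] [Algebra K G'] {N' : Type*} [AddCommGroup N']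
    [Module K N'] (j : N →ₗ[K] G) (j' : N' →ₗ[K] G') (f : G →ₐ[K] G') (p : N →ₗ[K] N')
    (hp : Function.Surjective p) (hf : ∀ v, f (j v) = j' (p v)) (k : ℕ) :
    (powDeg j k).map f.toLinearMap = powDeg j' k := by
  rw [powDeg, powDeg, Submodule.map_pow]
  congr 1
  rw [← LinearMap.range_comp]
  have : f.toLinearMap ∘ₗ j = j' ∘ₗ p := LinearMap.ext hf
  rw [this, LinearMap.range_comp, LinearMap.range_eq_top.2 hp, Submodule.map_top]

theorem belowDeg_map {G' : Type*} [Ring G'] [Algebra K G'] {N' : Type*} [AddCommGroup N']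
    [Module K N'] (j : N →ₗ[K] G) (j' : N' →ₗ[K] G') (f : G →ₐ[K] G') (p : N →ₗ[K] N')
    (hp : Function.Surjective p) (hf : ∀ v, f (j v) = j' (p v)) (k : ℕ) :
    (belowDeg j k).map f.toLinearMap = belowDeg j' k := by
  simp only [belowDeg, Submodule.map_iSup, powDeg_map j j' f p hp hf]

namespace IsGradedBy

variable {j : N →ₗ[K] G} (hj : IsGradedBy j)
include hj

theorem exists_mem_belowDeg (w : G) : ∃ k, w ∈ belowDeg j k := by
  have mulmem : ∀ t : TensorAlgebra K N, ∀ k, ∀ w ∈ belowDeg j k,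
      ∃ l, TensorAlgebra.lift K j t * w ∈ belowDeg j l := by
    intro t
    induction t using TensorAlgebra.induction with
    | algebraMap r =>
      intro k w hw
      exact ⟨k, by simpa [← Algebra.smul_def] using Submodule.smul_mem _ r hw⟩
    | ι m =>
      intro k w hw
      exact ⟨k + 1, by simpa using mul_mem_belowDeg j m hw⟩
    | mul a b ha hb =>
      intro k w hw
      obtain ⟨l, hl⟩ := hb k w hw
      obtain ⟨l', hl'⟩ := ha l _ hl
      exact ⟨l', by rwa [map_mul, mul_assoc]⟩
    | add a b ha hb =>
      intro k w hw
      obtain ⟨l, hl⟩ := hb k w hw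
      obtain ⟨l', hl'⟩ := ha k w hw
      refine ⟨max l l', ?_⟩
      rw [map_add, add_mul]
      exact add_mem (belowDeg_mono j (le_max_right _ _) hl')
        (belowDeg_mono j (le_max_left _ _) hl)
  obtain ⟨t, rfl⟩ := hj.lift_surjective w
  obtain ⟨l, hl⟩ := mulmem t 1 1 (powDeg_le_belowDeg j zero_lt_one (one_mem_powDeg j))
  exact ⟨l, by simpa using hl⟩

/-- Induction on the number of factors. -/
theorem induction {C : G → Prop} (one : C 1) (smul : ∀ c : K, ∀ w, C w → C (c • w))
    (add : ∀ w w', C w → C w' → C (w + w')) (mul : ∀ v w, C w → C (j v * w)) (w : G) : C w := by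
  let P : Submodule K G :=
    { carrier := {w | C w}
      add_mem' := fun h h' => add _ _ h h'
      zero_mem' := by simpa using smul 0 _ one
      smul_mem' := fun c w h => smul c w h }
  obtain ⟨k, hk⟩ := hj.exists_mem_belowDeg w
  have : belowDeg j k ≤ P := iSup₂_le fun i _ x hx =>
    powDeg_induction (C := fun _ w => C w) one (fun _ c w h => smul c w h)
      (fun _ w w' h h' => add w w' h h') (fun _ v w _ h => mul v w h) hx
  exact this hk

/-- The projection to the degree `k` component. -/
def comp (k : ℕ) : G →ₗ[K] G :=
  (Polynomial.lcoeff G k).restrictScalars K ∘ₗ hj.exists_hom.choose.toLinearMap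

theorem hom_apply {k : ℕ} {w : G} (hw : w ∈ powDeg j k) :
    hj.exists_hom.choose w = Polynomial.monomial k w := by
  refine powDeg_induction
    (C := fun k w => hj.exists_hom.choose w = Polynomial.monomial k w) ?_ ?_ ?_ ?_ hw
  · simp
  · intro k c w h
    rw [map_smul, h, Polynomial.smul_monomial]
  · intro k w w' h h'
    rw [map_add, map_add, h, h']
  · intro k v w _ h
    rw [map_mul, h, hj.exists_hom.choose_spec v, Polynomial.monomial_mul_monomial, add_comm 1 k]

theorem comp_apply {k l : ℕ} {w : G} (hw : w ∈ powDeg j k) :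
    hj.comp l w = if k = l then w else 0 := by
  simp [comp, hj.hom_apply hw, Polynomial.coeff_monomial]

theorem comp_self {k : ℕ} {w : G} (hw : w ∈ powDeg j k) : hj.comp k w = w := by
  simp [hj.comp_apply hw]

theorem comp_below {k : ℕ} {w : G} (hw : w ∈ belowDeg j k) : hj.comp k w = 0 := by
  have : belowDeg j k ≤ LinearMap.ker (hj.comp k) :=
    iSup₂_le fun i hi x hx => by simp [hj.comp_apply hx, hi.ne]
  exact this hw

/-- Two linear maps that agree on homogeneous elements are equal. -/
theorem linearMap_ext {V : Type*} [AddCommGroup V] [Module K V] {f f' : G →ₗ[K] V}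
    (H : ∀ k, ∀ w ∈ powDeg j k, f w = f' w) : f = f' := by
  ext w
  obtain ⟨k, hk⟩ := hj.exists_mem_belowDeg w
  have : belowDeg j k ≤ LinearMap.eqLocus f f' := iSup₂_le fun i _ x hx => H i x hx
  exact this hk

theorem comp_mem (k : ℕ) (w : G) : hj.comp k w ∈ powDeg j k := by
  obtain ⟨l, hl⟩ := hj.exists_mem_belowDeg w
  have : belowDeg j l ≤ (powDeg j k).comap (hj.comp k) := iSup₂_le fun i _ x hx => by
    rw [Submodule.mem_comap, hj.comp_apply hx]
    split_ifs with h
    · exact h ▸ hx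
    · exact zero_mem _
  exact this hl

/-- `j(v)` shifts the degree by one. -/
theorem comp_succ_mul (k : ℕ) (v : N) (w : G) :
    hj.comp (k + 1) (j v * w) = j v * hj.comp k w := by
  have : hj.comp (k + 1) ∘ₗ LinearMap.mulLeft K (j v) =
      LinearMap.mulLeft K (j v) ∘ₗ hj.comp k := by
    refine hj.linearMap_ext fun l w hw => ?_
    simp [hj.comp_apply hw, hj.comp_apply (mul_mem_powDeg j v hw)]
  exact LinearMap.congr_fun this w

theorem comp_zero_mul (v : N) (w : G) : hj.comp 0 (j v * w) = 0 := by
  have : hj.comp 0 ∘ₗ LinearMap.mulLeft K (j v) = 0 := by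
    refine hj.linearMap_ext fun l w hw => ?_
    simp [hj.comp_apply (mul_mem_powDeg j v hw)]
  exact LinearMap.congr_fun this w

theorem comp_succ_mul_right (k : ℕ) (v : N) (w : G) :
    hj.comp (k + 1) (w * j v) = hj.comp k w * j v := by
  have : hj.comp (k + 1) ∘ₗ LinearMap.mulRight K (j v) =
      LinearMap.mulRight K (j v) ∘ₗ hj.comp k := by
    refine hj.linearMap_ext fun l w hw => ?_
    simp [hj.comp_apply hw, hj.comp_apply (mul_mem_powDeg_right j v hw)]
  exact LinearMap.congr_fun this w

theorem comp_zero_mul_right (v : N) (w : G) : hj.comp 0 (w * j v) = 0 := by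
  have : hj.comp 0 ∘ₗ LinearMap.mulRight K (j v) = 0 := by
    refine hj.linearMap_ext fun l w hw => ?_
    simp [hj.comp_apply (mul_mem_powDeg_right j v hw)]
  exact LinearMap.congr_fun this w

/-- The linear map that multiplies the elements of degree `k` by `c k`. -/
def scale (c : ℕ → K) : G →ₗ[K] G :=
  (Polynomial.lsum fun k => (c k • LinearMap.id : G →ₗ[K] G)) ∘ₗ hj.exists_hom.choose.toLinearMap

theorem scale_apply (c : ℕ → K) {k : ℕ} {w : G} (hw : w ∈ powDeg j k) :
    hj.scale c w = c k • w := by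
  simp [scale, hj.hom_apply hw, Polynomial.lsum_apply, Polynomial.sum_monomial_index]

/-- A linear endomorphism that is the identity up to terms of lower degree has trivial kernel. -/
theorem eq_zero_of_sub_mem (f : G →ₗ[K] G) (hf : ∀ k, ∀ w ∈ powDeg j k, f w - w ∈ belowDeg j k)
    {w : G} (hw : f w = 0) : w = 0 := by
  have hb : ∀ k, ∀ w ∈ belowDeg j k, f w ∈ belowDeg j k := fun k w hw => by
    have : belowDeg j k ≤ (belowDeg j k).comap f := iSup₂_le fun i hi x hx => by
      have h1 := add_mem (belowDeg_mono j hi.le (hf i x hx)) (powDeg_le_belowDeg j hi hx)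
      simpa using h1
    exact this hw
  obtain ⟨k, hk⟩ := hj.exists_mem_belowDeg w
  induction k with
  | zero => simpa [belowDeg_zero] using hk
  | succ k ih =>
    obtain ⟨w₀, h0, w₁, h1, rfl⟩ := mem_belowDeg_succ hk
    refine ih ?_
    -- Both `f w₀` and `f w₁ - w₁` lie below degree k, so the component of degree k of `f (w₀ + w₁)`
    -- is `w₁`; it vanishes with `f (w₀ + w₁)`.
    have h2 : hj.comp k (f w₀ + (f w₁ - w₁)) = 0 := hj.comp_below (add_mem (hb k _ h0) (hf k _ h1))
    have h3 : f w₀ + (f w₁ - w₁) = f (w₀ + w₁) - w₁ := by rw [map_add]; abel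
    rw [h3, hw, zero_sub, map_neg, neg_eq_zero, hj.comp_self h1] at h2
    simpa [h2] using h0

end IsGradedBy

theorem mem_belowDeg_of_forall_powDeg {j : N →ₗ[K] G} {f : G →ₗ[K] G}
    (hf : ∀ k, ∀ w ∈ powDeg j k, f w ∈ belowDeg j (k + 1)) {k : ℕ} {w : G}
    (hw : w ∈ belowDeg j k) : f w ∈ belowDeg j k := by
  have : belowDeg j k ≤ (belowDeg j k).comap f :=
    iSup₂_le fun i hi x hx => belowDeg_mono j hi (hf i x hx)
  exact this hw

theorem isGradedBy_tensorAlgebra :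
    IsGradedBy (TensorAlgebra.ι K : N →ₗ[K] TensorAlgebra K N) where
  exists_hom := ⟨TensorAlgebra.lift K
    ((Polynomial.monomial 1).restrictScalars K ∘ₗ TensorAlgebra.ι K), fun v => by simp⟩
  lift_surjective t := ⟨t, by
    have : TensorAlgebra.lift K (TensorAlgebra.ι K : N →ₗ[K] _) = AlgHom.id K _ := by
      ext; simp
    rw [this]; rfl⟩

theorem isGradedBy_symmetricAlgebra : IsGradedBy (SymmetricAlgebra.ι K N) where
  exists_hom := ⟨SymmetricAlgebra.lift
    ((Polynomial.monomial 1).restrictScalars K ∘ₗ SymmetricAlgebra.ι K N), fun v => by simp⟩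
  lift_surjective t := by
    have : TensorAlgebra.lift K (SymmetricAlgebra.ι K N) = SymmetricAlgebra.algHom K N := by
      ext; simp [SymmetricAlgebra.ι]
    rw [this]
    exact SymmetricAlgebra.algHom_surjective K N t

end Graded

/-! ### Comparison of a filtered module with a graded one -/

section Comparison

set_option linter.unusedSectionVars false

variable {K : Type u} [Field K] {g : Type v} [LieRing g] [LieAlgebra K g]
variable {H : Type*} [LieRing H] [LieAlgebra K H] [LieRingModule H g] [LieModule K H g]
variable {L : Type*} [LieRing L] [LieAlgebra K L]
variable (φ : H →ₗ⁅K⁆ L) (θ : g →ₗ[K] L)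
variable (hθ : ∀ (x : H) (y : g), θ ⁅x, y⁆ = ⁅φ x, θ y⁆)

theorem mem_degFil {k : ℕ} {y : Ind φ} :
    y ∈ degFil φ θ hθ k ↔ ∃ t ∈ belowDeg (TensorAlgebra.ι K : g →ₗ[K] _) (k + 1),
      ofTensor φ θ t = y := by
  change y ∈ (⨆ i ≤ k, tensorDeg K g i).map (ofTensor φ θ) ↔ _
  have : belowDeg (TensorAlgebra.ι K : g →ₗ[K] _) (k + 1) = ⨆ i ≤ k, tensorDeg K g i := by
    simp only [belowDeg, Nat.lt_succ_iff]; rfl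
  rw [this]
  exact Submodule.mem_map

theorem mem_prev_degFil {k : ℕ} {y : Ind φ} :
    y ∈ prev (degFil φ θ hθ) k ↔ ∃ t ∈ belowDeg (TensorAlgebra.ι K : g →ₗ[K] _) k,
      ofTensor φ θ t = y := by
  cases k with
  | zero => simp [prev, belowDeg_zero, eq_comm]
  | succ k => exact mem_degFil φ θ hθ

theorem ofTensor_mem_prev {k : ℕ} {t : TensorAlgebra K g}
    (ht : t ∈ belowDeg (TensorAlgebra.ι K : g →ₗ[K] _) k) :
    ofTensor φ θ t ∈ prev (degFil φ θ hθ) k :=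
  (mem_prev_degFil φ θ hθ).2 ⟨t, ht, rfl⟩

theorem ofTensor_mem_degFil {k : ℕ} {t : TensorAlgebra K g} (ht : t ∈ tensorDeg K g k) :
    ofTensor φ θ t ∈ degFil φ θ hθ k :=
  (mem_degFil φ θ hθ).2 ⟨t, powDeg_le_belowDeg _ k.lt_succ_self ht, rfl⟩

theorem prev_le_degFil (k : ℕ) : prev (degFil φ θ hθ) k ≤ degFil φ θ hθ k := by
  intro y hy
  obtain ⟨t, ht, rfl⟩ := (mem_prev_degFil φ θ hθ).1 hy
  exact (mem_degFil φ θ hθ).2 ⟨t, belowDeg_mono _ k.le_succ ht, rfl⟩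

omit [LieRingModule H g] [LieModule K H g] in
theorem smul_ofTensor (a : g) (t : TensorAlgebra K g) :
    UniversalEnvelopingAlgebra.ι K (θ a) • ofTensor φ θ t =
      ofTensor φ θ (TensorAlgebra.ι K a * t) := by
  simp only [ofTensor, LinearMap.comp_apply, AlgHom.toLinearMap_apply, map_mul,
    TensorAlgebra.lift_ι_apply]
  rfl

theorem smul_mem_prev (a : g) {k : ℕ} {y : Ind φ} (hy : y ∈ prev (degFil φ θ hθ) k) :
    UniversalEnvelopingAlgebra.ι K (θ a) • y ∈ prev (degFil φ θ hθ) (k + 1) := by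
  obtain ⟨t, ht, rfl⟩ := (mem_prev_degFil φ θ hθ).1 hy
  rw [smul_ofTensor]
  exact ofTensor_mem_prev φ θ hθ (mul_mem_belowDeg _ a ht)

variable {N : Type*} [AddCommGroup N] [Module K N] {G : Type*} [Ring G] [Algebra K G]
variable (j : N →ₗ[K] G) (q : TensorAlgebra K g →ₗ[K] G)

/-- `T^k(g)` maps onto the degree `k` part of `G`, and the symbols that vanish in `G` vanish in
the associated graded of `U(L)/U(L)H`. -/
structure IsSymbolMap : Prop where
  map_powDeg : ∀ k, (tensorDeg K g k).map q = powDeg j k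
  mem_prev : ∀ k, ∀ t ∈ tensorDeg K g k, q t = 0 → ofTensor φ θ t ∈ prev (degFil φ θ hθ) k

/-- The linear map `π : U(L)/U(L)H → G` induces the symbol map on the associated graded. -/
def IsFilteredRetraction (π : Ind φ →ₗ[K] G) : Prop :=
  ∀ k, ∀ t ∈ tensorDeg K g k, π (ofTensor φ θ t) - q t ∈ belowDeg j k

/-- The linear map `s : G → U(L)/U(L)H` induces a section of the symbol map on the associated
graded. -/
def IsFilteredSection (s : G →ₗ[K] Ind φ) : Prop :=
  ∀ k, ∀ t ∈ tensorDeg K g k, s (q t) - ofTensor φ θ t ∈ prev (degFil φ θ hθ) k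

variable {φ θ hθ j q} (hj : IsGradedBy j) (hq : IsSymbolMap φ θ hθ j q)

include hq in
theorem IsSymbolMap.apply_mem {k : ℕ} {t : TensorAlgebra K g} (ht : t ∈ tensorDeg K g k) :
    q t ∈ powDeg j k := by
  rw [← hq.map_powDeg]; exact Submodule.mem_map_of_mem ht

include hq in
theorem IsSymbolMap.exists_lift {k : ℕ} {w : G} (hw : w ∈ powDeg j k) :
    ∃ t ∈ tensorDeg K g k, q t = w := by
  rwa [← hq.map_powDeg] at hw

include hq in
theorem IsFilteredRetraction.mem_below {π : Ind φ →ₗ[K] G}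
    (hπ : IsFilteredRetraction φ θ j q π) {k : ℕ} {y : Ind φ}
    (hy : y ∈ prev (degFil φ θ hθ) k) : π y ∈ belowDeg j k := by
  obtain ⟨t, ht, rfl⟩ := (mem_prev_degFil φ θ hθ).1 hy
  have : belowDeg (TensorAlgebra.ι K : g →ₗ[K] _) k ≤ (belowDeg j k).comap (π ∘ₗ ofTensor φ θ) :=
    iSup₂_le fun i hi x hx => by
      have := add_mem (belowDeg_mono j hi.le (hπ i x hx))
        (powDeg_le_belowDeg j hi (hq.apply_mem hx))
      simpa using this
  exact this ht

theorem mem_prev_succ {k : ℕ} {y : Ind φ} (hy : y ∈ degFil φ θ hθ k) :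
    ∃ t ∈ tensorDeg K g k, y - ofTensor φ θ t ∈ prev (degFil φ θ hθ) k := by
  obtain ⟨t, ht, rfl⟩ := (mem_degFil φ θ hθ).1 hy
  obtain ⟨t₀, h0, t₁, h1, rfl⟩ := mem_belowDeg_succ ht
  exact ⟨t₁, h1, by simpa using ofTensor_mem_prev φ θ hθ h0⟩

theorem indMk_surjective : Function.Surjective (indMk φ) :=
  Submodule.Quotient.mk_surjective _

theorem exists_mem_prev (hsurj : Function.Surjective (ofTensor φ θ)) (y : Ind φ) :
    ∃ k, y ∈ prev (degFil φ θ hθ) k := by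
  obtain ⟨t, rfl⟩ := hsurj y
  obtain ⟨k, hk⟩ := isGradedBy_tensorAlgebra.exists_mem_belowDeg t
  exact ⟨k, ofTensor_mem_prev φ θ hθ hk⟩

/-- Induction along the filtration. -/
theorem mem_of_forall_degFil (hsurj : Function.Surjective (ofTensor φ θ))
    (P : Submodule K (Ind φ))
    (step : ∀ k, ∀ t ∈ tensorDeg K g k, ∃ z ∈ P, z - ofTensor φ θ t ∈ prev (degFil φ θ hθ) k)
    (y : Ind φ) : y ∈ P := by
  obtain ⟨k, hk⟩ := exists_mem_prev (hθ := hθ) hsurj y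
  induction k generalizing y with
  | zero =>
    have : y = 0 := by simpa [prev] using hk
    exact this ▸ zero_mem _
  | succ k ih =>
    obtain ⟨t, ht, h1⟩ := mem_prev_succ hk
    obtain ⟨z, hz, h2⟩ := step k t ht
    have h3 : y - z ∈ P := ih _ (by simpa using sub_mem h1 h2)
    simpa using add_mem h3 hz

-- `π ∘ s` is the identity up to terms of lower degree, hence injective, and so is `s`. Surjectivity
-- climbs the filtration and does not need `π`.
include hj hq in
theorem IsFilteredSection.bijective {s : G →ₗ[K] Ind φ} (hs : IsFilteredSection φ θ hθ q s)
    (hsurj : Function.Surjective (ofTensor φ θ))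
    {π : Ind φ →ₗ[K] G} (hπ : IsFilteredRetraction φ θ j q π) : Function.Bijective s := by
  constructor
  · refine (injective_iff_map_eq_zero s).2 fun w hw => ?_
    refine hj.eq_zero_of_sub_mem (π ∘ₗ s) (fun k w hw => ?_) (by simp [hw])
    obtain ⟨t, ht, rfl⟩ := hq.exists_lift hw
    have := add_mem (hπ.mem_below hq (hs k t ht)) (hπ k t ht)
    simpa using this
  · intro y
    exact mem_of_forall_degFil (hθ := hθ) hsurj (LinearMap.range s)
      (fun k t ht => ⟨_, ⟨q t, rfl⟩, hs k t ht⟩) y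

-- If `π y = 0` and `y` lies in F^k, then the symbol of `y`, read off from `π y`, vanishes; the
-- field `mem_prev` of `IsSymbolMap` pushes `y` down one step.
include hj hq in
theorem IsFilteredRetraction.injective (hsurj : Function.Surjective (ofTensor φ θ))
    {π : Ind φ →ₗ[K] G} (hπ : IsFilteredRetraction φ θ j q π) : Function.Injective π := by
  refine (injective_iff_map_eq_zero π).2 fun y hy => ?_
  obtain ⟨k, hk⟩ := exists_mem_prev (hθ := hθ) hsurj y
  induction k with
  | zero => simpa [prev] using hk
  | succ k ih =>
    refine ih ?_
    obtain ⟨t, ht, h1⟩ := mem_prev_succ hk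
    have h2 := hj.comp_below (add_mem (hπ.mem_below hq h1) (hπ k t ht))
    rw [map_sub, sub_add_sub_cancel, hy, zero_sub, map_neg, neg_eq_zero,
      hj.comp_self (hq.apply_mem ht)] at h2
    simpa using add_mem h1 (hq.mem_prev k t ht h2)

-- Lift the top component to a tensor and correct the error by induction. The control on the
-- filtration step of the preimage is what makes the inverse of `π` a filtered section.
include hq in
theorem IsFilteredRetraction.surjective_below
    {π : Ind φ →ₗ[K] G} (hπ : IsFilteredRetraction φ θ j q π) {k : ℕ} {w : G}
    (hw : w ∈ belowDeg j k) : ∃ y ∈ prev (degFil φ θ hθ) k, π y = w := by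
  induction k generalizing w with
  | zero =>
    have : w = 0 := by simpa [belowDeg_zero] using hw
    exact ⟨0, zero_mem _, by simp [this]⟩
  | succ k ih =>
    obtain ⟨w₀, h0, w₁, h1, rfl⟩ := mem_belowDeg_succ hw
    obtain ⟨t, ht, rfl⟩ := hq.exists_lift h1
    obtain ⟨y, hy, e⟩ := ih (sub_mem h0 (hπ k t ht))
    refine ⟨y + ofTensor φ θ t, add_mem (prev_le_degFil φ θ hθ k hy)
      (ofTensor_mem_degFil φ θ hθ ht), ?_⟩
    rw [map_add, e]; abel

include hj hq in
/-- A filtered map that induces the symbol map is bijective, and its inverse is a filtered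
section. -/
theorem IsFilteredRetraction.bijective (hsurj : Function.Surjective (ofTensor φ θ))
    {π : Ind φ →ₗ[K] G} (hπ : IsFilteredRetraction φ θ j q π) : Function.Bijective π :=
  ⟨hπ.injective hj hq hsurj, fun w => by
    obtain ⟨k, hk⟩ := hj.exists_mem_belowDeg w
    obtain ⟨y, -, e⟩ := hπ.surjective_below hq hk
    exact ⟨y, e⟩⟩

include hj hq in
theorem IsFilteredRetraction.isFilteredSection (hsurj : Function.Surjective (ofTensor φ θ))
    {π : Ind φ →ₗ[K] G} (hπ : IsFilteredRetraction φ θ j q π)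
    {s : G →ₗ[K] Ind φ} (hs : ∀ w, π (s w) = w) : IsFilteredSection φ θ hθ q s := by
  intro k t ht
  obtain ⟨y, hy, e⟩ := hπ.surjective_below hq (hπ k t ht)
  have : s (q t) - ofTensor φ θ t = - y :=
    hπ.injective hj hq hsurj (by rw [map_neg, e, map_sub, hs]; abel)
  rw [this]
  exact neg_mem hy

variable [LieRingModule H G] [LieModule K H G] (hqH : ∀ (x : H) t, q ⁅x, t⁆ = ⁅x, q t⁆)
variable (P : ℕ → LieSubmodule K H G) (hP : ∀ k, (P k).toSubmodule = powDeg j k)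

theorem lie_mem_tensorDeg (x : H) {k : ℕ} {t : TensorAlgebra K g} (ht : t ∈ tensorDeg K g k) :
    ⁅x, t⁆ ∈ tensorDeg K g k :=
  derT_mem _ ht

-- `π` itself need not be H-linear. On F^k, however, the component of degree k of `π` sees only the
-- symbol of a lift, and taking symbols is H-linear.
include hj hq hqH in
theorem IsFilteredRetraction.comp_lie {π : Ind φ →ₗ[K] G}
    (hπ : IsFilteredRetraction φ θ j q π) {k : ℕ} (x : H) {y : Ind φ}
    (hy : y ∈ degFil φ θ hθ k) : hj.comp k (π ⁅x, y⁆) = ⁅x, hj.comp k (π y)⁆ := by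
  have key : ∀ t ∈ tensorDeg K g k, hj.comp k (π (ofTensor φ θ t)) = q t := fun t ht => by
    have := hj.comp_below (hπ k t ht)
    rwa [map_sub, hj.comp_self (hq.apply_mem ht), sub_eq_zero] at this
  obtain ⟨t, ht, h1⟩ := mem_prev_succ hy
  have h2 : ⁅x, y⁆ - ofTensor φ θ ⁅x, t⁆ ∈ prev (degFil φ θ hθ) k := by
    rw [← lie_ofTensor φ θ hθ, ← lie_sub]
    exact LieSubmodule.lie_mem _ h1
  have h3 := hj.comp_below (hπ.mem_below hq h1)
  have h4 := hj.comp_below (hπ.mem_below hq h2)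
  rw [map_sub, map_sub, key _ ht, sub_eq_zero] at h3
  rw [map_sub, map_sub, key _ (lie_mem_tensorDeg x ht), sub_eq_zero] at h4
  rw [h3, h4, hqH]

/-- The symbol map `F^k → G^k`. -/
def symbolHom {π : Ind φ →ₗ[K] G} (hπ : IsFilteredRetraction φ θ j q π) (k : ℕ) :
    degFil φ θ hθ k →ₗ⁅K,H⁆ P k :=
  { ((hj.comp k ∘ₗ π) ∘ₗ (degFil φ θ hθ k).toSubmodule.subtype).codRestrict (P k).toSubmodule
      (fun y => by rw [hP]; exact hj.comp_mem k _) with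
    map_lie' := fun {x y} => Subtype.ext (hπ.comp_lie hj hq hqH x y.2) }

theorem symbolHom_apply {π : Ind φ →ₗ[K] G} (hπ : IsFilteredRetraction φ θ j q π) {k : ℕ}
    {t : TensorAlgebra K g} (ht : t ∈ tensorDeg K g k) {y : degFil φ θ hθ k}
    (hy : (y : Ind φ) - ofTensor φ θ t ∈ prev (degFil φ θ hθ) k) :
    (symbolHom hj hq hqH P hP hπ k y : G) = q t := by
  change hj.comp k (π y) = q t
  have h1 := hj.comp_below (add_mem (hπ.mem_below hq hy) (hπ k t ht))
  rwa [map_sub, sub_add_sub_cancel, map_sub, hj.comp_self (hq.apply_mem ht), sub_eq_zero] at h1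

-- Injectivity is the field `mem_prev` of `IsSymbolMap`: an element with vanishing symbol lies one
-- step lower. Surjectivity holds because T^k(g) maps onto G^k.
include hj hq hqH hP in
theorem exists_symbolEquiv {π : Ind φ →ₗ[K] G} (hπ : IsFilteredRetraction φ θ j q π) :
    ∃ e : ∀ k, Gr (degFil φ θ hθ) k ≃ₗ⁅K,H⁆ P k, ∀ k, ∀ t ∈ tensorDeg K g k,
      ∀ y : degFil φ θ hθ k, ofTensor φ θ t = y → (e k (grMk (degFil φ θ hθ) k y) : G) = q t := by
  let f k := symbolHom hj hq hqH P hP hπ k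
  have hf k : ((prev (degFil φ θ hθ) k).comap (degFil φ θ hθ k).incl).toSubmodule ≤
      LinearMap.ker (f k).toLinearMap := by
    intro y hy
    refine Subtype.ext ?_
    rw [ZeroMemClass.coe_zero, ← map_zero q]
    -- An element of F^{k-1} has the zero tensor as a lift of its symbol of degree k.
    exact symbolHom_apply hj hq hqH P hP hπ (zero_mem (tensorDeg K g k)) (by rw [map_zero, sub_zero]; exact hy)
  let e k : Gr (degFil φ θ hθ) k →ₗ⁅K,H⁆ P k :=
    { Submodule.liftQ _ (f k).toLinearMap (hf k) with
      map_lie' := by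
        intro x m
        induction m using Submodule.Quotient.induction_on with
        | H a => exact (f k).map_lie x a }
  have he k (y : degFil φ θ hθ k) : e k (grMk (degFil φ θ hθ) k y) = f k y := rfl
  have hb k : Function.Bijective (e k) := by
    constructor
    · refine (injective_iff_map_eq_zero (e k)).2 fun m hm => ?_
      obtain ⟨y, rfl⟩ := LieSubmodule.Quotient.surjective_mk' _ m
      obtain ⟨t, ht, h1⟩ := mem_prev_succ y.2
      have h2 : q t = 0 := by
        rw [← symbolHom_apply hj hq hqH P hP hπ ht h1]
        exact congrArg Subtype.val hm
      refine (LieSubmodule.Quotient.mk_eq_zero _).2 ?_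
      have := add_mem h1 (hq.mem_prev k t ht h2)
      rwa [sub_add_cancel] at this
    · rintro ⟨w, hw⟩
      obtain ⟨t, ht, rfl⟩ := hq.exists_lift (hP k ▸ hw : w ∈ powDeg j k)
      refine ⟨grMk _ k ⟨_, ofTensor_mem_degFil φ θ hθ ht⟩, Subtype.ext ?_⟩
      exact symbolHom_apply hj hq hqH P hP hπ ht (by simp)
  refine ⟨fun k => { e k, LinearEquiv.ofBijective (e k).toLinearMap (hb k) with }, ?_⟩
  intro k t ht y hy
  exact symbolHom_apply hj hq hqH P hP hπ ht (by simp [hy])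

include hq hP in
/-- An `H`-linear filtered section splits the filtration. -/
theorem IsFilteredSection.splits {s : G →ₗ⁅K,H⁆ Ind φ} (hs : IsFilteredSection φ θ hθ q s)
    (e : ∀ k, Gr (degFil φ θ hθ) k ≃ₗ⁅K,H⁆ P k)
    (he : ∀ k, ∀ t ∈ tensorDeg K g k,
      ∀ y : degFil φ θ hθ k, ofTensor φ θ t = y →
        (e k (grMk (degFil φ θ hθ) k y) : G) = q t) :
    Splits (degFil φ θ hθ) := by
  intro k
  have hmem : ∀ w : P k, s w ∈ degFil φ θ hθ k := fun w => by
    obtain ⟨t, ht, h⟩ := hq.exists_lift (hP k ▸ w.2 : (w : G) ∈ powDeg j k)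
    rw [← h]
    simpa using add_mem (prev_le_degFil φ θ hθ k (hs k t ht)) (ofTensor_mem_degFil φ θ hθ ht)
  let f : P k →ₗ⁅K,H⁆ degFil φ θ hθ k :=
    { (s.toLinearMap ∘ₗ (P k).toSubmodule.subtype).codRestrict (degFil φ θ hθ k).toSubmodule
        hmem with
      map_lie' := fun {x y} => Subtype.ext (s.map_lie x y) }
  refine ⟨f.comp (e k).toLieModuleHom, fun y => ?_⟩
  obtain ⟨y, rfl⟩ := LieSubmodule.Quotient.surjective_mk' _ y
  change grMk _ k (f (e k (grMk _ k y))) = grMk _ k y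
  obtain ⟨t, ht, h1⟩ := mem_prev_succ y.2
  have h2 : grMk _ k y = grMk _ k ⟨_, ofTensor_mem_degFil φ θ hθ ht⟩ := by
    rw [← sub_eq_zero, ← map_sub]
    exact LieSubmodule.Quotient.mk_eq_zero _ |>.2 h1
  rw [h2, ← sub_eq_zero, ← map_sub]
  refine LieSubmodule.Quotient.mk_eq_zero _ |>.2 ?_
  have := hs k t ht
  rw [← he k t ht ⟨_, ofTensor_mem_degFil φ θ hθ ht⟩ rfl] at this
  exact this

end Comparison

/-! ### Universal property of the first order neighbourhood Lie algebra -/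

section NbhdLift

variable {K : Type u} [Field K] {g : Type v} [LieRing g] [LieAlgebra K g] (h : LieSubalgebra K g)

/-- The morphism `h⁽¹⁾ → L'` that extends a linear map `f : g → L'` compatible with the brackets of
elements of `h` with elements of `g`. -/
def nbhdLift {L' : Type*} [LieRing L'] [LieAlgebra K L'] (f : g →ₗ[K] L')
    (hf : ∀ (x : h) (y : g), f ⁅(x : g), y⁆ = ⁅f x, f y⁆) : Nbhd h →ₗ⁅K⁆ L' :=
  quotLift _ (FreeLie.lift f) <| LieSubmodule.lieSpan_le.2 <| by
    rintro _ ⟨x, y, rfl⟩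
    simp [LieHom.mem_ker, FreeLie.lift_of, hf]

theorem nbhdLift_of {L' : Type*} [LieRing L'] [LieAlgebra K L'] (f : g →ₗ[K] L')
    (hf : ∀ (x : h) (y : g), f ⁅(x : g), y⁆ = ⁅f x, f y⁆) (a : g) :
    nbhdLift h f hf (nbhdOf h a) = f a :=
  FreeLie.lift_of f a

theorem nbhd_hom_ext {L' : Type*} [LieRing L'] [LieAlgebra K L'] {f f' : Nbhd h →ₗ⁅K⁆ L'}
    (H : ∀ a, f (nbhdOf h a) = f' (nbhdOf h a)) : f = f' := by
  let p : FreeLieAlgebra K g →ₗ⁅K⁆ Nbhd h :=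
    { toFun := fun x => Submodule.Quotient.mk (Submodule.Quotient.mk x)
      map_add' := fun _ _ => rfl
      map_smul' := fun _ _ => rfl
      map_lie' := rfl }
  have hp : f.comp p = f'.comp p := FreeLieAlgebra.hom_ext H
  ext x
  induction x using Submodule.Quotient.induction_on with
  | H x =>
    induction x using Submodule.Quotient.induction_on with
    | H x => exact LieHom.congr_fun hp x

/-- The composite h → h⁽¹⁾ → g is the inclusion. -/
theorem nbhdIncl_injective : Function.Injective (nbhdIncl h) := fun x y hxy => by
  have := congrArg (nbhdProj h) hxy
  exact Subtype.ext ((nbhdProj_of h x).symm.trans (this.trans (nbhdProj_of h y)))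

end NbhdLift

/-! ### Surjectivity of the projections from the tensor algebra -/

section Surjectivity

variable {K : Type u} [Field K] {g : Type v} [LieRing g] [LieAlgebra K g] (h : LieSubalgebra K g)

theorem projR_surjective : Function.Surjective (projR h) := by
  intro y
  obtain ⟨u, rfl⟩ := indMk_surjective y
  obtain ⟨t, rfl⟩ : ∃ t, UniversalEnvelopingAlgebra.mkAlgHom K g t = u := Quotient.exists_rep u
  refine ⟨t, ?_⟩
  change indMk _ (TensorAlgebra.lift K _ t) = _
  congr 1
  refine AlgHom.congr_fun (?_ : TensorAlgebra.lift K _ = UniversalEnvelopingAlgebra.mkAlgHom K g) t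
  ext a
  simp

/-- The elements of g generate h⁽¹⁾ only as a Lie algebra. The image of T(g) in U(h⁽¹⁾) is a
subalgebra in which the defining relations of h⁽¹⁾ hold, so the universal properties give a map from
U(h⁽¹⁾) into it; followed by the inclusion it is the identity. -/
theorem projF_surjective : Function.Surjective (projF h) := by
  intro y
  obtain ⟨u, rfl⟩ := indMk_surjective y
  set f := TensorAlgebra.lift K ((UniversalEnvelopingAlgebra.ι K :
    Nbhd h →ₗ⁅K⁆ UniversalEnvelopingAlgebra K (Nbhd h)).toLinearMap ∘ₗ nbhdOf h) with hf
  have hfa : ∀ a, f (TensorAlgebra.ι K a) = UniversalEnvelopingAlgebra.ι K (nbhdOf h a) := by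
    simp [hf]
  let i : g →ₗ[K] f.range :=
    f.rangeRestrict.toLinearMap ∘ₗ TensorAlgebra.ι K
  have hi : ∀ (x : h) (y : g), i ⁅(x : g), y⁆ = ⁅i x, i y⁆ := fun x y => by
    refine Subtype.ext ?_
    change f (TensorAlgebra.ι K _) = ⁅f (TensorAlgebra.ι K _), f (TensorAlgebra.ι K _)⁆
    rw [hfa, hfa, hfa, nbhdOf_lie, LieHom.map_lie]
  let F : UniversalEnvelopingAlgebra K (Nbhd h) →ₐ[K] f.range :=
    UniversalEnvelopingAlgebra.lift K (nbhdLift h i hi)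
  have hF : f.range.val.comp F = AlgHom.id K _ := by
    refine UniversalEnvelopingAlgebra.hom_ext K (nbhd_hom_ext h fun a => ?_)
    change (F (UniversalEnvelopingAlgebra.ι K (nbhdOf h a)) : UniversalEnvelopingAlgebra K _) =
      UniversalEnvelopingAlgebra.ι K (nbhdOf h a)
    rw [UniversalEnvelopingAlgebra.lift_ι_apply, nbhdLift_of]
    exact hfa a
  obtain ⟨t, ht⟩ := (F u).2
  refine ⟨t, ?_⟩
  change indMk _ (f t) = _
  congr 1
  exact ht.trans (AlgHom.congr_fun hF u)

end Surjectivity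

/-! ### Filtered retractions from actions on the graded module -/

section Retraction

variable {K : Type u} [Field K] {H : Type*} [LieRing H] [LieAlgebra K H]
variable {L : Type*} [LieRing L] [LieAlgebra K L] (φ : H →ₗ⁅K⁆ L)
variable {G : Type*} [Ring G] [Algebra K G] (B : L →ₗ⁅K⁆ Module.End K G)

/-- The linear map `U(L)/U(L)H → G`, `u ↦ u · 1`, for an action of `L` on `G` such that `H` kills
`1`. -/
def orbitMap (hB : ∀ x, B (φ x) 1 = 0) : Ind φ →ₗ[K] G :=
  (((leftIdeal φ).restrictScalars K).liftQ
    (LinearMap.applyₗ (1 : G) ∘ₗ (UniversalEnvelopingAlgebra.lift K B).toLinearMap)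
    (fun u hu => by
      change u ∈ Submodule.span _ _ at hu
      change UniversalEnvelopingAlgebra.lift K B u 1 = 0
      induction hu using Submodule.span_induction with
      | mem u hu =>
        obtain ⟨x, rfl⟩ := hu
        change UniversalEnvelopingAlgebra.lift K B (UniversalEnvelopingAlgebra.ι K (φ x)) 1 = 0
        rw [UniversalEnvelopingAlgebra.lift_ι_apply, hB]
      | zero => simp
      | add u v _ _ hu hv => simp [hu, hv]
      | smul a u _ hu => simp [hu])) ∘ₗ
    (Submodule.Quotient.restrictScalarsEquiv K (leftIdeal φ)).symm.toLinearMap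

variable (hB : ∀ x, B (φ x) 1 = 0)

theorem orbitMap_one : orbitMap φ B hB (indMk φ 1) = 1 := by
  exact LinearMap.congr_fun (map_one (UniversalEnvelopingAlgebra.lift K B)) 1

theorem orbitMap_smul (a : L) (y : Ind φ) :
    orbitMap φ B hB (UniversalEnvelopingAlgebra.ι K a • y) = B a (orbitMap φ B hB y) := by
  obtain ⟨u, rfl⟩ := indMk_surjective y
  change UniversalEnvelopingAlgebra.lift K B (UniversalEnvelopingAlgebra.ι K a * u) 1 =
    B a (UniversalEnvelopingAlgebra.lift K B u 1)
  rw [map_mul, UniversalEnvelopingAlgebra.lift_ι_apply, Module.End.mul_apply]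

theorem ofTensor_one {V : Type*} [AddCommGroup V] [Module K V] (θ : V →ₗ[K] L) :
    ofTensor φ θ 1 = indMk φ 1 := by
  simp [ofTensor]

/-- A generator acts as multiplication by its symbol plus an operator that does not raise degree.
Hence a product of k generators applied to 1 has the product of the symbols as its leading term. -/
theorem isFilteredRetraction_orbitMap {g : Type*} [LieRing g] [LieAlgebra K g] {N : Type*}
    [AddCommGroup N] [Module K N] (θ : g →ₗ[K] L) (j : N →ₗ[K] G) (p : g →ₗ[K] N)
    (q : TensorAlgebra K g →ₐ[K] G) (hq : ∀ a, q (TensorAlgebra.ι K a) = j (p a))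
    (hBj : ∀ a k, ∀ w ∈ belowDeg j k, B (θ a) w - j (p a) * w ∈ belowDeg j k) :
    IsFilteredRetraction φ θ j q.toLinearMap (orbitMap φ B hB) := by
  intro k t ht
  -- The degree of the symbol is carried through the induction because the error bound at the next
  -- generator needs it.
  have key : q t ∈ powDeg j k ∧ orbitMap φ B hB (ofTensor φ θ t) - q t ∈ belowDeg j k := by
    refine powDeg_induction (j := (TensorAlgebra.ι K : g →ₗ[K] TensorAlgebra K g))
      (C := fun k t => q t ∈ powDeg j k ∧
        orbitMap φ B hB (ofTensor φ θ t) - q t ∈ belowDeg j k) ?_ ?_ ?_ ?_ ht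
    · rw [map_one, ofTensor_one, orbitMap_one, sub_self]
      exact ⟨one_mem_powDeg j, zero_mem _⟩
    · rintro k c t ⟨h1, h2⟩
      simp only [map_smul, ← smul_sub]
      exact ⟨Submodule.smul_mem _ c h1, Submodule.smul_mem _ c h2⟩
    · rintro k t t' ⟨h1, h2⟩ ⟨h3, h4⟩
      simp only [map_add, add_sub_add_comm]
      exact ⟨add_mem h1 h3, add_mem h2 h4⟩
    · rintro k a t - ⟨h1, h2⟩
      rw [map_mul, hq]
      refine ⟨mul_mem_powDeg j _ h1, ?_⟩
      rw [← smul_ofTensor, orbitMap_smul]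
      have h3 : orbitMap φ B hB (ofTensor φ θ t) ∈ belowDeg j (k + 1) := by
        have := add_mem (belowDeg_mono j k.le_succ h2) (powDeg_le_belowDeg j k.lt_succ_self h1)
        simpa using this
      have := add_mem (hBj a _ _ h3) (mul_mem_belowDeg j (p a) h2)
      simpa [mul_sub] using this
  exact key.2

end Retraction

/-! ### The symbol maps -/

section Symbols

variable {K : Type u} [Field K] {g : Type v} [LieRing g] [LieAlgebra K g] (h : LieSubalgebra K g)

theorem normalMk_surjective : Function.Surjective (normalMk h) :=
  LieSubmodule.Quotient.surjective_mk' _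

theorem normalMk_eq_zero {a : g} : normalMk h a = 0 ↔ a ∈ h :=
  LieSubmodule.Quotient.mk_eq_zero _

theorem toTN_ι (a : g) : toTN h (TensorAlgebra.ι K a) = TensorAlgebra.ι K (normalMk h a) := by
  simp [toTN]

theorem toSN_ι (a : g) :
    toSN h (TensorAlgebra.ι K a) = SymmetricAlgebra.ι K (NormalMod h) (normalMk h a) := by
  simp [toSN, toTN_ι, SymmetricAlgebra.ι]

theorem algHom_lie {L : Type*} [LieRing L] [LieAlgebra K L] {M : Type*} [AddCommGroup M]
    [Module K M] [LieRingModule L M] [LieModule K L M] (x : L) (t : TensorAlgebra K M) :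
    SymmetricAlgebra.algHom K M ⁅x, t⁆ = ⁅x, SymmetricAlgebra.algHom K M t⁆ := by
  change SymmetricAlgebra.algHom K M (derT _ t) = derS _ (SymmetricAlgebra.algHom K M t)
  induction t using TensorAlgebra.induction with
  | algebraMap r => rw [derT_algebraMap, map_zero, AlgHom.commutes, derS_algebraMap]
  | ι m =>
    rw [derT_ι]
    exact (derS_ι _ m).symm
  | mul a b ha hb => rw [derT_mul, map_mul, derS_mul, map_add, map_mul, map_mul, ha, hb]
  | add a b ha hb => simp only [map_add, ha, hb]

theorem toTN_lie (x : h) (t : TensorAlgebra K g) : toTN h ⁅x, t⁆ = ⁅x, toTN h t⁆ := by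
  change toTN h (derT _ t) = derT _ (toTN h t)
  induction t using TensorAlgebra.induction with
  | algebraMap r => rw [derT_algebraMap, map_zero, AlgHom.commutes, derT_algebraMap]
  | ι m =>
    rw [derT_ι, toTN_ι, toTN_ι, derT_ι]
    exact congrArg _ ((normalMk h).map_lie x m)
  | mul a b ha hb => rw [derT_mul, map_mul, derT_mul, map_add, map_mul, map_mul, ha, hb]
  | add a b ha hb => simp only [map_add, ha, hb]

theorem toSN_lie (x : h) (t : TensorAlgebra K g) : toSN h ⁅x, t⁆ = ⁅x, toSN h t⁆ := by
  simp only [toSN, AlgHom.comp_apply, toTN_lie, algHom_lie]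

/-- A linear section of `g → n`. -/
def normalSection : NormalMod h →ₗ[K] g :=
  ((normalMk h).toLinearMap.exists_rightInverse_of_surjective
    (LinearMap.range_eq_top.2 (normalMk_surjective h))).choose

theorem normalMk_normalSection (c : NormalMod h) : normalMk h (normalSection h c) = c :=
  LinearMap.congr_fun ((normalMk h).toLinearMap.exists_rightInverse_of_surjective
    (LinearMap.range_eq_top.2 (normalMk_surjective h))).choose_spec c

theorem sub_normalSection_mem (a : g) : a - normalSection h (normalMk h a) ∈ h := by
  rw [← normalMk_eq_zero, map_sub, normalMk_normalSection, sub_self]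

/-- The algebra section of `T(g) → T(n)` induced by a linear section of `g → n`. -/
def tensorSection : TensorAlgebra K (NormalMod h) →ₐ[K] TensorAlgebra K g :=
  TensorAlgebra.lift K (TensorAlgebra.ι K ∘ₗ normalSection h)

theorem tensorSection_ι (c : NormalMod h) :
    tensorSection h (TensorAlgebra.ι K c) = TensorAlgebra.ι K (normalSection h c) := by
  simp [tensorSection]

variable {L : Type*} [LieRing L] [LieAlgebra K L] {φ : h →ₗ⁅K⁆ L} {θ : g →ₗ[K] L}
  (hθ : ∀ (x : h) (y : g), θ ⁅x, y⁆ = ⁅φ x, θ y⁆) (hφ : ∀ x : h, θ x = φ x)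

-- Replacing the first factor of a t by its representative in the complement changes the product by
-- x t with x in h. Modulo the left ideal x t = [x, t], and this has the degree of t, one less than
-- that of a t.
include hφ in
theorem ofTensor_sub_tensorSection_mem {k : ℕ} {t : TensorAlgebra K g}
    (ht : t ∈ tensorDeg K g k) :
    ofTensor φ θ t - ofTensor φ θ (tensorSection h (toTN h t)) ∈ prev (degFil φ θ hθ) k := by
  refine powDeg_induction (j := (TensorAlgebra.ι K : g →ₗ[K] TensorAlgebra K g))
    (C := fun k t => ofTensor φ θ t - ofTensor φ θ (tensorSection h (toTN h t)) ∈
      prev (degFil φ θ hθ) k) ?_ ?_ ?_ ?_ ht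
  · simp
  · intro k c t h1
    simp only [map_smul, ← smul_sub]
    exact Submodule.smul_mem (prev (degFil φ θ hθ) k).toSubmodule c h1
  · intro k t t' h1 h2
    simp only [map_add, add_sub_add_comm]
    exact add_mem h1 h2
  · intro k a t ht h1
    set r := normalSection h (normalMk h a) with hr
    have h2 : ofTensor φ θ (TensorAlgebra.ι K a * t) -
        ofTensor φ θ (tensorSection h (toTN h (TensorAlgebra.ι K a * t))) =
        ofTensor φ θ (TensorAlgebra.ι K (a - r) * t) +
        UniversalEnvelopingAlgebra.ι K (θ r) •
          (ofTensor φ θ t - ofTensor φ θ (tensorSection h (toTN h t))) := by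
      rw [map_mul (toTN h), toTN_ι, map_mul (tensorSection h), tensorSection_ι, ← hr, smul_sub, smul_ofTensor, smul_ofTensor,
        map_sub, sub_mul, map_sub]
      abel
    rw [h2]
    refine add_mem ?_ (smul_mem_prev φ θ hθ r h1)
    have h3 := lie_ofTensor φ θ hθ ⟨a - r, sub_normalSection_mem h a⟩ t
    change UniversalEnvelopingAlgebra.ι K (φ ⟨a - r, _⟩) • ofTensor φ θ t = _ at h3
    rw [← hφ, smul_ofTensor] at h3
    rw [h3]
    exact ofTensor_mem_degFil φ θ hθ (derT_mem _ ht)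

theorem map_toTN (k : ℕ) :
    (tensorDeg K g k).map (toTN h).toLinearMap = powDeg (TensorAlgebra.ι K) k :=
  powDeg_map _ _ (toTN h) (normalMk h).toLinearMap (normalMk_surjective h) (toTN_ι h) k

theorem map_toSN (k : ℕ) : (tensorDeg K g k).map (toSN h).toLinearMap =
    powDeg (SymmetricAlgebra.ι K (NormalMod h)) k :=
  powDeg_map _ _ (toSN h) (normalMk h).toLinearMap (normalMk_surjective h) (toSN_ι h) k

theorem isSymbolMap_toTN :
    IsSymbolMap (nbhdIncl h) (nbhdOf h) (fun x y => nbhdOf_lie h x y) (TensorAlgebra.ι K)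
      (toTN h).toLinearMap where
  map_powDeg := map_toTN h
  mem_prev k t ht h0 := by
    have := ofTensor_sub_tensorSection_mem h (φ := nbhdIncl h) (θ := nbhdOf h) (fun x y => nbhdOf_lie h x y) (fun _ => rfl) ht
    rw [AlgHom.toLinearMap_apply] at h0
    rwa [h0, map_zero, map_zero, sub_zero] at this

/-- An algebra morphism `T(M) → U` that sends commutators of generators to elements of degree one
sends the homogeneous elements of degree `k` that vanish in `S(M)` to elements of degree less
than `k`. -/
theorem mem_belowDeg_of_algHom_eq_zero {M : Type*} [AddCommGroup M] [Module K M] {U : Type*}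
    [Ring U] [Algebra K U] {N : Type*} [AddCommGroup N] [Module K N] (j : N →ₗ[K] U)
    (r : M →ₗ[K] N) (hr : ∀ a b, j (r a) * j (r b) - j (r b) * j (r a) ∈ belowDeg j 2)
    {k : ℕ} {t : TensorAlgebra K M} (ht : t ∈ tensorDeg K M k)
    (h0 : SymmetricAlgebra.algHom K M t = 0) :
    TensorAlgebra.lift K (j ∘ₗ r) t ∈ belowDeg j k := by
  have hg := isGradedBy_tensorAlgebra (K := K) (N := M)
  set E := TensorAlgebra.lift K (j ∘ₗ r)
  have hE : ∀ a, E (TensorAlgebra.ι K a) = j (r a) := fun a => by simp [E]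
  -- `Z` collects the tensors each of whose homogeneous components is sent below its own degree. It
  -- is a two-sided ideal containing the commutators of generators, so it contains the kernel of
  -- T(M) → S(M).
  let Z : Submodule K (TensorAlgebra K M) :=
    ⨅ k, (belowDeg j k).comap (E.toLinearMap ∘ₗ hg.comp k)
  have hZ : ∀ {t}, t ∈ Z ↔ ∀ k, E (hg.comp k t) ∈ belowDeg j k := fun {t} => by
    simp [Z, Submodule.mem_iInf]
  have hl : ∀ s, ∀ t ∈ Z, s * t ∈ Z := by
    intro s
    induction s using TensorAlgebra.induction with
    | algebraMap c => exact fun t ht => by simpa [← Algebra.smul_def] using Z.smul_mem c ht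
    | ι m =>
      refine fun t ht => hZ.2 fun k => ?_
      cases k with
      | zero => rw [hg.comp_zero_mul, map_zero]; exact zero_mem _
      | succ k => rw [hg.comp_succ_mul, map_mul, hE]; exact mul_mem_belowDeg j _ (hZ.1 ht k)
    | mul a b ha hb => exact fun t ht => by rw [mul_assoc]; exact ha _ (hb _ ht)
    | add a b ha hb => exact fun t ht => by rw [add_mul]; exact add_mem (ha _ ht) (hb _ ht)
  have hrt : ∀ s, ∀ t ∈ Z, t * s ∈ Z := by
    intro s
    induction s using TensorAlgebra.induction with
    | algebraMap c =>
      exact fun t ht => by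
        simpa [← Algebra.commutes, ← Algebra.smul_def] using Z.smul_mem c ht
    | ι m =>
      refine fun t ht => hZ.2 fun k => ?_
      cases k with
      | zero => rw [hg.comp_zero_mul_right, map_zero]; exact zero_mem _
      | succ k =>
        rw [hg.comp_succ_mul_right, map_mul, hE]; exact mul_mem_belowDeg_right j _ (hZ.1 ht k)
    | mul a b ha hb => exact fun t ht => by rw [← mul_assoc]; exact hb _ (ha _ ht)
    | add a b ha hb => exact fun t ht => by rw [mul_add]; exact add_mem (ha _ ht) (hb _ ht)
  let c : RingCon (TensorAlgebra K M) :=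
    { r := fun s t => s - t ∈ Z
      iseqv := ⟨fun s => by simp, fun {s t} hst => by simpa using neg_mem hst,
        fun {s t u} h1 h2 => by simpa using add_mem h1 h2⟩
      mul' := fun {a b c d} h1 h2 => by
        have := add_mem (hrt c _ h1) (hl b _ h2)
        simpa [sub_mul, mul_sub] using this
      add' := fun {a b c d} h1 h2 => by
        simpa [add_sub_add_comm] using add_mem h1 h2 }
  have hc : TensorAlgebra.symRingCon K M ≤ c := by
    refine RingCon.ringConGen_le.2 ?_
    rintro _ _ ⟨a, b⟩
    refine hZ.2 fun k => ?_
    have hab : ∀ a b : M, TensorAlgebra.ι K a * TensorAlgebra.ι K b ∈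
        powDeg (TensorAlgebra.ι K : M →ₗ[K] _) 2 := fun a b =>
      mul_mem_powDeg _ a (by simp [powDeg])
    rw [map_sub, hg.comp_apply (hab a b), hg.comp_apply (hab b a)]
    split_ifs with hk
    · subst hk
      simpa [hE] using hr a b
    · simp
  have h1 : c t 0 := hc ((RingCon.eq _).1 (h0.trans (map_zero (SymmetricAlgebra.algHom K M)).symm))
  have h2 := hZ.1 (show t - 0 ∈ Z from h1) k
  rwa [sub_zero, hg.comp_self ht] at h2

/-- First move all factors into the complement of h. A symbol that then dies in S(n) is a
combination of commutators, and in U(g) the commutator of two generators is their bracket, of degree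
one. -/
theorem isSymbolMap_toSN :
    IsSymbolMap h.incl LinearMap.id (fun _ _ => rfl) (SymmetricAlgebra.ι K (NormalMod h))
      (toSN h).toLinearMap where
  map_powDeg := map_toSN h
  mem_prev k t ht h0 := by
    have h1 := ofTensor_sub_tensorSection_mem h (φ := h.incl) (θ := LinearMap.id)
      (fun _ _ => rfl) (fun _ => rfl) ht
    have hn : toTN h t ∈ tensorDeg K (NormalMod h) k := by
      rw [tensorDeg, ← powDeg, ← map_toTN]; exact Submodule.mem_map_of_mem ht
    set ιU := (UniversalEnvelopingAlgebra.ι K :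
      g →ₗ⁅K⁆ UniversalEnvelopingAlgebra K g).toLinearMap with hι
    have h2 := mem_belowDeg_of_algHom_eq_zero ιU (normalSection h) (fun a b => by
      have : ιU (normalSection h a) * ιU (normalSection h b) -
          ιU (normalSection h b) * ιU (normalSection h a) =
          ιU ⁅normalSection h a, normalSection h b⁆ :=
        ((UniversalEnvelopingAlgebra.ι K).map_lie _ _).symm
      rw [this]
      exact powDeg_le_belowDeg _ one_lt_two (by simp [powDeg])) hn h0
    -- Elements of low degree in U(g) are images of tensors of low degree; this produces the lift
    -- `t'` that witnesses membership in the filtration.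
    rw [← belowDeg_map (TensorAlgebra.ι K) ιU (TensorAlgebra.lift K ιU) LinearMap.id
      Function.surjective_id (by simp)] at h2
    obtain ⟨t', ht', e⟩ := h2
    have h3 : ofTensor h.incl LinearMap.id (tensorSection h (toTN h t)) =
        ofTensor h.incl LinearMap.id t' := by
      change indMk _ (TensorAlgebra.lift K ιU _) = indMk _ (TensorAlgebra.lift K ιU _)
      congr 1
      refine Eq.trans ?_ e.symm
      rw [← AlgHom.comp_apply]
      congr 1
      ext c
      simp [tensorSection]
    rw [h3] at h1
    simpa using add_mem h1 (ofTensor_mem_prev h.incl LinearMap.id (fun _ _ => rfl) ht')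

end Symbols

/-! ### The action of the first order neighbourhood on the tensor algebra -/

section TensorAction

variable {K : Type u} [Field K] {g : Type v} [LieRing g] [LieAlgebra K g] (h : LieSubalgebra K g)

/-- The projection `g → h` along the image of a linear section of `g → n`. -/
def hPart : g →ₗ[K] h :=
  (LinearMap.id - normalSection h ∘ₗ (normalMk h).toLinearMap).codRestrict h.toSubmodule
    (fun a => sub_normalSection_mem h a)

theorem coe_hPart (a : g) : (hPart h a : g) = a - normalSection h (normalMk h a) := rfl

theorem hPart_coe (x : h) : hPart h x = x :=
  Subtype.ext (by rw [coe_hPart, (normalMk_eq_zero h).2 x.2, map_zero, sub_zero])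

theorem normalMk_coe (x : h) : normalMk h (x : g) = 0 := (normalMk_eq_zero h).2 x.2

/-- Left multiplication by `c ∈ n` on `T(n)`, together with its effect on the action of `h`. -/
def stepMap : NormalMod h →ₗ[K] Module.End K
    (TensorAlgebra K (NormalMod h) × (h →ₗ[K] TensorAlgebra K (NormalMod h))) :=
  LinearMap.mk₂ K
    (fun c p => (TensorAlgebra.ι K c * p.1,
      (LinearMap.mulRight K p.1 ∘ₗ TensorAlgebra.ι K ∘ₗ (normalMk h).toLinearMap +
        p.2 ∘ₗ hPart h) ∘ₗ (LieModule.toEnd K h g).toLinearMap.flip (normalSection h c) +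
      LinearMap.mulLeft K (TensorAlgebra.ι K c) ∘ₗ p.2))
    (fun c c' p => by ext <;> simp [add_mul]; abel)
    (fun a c p => by ext <;> simp)
    (fun c p p' => by ext <;> simp [mul_add]; abel)
    (fun a c p => by ext <;> simp)

/-- The action of `h` on `T(n)` given by `x · 1 = 0` and
`x · (c w) = [x, c] · w + c (x · w)` for `c ∈ n`, where `n` is embedded in `g` by a linear
section. -/
def hAct : h →ₗ[K] Module.End K (TensorAlgebra K (NormalMod h)) :=
  (LinearMap.snd K _ _ ∘ₗ LinearMap.applyₗ ((1, 0) : TensorAlgebra K (NormalMod h) ×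
    (h →ₗ[K] TensorAlgebra K (NormalMod h))) ∘ₗ
    (TensorAlgebra.lift K (stepMap h)).toLinearMap).flip

/-- The action of `g` on `T(n)`, where the chosen complement of `h` acts by left multiplication. -/
def gAct : g →ₗ[K] Module.End K (TensorAlgebra K (NormalMod h)) :=
  LinearMap.mul K _ ∘ₗ TensorAlgebra.ι K ∘ₗ (normalMk h).toLinearMap + hAct h ∘ₗ hPart h

theorem gAct_apply (a : g) (w : TensorAlgebra K (NormalMod h)) :
    gAct h a w = TensorAlgebra.ι K (normalMk h a) * w + hAct h (hPart h a) w := rfl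

theorem hAct_one (x : h) : hAct h x 1 = 0 := by
  change (TensorAlgebra.lift K (stepMap h) 1 (1, 0)).2 x = 0
  rw [map_one]; rfl

/-- The recursion for x · (c w) involves w as well as x · w, so it runs on pairs; the first entry
only rebuilds the tensor. -/
theorem lift_stepMap_fst (w : TensorAlgebra K (NormalMod h)) :
    (TensorAlgebra.lift K (stepMap h) w (1, 0)).1 = w := by
  refine isGradedBy_tensorAlgebra.induction
    (C := fun w => (TensorAlgebra.lift K (stepMap h) w (1, 0)).1 = w) ?_ ?_ ?_ ?_ w
  · rw [map_one]; rfl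
  · intro c w hw
    rw [map_smul, LinearMap.smul_apply, Prod.smul_fst, hw]
  · intro w w' hw hw'
    rw [map_add, LinearMap.add_apply, Prod.fst_add, hw, hw']
  · intro v w hw
    rw [map_mul, TensorAlgebra.lift_ι_apply, Module.End.mul_apply]
    exact congrArg (TensorAlgebra.ι K v * ·) hw

theorem hAct_mul (x : h) (c : NormalMod h) (w : TensorAlgebra K (NormalMod h)) :
    hAct h x (TensorAlgebra.ι K c * w) =
      gAct h ⁅x, normalSection h c⁆ w + TensorAlgebra.ι K c * hAct h x w := by
  have h1 : hAct h x (TensorAlgebra.ι K c * w) = (stepMap h c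
      (TensorAlgebra.lift K (stepMap h) w (1, 0))).2 x := by
    change (TensorAlgebra.lift K (stepMap h) (TensorAlgebra.ι K c * w) (1, 0)).2 x = _
    rw [map_mul, TensorAlgebra.lift_ι_apply, Module.End.mul_apply]
  have h2 : (stepMap h c (TensorAlgebra.lift K (stepMap h) w (1, 0))).2 x =
      TensorAlgebra.ι K (normalMk h ⁅x, normalSection h c⁆) *
        (TensorAlgebra.lift K (stepMap h) w (1, 0)).1 +
      hAct h (hPart h ⁅x, normalSection h c⁆) w + TensorAlgebra.ι K c * hAct h x w := rfl
  rw [h1, h2, lift_stepMap_fst, gAct_apply]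

theorem gAct_coe (x : h) : gAct h (x : g) = hAct h x := by
  ext1 w
  rw [gAct_apply, normalMk_coe, hPart_coe, map_zero, zero_mul, zero_add]

theorem normalSection_add_hPart (a : g) : normalSection h (normalMk h a) + (hPart h a : g) = a := by
  rw [coe_hPart]; abel

/-- For a in the complement the identity is the defining recursion `hAct_mul`; for a in h it is the
hypothesis. The vector `w` stays fixed, so that the lemma can serve inside the induction for
`hAct_lie`. -/
theorem gAct_lie_of_hAct_lie {w : TensorAlgebra K (NormalMod h)}
    (hw : ∀ x y, hAct h ⁅x, y⁆ w = hAct h x (hAct h y w) - hAct h y (hAct h x w)) (x : h) (a : g) :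
    gAct h ⁅x, a⁆ w = hAct h x (gAct h a w) - gAct h a (hAct h x w) := by
  have h1 : gAct h ⁅x, a⁆ w = gAct h ⁅x, normalSection h (normalMk h a)⁆ w +
      hAct h ⁅x, hPart h a⁆ w := by
    rw [← gAct_coe, ← LinearMap.add_apply, ← map_add]
    congr 2
    conv_lhs => rw [← normalSection_add_hPart h a, lie_add]
    rfl
  rw [h1, hw, gAct_apply h a w, gAct_apply h a (hAct h x w), map_add, hAct_mul]
  abel

/-- On c w the claim becomes an identity at w involving the action of [x, [y, c]] and [y, [x, c]].
The Jacobi identity and the inductive hypothesis, extended from h to g, settle it. -/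
theorem hAct_lie (x y : h) (w : TensorAlgebra K (NormalMod h)) :
    hAct h ⁅x, y⁆ w = hAct h x (hAct h y w) - hAct h y (hAct h x w) := by
  refine isGradedBy_tensorAlgebra.induction
    (C := fun w => ∀ x y, hAct h ⁅x, y⁆ w = hAct h x (hAct h y w) - hAct h y (hAct h x w))
    ?_ ?_ ?_ ?_ w x y
  · simp [hAct_one]
  · intro c w hw x y
    simp only [map_smul, hw, smul_sub]
  · intro w w' hw hw' x y
    simp only [map_add, hw, hw']; abel
  · intro c w hw x y
    have key := gAct_lie_of_hAct_lie h hw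
    have h1 : gAct h ⁅⁅x, y⁆, normalSection h c⁆ w =
        gAct h ⁅x, ⁅y, normalSection h c⁆⁆ w - gAct h ⁅y, ⁅x, normalSection h c⁆⁆ w := by
      rw [lie_lie, map_sub, LinearMap.sub_apply]
    rw [hAct_mul, h1, key x ⁅y, normalSection h c⁆, key y ⁅x, normalSection h c⁆, hw, hAct_mul h y, hAct_mul h x, map_add, map_add, hAct_mul h x,
      hAct_mul h y, mul_sub]
    abel

theorem gAct_lie (x : h) (a : g) (w : TensorAlgebra K (NormalMod h)) :
    gAct h ⁅x, a⁆ w = hAct h x (gAct h a w) - gAct h a (hAct h x w) :=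
  gAct_lie_of_hAct_lie h (fun x y => hAct_lie h x y w) x a

/-- In x · (c w) the factor c is traded for the class of [x, c], or for a further action of h on w,
so the degree never grows. -/
theorem hAct_mem_belowDeg (x : h) {k : ℕ} {w : TensorAlgebra K (NormalMod h)}
    (hw : w ∈ belowDeg (TensorAlgebra.ι K : NormalMod h →ₗ[K] _) k) :
    hAct h x w ∈ belowDeg (TensorAlgebra.ι K : NormalMod h →ₗ[K] _) k := by
  refine mem_belowDeg_of_forall_powDeg (fun k w hw => ?_) hw
  refine powDeg_induction (j := (TensorAlgebra.ι K : NormalMod h →ₗ[K] _))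
    (C := fun k w => ∀ x, hAct h x w ∈ belowDeg (TensorAlgebra.ι K) (k + 1)) ?_ ?_ ?_ ?_ hw x
  · intro x
    rw [hAct_one]; exact zero_mem _
  · intro k c w hw x
    rw [map_smul]; exact Submodule.smul_mem _ c (hw x)
  · intro k w w' hw hw' x
    rw [map_add]; exact add_mem (hw x) (hw' x)
  · intro k c w hw1 hw x
    rw [hAct_mul, gAct_apply]
    exact add_mem (add_mem (powDeg_le_belowDeg _ (Nat.lt_succ_self _) (mul_mem_powDeg _ _ hw1))
      (belowDeg_mono _ (Nat.le_succ _) (hw _))) (mul_mem_belowDeg _ _ (hw x))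

/-- The relations of h⁽¹⁾ involve only brackets of h with g, so `gAct_lie` is all that is needed;
two elements of the complement satisfy no relation that would have to be checked. -/
theorem exists_isFilteredRetraction_toTN :
    ∃ π, IsFilteredRetraction (nbhdIncl h) (nbhdOf h) (TensorAlgebra.ι K)
      (toTN h).toLinearMap π := by
  let B : Nbhd h →ₗ⁅K⁆ Module.End K (TensorAlgebra K (NormalMod h)) :=
    nbhdLift h (gAct h) (fun x a => by
      ext1 w
      rw [gAct_coe]
      exact gAct_lie h x a w)
  have hB : ∀ a, B (nbhdOf h a) = gAct h a := nbhdLift_of h _ _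
  refine ⟨orbitMap (nbhdIncl h) B fun x => ?_, isFilteredRetraction_orbitMap _ _ _ _ _
    (normalMk h).toLinearMap _ (toTN_ι h) fun a k w hw => ?_⟩
  · change B (nbhdOf h x) 1 = 0
    rw [hB, gAct_coe, hAct_one]
  · rw [hB, gAct_apply]
    simpa using hAct_mem_belowDeg h _ hw

end TensorAction

/-! ### The splitting attached to a representation of the first order neighbourhood -/

section PBWMap

variable {K : Type u} [Field K] {g : Type v} [LieRing g] [LieAlgebra K g] (h : LieSubalgebra K g)

/-- The map `f ↦ derT f`, as a linear map. -/
def derTHom {M : Type*} [AddCommGroup M] [Module K M] :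
    Module.End K M →ₗ[K] Module.End K (TensorAlgebra K M) where
  toFun := derT
  map_add' f f' := LinearMap.ext (derT_add f f')
  map_smul' c f := LinearMap.ext (derT_smul c f)

theorem derT_mem_belowDeg {M : Type*} [AddCommGroup M] [Module K M] (f : M →ₗ[K] M) {k : ℕ}
    {t : TensorAlgebra K M} (ht : t ∈ belowDeg (TensorAlgebra.ι K : M →ₗ[K] _) k) :
    derT f t ∈ belowDeg (TensorAlgebra.ι K : M →ₗ[K] _) k :=
  mem_belowDeg_of_forall_powDeg
    (fun k _ hw => powDeg_le_belowDeg _ k.lt_succ_self (derT_mem f hw)) ht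

/-- `a ∈ g` acts on `T(n)` by `w ↦ ā w + ρ(a) w`. -/
def repAct (ρ : NbhdRep h (NormalMod h)) :
    g →ₗ[K] Module.End K (TensorAlgebra K (NormalMod h)) :=
  LinearMap.mul K _ ∘ₗ TensorAlgebra.ι K ∘ₗ (normalMk h).toLinearMap +
    derTHom ∘ₗ ρ.toLinearMap ∘ₗ nbhdOf h

theorem repAct_apply (ρ : NbhdRep h (NormalMod h)) (a : g) (w : TensorAlgebra K (NormalMod h)) :
    repAct h ρ a w = TensorAlgebra.ι K (normalMk h a) * w + derT (ρ (nbhdOf h a)) w := rfl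

variable {h} {ρ : NbhdRep h (NormalMod h)}

theorem repAct_coe (x : h) (w : TensorAlgebra K (NormalMod h)) :
    repAct h ρ (x : g) w = derT (ρ (nbhdOf h x)) w := by
  rw [repAct_apply, normalMk_coe, map_zero, zero_mul, zero_add]

/-- The commutator of the derivation ρ(x) with multiplication by the class of a is multiplication by
ρ(x) applied to that class. Since ρ extends the action of h, this is the class of [x, a]. -/
theorem repAct_lie (hρ : IsExtension h ρ) (x : h) (a : g) :
    repAct h ρ ⁅(x : g), a⁆ = ⁅repAct h ρ x, repAct h ρ a⁆ := by
  ext1 w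
  have h1 : derT (ρ (nbhdOf h ⁅(x : g), a⁆)) w = derT (ρ (nbhdOf h x)) (derT (ρ (nbhdOf h a)) w) -
      derT (ρ (nbhdOf h a)) (derT (ρ (nbhdOf h x)) w) := by
    rw [nbhdOf_lie, LieHom.map_lie, ← derT_lie]; rfl
  have h2 : normalMk h ⁅(x : g), a⁆ = ρ (nbhdOf h x) (normalMk h a) :=
    ((normalMk h).map_lie x a).trans (hρ x _).symm
  have h3 : ⁅repAct h ρ x, repAct h ρ a⁆ w =
    repAct h ρ x (repAct h ρ a w) - repAct h ρ a (repAct h ρ x w) := rfl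
  rw [h3, repAct_coe, repAct_coe, repAct_apply, repAct_apply, repAct_apply, map_add, derT_mul,
    derT_ι, h1, h2]
  abel

/-- The orbit map of `repAct` is h-linear because h acts through the derivations extending its
action on n. Its inverse is s, and the recursion for s restates that a acts as multiplication by its
class plus ρ(a). -/
theorem exists_isPBWMap (hρ : IsExtension h ρ) :
    ∃ s : TensorAlgebra K (NormalMod h) ≃ₗ⁅K,h⁆ UNbhd h, IsPBWMap h ρ s ∧ SplitsF h s := by
  let B : Nbhd h →ₗ⁅K⁆ Module.End K (TensorAlgebra K (NormalMod h)) :=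
    nbhdLift h (repAct h ρ) (repAct_lie hρ)
  have hB : ∀ a, B (nbhdOf h a) = repAct h ρ a := nbhdLift_of h _ _
  have hB1 : ∀ x, B (nbhdIncl h x) 1 = 0 := fun x => by
    change B (nbhdOf h x) 1 = 0
    rw [hB, repAct_coe, ← map_one (algebraMap K _), derT_algebraMap]
  have hπ : IsFilteredRetraction (nbhdIncl h) (nbhdOf h) (TensorAlgebra.ι K)
      (toTN h).toLinearMap (orbitMap (nbhdIncl h) B hB1) :=
    isFilteredRetraction_orbitMap _ _ _ _ _ (normalMk h).toLinearMap _ (toTN_ι h)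
      fun a k w hw => by
        rw [hB, repAct_apply]
        simpa using derT_mem_belowDeg _ hw
  have hs := orbitMap_smul (nbhdIncl h) B hB1
  have h1 := orbitMap_one (nbhdIncl h) B hB1
  set π := orbitMap (nbhdIncl h) B hB1
  have hb := hπ.bijective isGradedBy_tensorAlgebra (isSymbolMap_toTN h) (projF_surjective h)
  let e : UNbhd h ≃ₗ⁅K,h⁆ TensorAlgebra K (NormalMod h) :=
    { LinearEquiv.ofBijective π hb with
      map_lie' := by
        intro x y
        change π (UniversalEnvelopingAlgebra.ι K (nbhdOf h x) • y) = derT _ (π y)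
        rw [hs, hB, repAct_coe]
        congr 1
        congr 1
        ext1 c
        exact hρ x c }
  have he : ∀ y, e y = π y := fun _ => rfl
  refine ⟨e.symm, ⟨?_, ?_⟩, ?_⟩
  · change e.symm 1 = _
    rw [← h1, ← he, e.symm_apply_apply]
  · intro a w
    change e.symm _ = UniversalEnvelopingAlgebra.ι K (nbhdOf h a) • e.symm w - e.symm _
    apply e.injective
    rw [map_sub, e.apply_symm_apply, e.apply_symm_apply, he, hs, hB, repAct_apply, ← he,
      e.apply_symm_apply, add_sub_cancel_right]
  · have := hπ.isFilteredSection (s := e.symm.toLieModuleHom.toLinearMap) isGradedBy_tensorAlgebra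
      (isSymbolMap_toTN h) (projF_surjective h) (fun w => e.apply_symm_apply w)
    exact this

end PBWMap

/-! ### The relative Poincaré–Birkhoff–Witt theorem -/

section Monomials

variable {K : Type*} [Field K] {N : Type*} [AddCommGroup N] [Module K N]
variable {I : Type*} (b : Module.Basis I K N)

/-- The monomial in the symmetric algebra given by a multiset of basis vectors. -/
def mon (M : Multiset I) : SymmetricAlgebra K N :=
  (M.map fun i => SymmetricAlgebra.ι K N (b i)).prod

@[simp]
theorem mon_zero : mon b 0 = 1 := by simp [mon]

theorem mon_cons (i : I) (M : Multiset I) :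
    mon b (i ::ₘ M) = SymmetricAlgebra.ι K N (b i) * mon b M := by simp [mon]

/-- The monomial basis of the symmetric algebra. -/
def monBasis : Module.Basis (Multiset I) K (SymmetricAlgebra K N) :=
  haveI := Classical.decEq I
  b.symmetricAlgebra.reindex Multiset.toFinsupp.symm.toEquiv

theorem monBasis_apply (M : Multiset I) : monBasis b M = mon b M := by
  classical
  obtain ⟨f, rfl⟩ := (Multiset.toFinsupp (α := I)).symm.surjective M
  have h1 : monBasis b (Multiset.toFinsupp.symm f) = b.symmetricAlgebra f := by
    rw [monBasis, Module.Basis.reindex_apply]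
    congr 1
    exact (Multiset.toFinsupp (α := I)).apply_symm_apply f
  have h2 : b.symmetricAlgebra f =
      (SymmetricAlgebra.equivMvPolynomial b).symm (MvPolynomial.monomial f 1) := by
    simp [Module.Basis.symmetricAlgebra]
  rw [h1, h2, mon, Multiset.toFinsupp_symm_apply, Finsupp.toMultiset_map, Finsupp.prod_toMultiset,
    MvPolynomial.monomial_eq, map_mul, map_one, map_one, one_mul, Finsupp.prod, map_prod,
    Finsupp.prod_mapDomain_index (by simp) (by intros; rw [pow_add])]
  simp [Finsupp.prod]

theorem mon_mem_powDeg (M : Multiset I) :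
    mon b M ∈ powDeg (SymmetricAlgebra.ι K N) M.card := by
  induction M using Multiset.induction_on with
  | empty => simpa using one_mem_powDeg _
  | cons i M ih =>
    rw [mon_cons, Multiset.card_cons]
    exact mul_mem_powDeg _ _ ih

theorem mon_mem_belowDeg {M : Multiset I} {k : ℕ} (hM : M.card < k) :
    mon b M ∈ belowDeg (SymmetricAlgebra.ι K N) k :=
  powDeg_le_belowDeg _ hM (mon_mem_powDeg b M)

/-- A subspace that contains the monomials of degree less than `k` contains all elements of degree
less than `k`. -/
theorem belowDeg_le_of_mon {k : ℕ} {P : Submodule K (SymmetricAlgebra K N)}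
    (hP : ∀ M : Multiset I, M.card < k → mon b M ∈ P) :
    belowDeg (SymmetricAlgebra.ι K N) k ≤ P := by
  refine iSup₂_le fun i hi w hw => ?_
  have key : w ∈ Submodule.span K {w | ∃ M : Multiset I, M.card = i ∧ mon b M = w} := by
    refine powDeg_induction (j := SymmetricAlgebra.ι K N)
      (C := fun i w => w ∈ Submodule.span K {w | ∃ M : Multiset I, M.card = i ∧ mon b M = w})
      ?_ ?_ ?_ ?_ hw
    · exact Submodule.subset_span ⟨0, rfl, mon_zero b⟩
    · exact fun k c w hw => Submodule.smul_mem _ c hw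
    · exact fun k w w' hw hw' => add_mem hw hw'
    · intro k v w hwk hw
      clear hwk
      have hv : v ∈ Submodule.span K (Set.range b) := b.mem_span v
      induction hv using Submodule.span_induction with
      | mem v hv =>
        obtain ⟨i, rfl⟩ := hv
        induction hw using Submodule.span_induction with
        | mem w hw =>
          obtain ⟨M, rfl, rfl⟩ := hw
          exact Submodule.subset_span ⟨i ::ₘ M, Multiset.card_cons _ _, mon_cons b i M⟩
        | zero => rw [mul_zero]; exact zero_mem _
        | add w w' _ _ h1 h2 => rw [mul_add]; exact add_mem h1 h2
        | smul c w _ h1 => rw [mul_smul_comm]; exact Submodule.smul_mem _ c h1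
      | zero => rw [map_zero, zero_mul]; exact zero_mem _
      | add w w' _ _ h1 h2 => rw [map_add, add_mul]; exact add_mem h1 h2
      | smul c w _ h1 => rw [map_smul, smul_mul_assoc]; exact Submodule.smul_mem _ c h1
  refine (Submodule.span_le.2 ?_ : _ ≤ P) key
  rintro _ ⟨M, rfl, rfl⟩
  exact hP M hi

variable [LinearOrder I]

/-- The recursion on monomials strips the smallest index; `min_cons_inj` shows that the choice made
here is harmless. -/
theorem exists_eq_min_cons {M : Multiset I} (hM : M ≠ 0) :
    ∃ p : I × Multiset I, M = p.1 ::ₘ p.2 ∧ ∀ i ∈ p.2, p.1 ≤ i := by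
  obtain ⟨k, hk, hmin⟩ := M.toFinset.exists_min_image id
    (Multiset.toFinset_nonempty.2 hM)
  obtain ⟨P, rfl⟩ := Multiset.exists_cons_of_mem (Multiset.mem_toFinset.1 hk)
  exact ⟨(k, P), rfl, fun i hi =>
    hmin i (Multiset.mem_toFinset.2 (Multiset.mem_cons_of_mem hi))⟩

theorem min_cons_inj {k k' : I} {P P' : Multiset I} (h : k ::ₘ P = k' ::ₘ P')
    (hk : ∀ i ∈ P, k ≤ i) (hk' : ∀ i ∈ P', k' ≤ i) : k = k' ∧ P = P' := by
  have h1 : k' ≤ k := by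
    have : k ∈ k' ::ₘ P' := h ▸ Multiset.mem_cons_self k P
    rcases Multiset.mem_cons.1 this with rfl | h
    exacts [le_rfl, hk' _ h]
  have h2 : k ≤ k' := by
    have : k' ∈ k ::ₘ P := h ▸ Multiset.mem_cons_self k' P'
    rcases Multiset.mem_cons.1 this with rfl | h
    exacts [le_rfl, hk _ h]
  obtain rfl := le_antisymm h2 h1
  exact ⟨rfl, (Multiset.cons_inj_right k).1 h⟩

end Monomials

/-! ### Construction of the action of g on S(n) from ordered monomials. -/

section PBW

variable {K : Type u} [Field K] {g : Type v} [LieRing g] [LieAlgebra K g] (h : LieSubalgebra K g)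
variable {I : Type*} (b : Module.Basis I K (NormalMod h))

/-- The lift to `g` of a basis vector of `n`. -/
def liftVec (i : I) : g := normalSection h (b i)

theorem normalMk_liftVec (i : I) : normalMk h (liftVec h b i) = b i :=
  normalMk_normalSection h (b i)

theorem span_liftVec_sup : Submodule.span K (Set.range (liftVec h b)) ⊔ h.toSubmodule = ⊤ := by
  refine eq_top_iff.2 fun a _ => ?_
  have h1 : normalSection h (normalMk h a) ∈ Submodule.span K (Set.range (liftVec h b)) := by
    have : (Submodule.span K (Set.range b)).map (normalSection h) =
        Submodule.span K (Set.range (liftVec h b)) := by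
      rw [Submodule.map_span, ← Set.range_comp]; rfl
    rw [← this]
    exact Submodule.mem_map_of_mem (b.mem_span _)
  have := Submodule.add_mem_sup h1 (sub_normalSection_mem h a)
  rwa [add_sub_cancel] at this

/-- A subspace that contains `h` and the lifts of the basis vectors is everything. -/
theorem mem_of_liftVec {P : Submodule K g} (h1 : ∀ i, liftVec h b i ∈ P) (h2 : ∀ x : h, (x : g) ∈ P)
    (a : g) : a ∈ P := by
  have : (⊤ : Submodule K g) ≤ P := by
    rw [← span_liftVec_sup h b]
    refine sup_le (Submodule.span_le.2 ?_) fun x hx => h2 ⟨x, hx⟩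
    rintro _ ⟨i, rfl⟩
    exact h1 i
  exact this trivial

variable [LinearOrder I]

/-- The span of `h` and the lifts of the basis vectors with index greater than `k`. -/
def upper (k : I) : Submodule K g :=
  Submodule.span K (liftVec h b '' Set.Ioi k) ⊔ h.toSubmodule

/-- The projection of `g` that kills the lifts of the basis vectors with index at most `k`. -/
def upperProj (k : I) : g →ₗ[K] g :=
  LinearMap.id - b.constr K (fun i => if i ≤ k then liftVec h b i else 0) ∘ₗ
    (normalMk h).toLinearMap

theorem upperProj_liftVec (k i : I) :
    upperProj h b k (liftVec h b i) = if i ≤ k then 0 else liftVec h b i := by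
  have : upperProj h b k (liftVec h b i) = liftVec h b i -
      b.constr K (fun i => if i ≤ k then liftVec h b i else 0) (normalMk h (liftVec h b i)) := rfl
  rw [this, normalMk_liftVec, Module.Basis.constr_basis]
  split_ifs <;> simp

theorem upperProj_coe (k : I) (x : h) : upperProj h b k x = x := by
  have : upperProj h b k x = x -
      b.constr K (fun i => if i ≤ k then liftVec h b i else 0) (normalMk h x) := rfl
  rw [this, normalMk_coe, map_zero, sub_zero]

theorem upperProj_of_mem {k : I} {a : g} (ha : a ∈ upper h b k) : upperProj h b k a = a := by
  have : upper h b k ≤ LinearMap.eqLocus (upperProj h b k) LinearMap.id := by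
    refine sup_le (Submodule.span_le.2 ?_) fun x hx => upperProj_coe h b k ⟨x, hx⟩
    rintro _ ⟨i, hi, rfl⟩
    exact (upperProj_liftVec h b k i).trans (if_neg (not_le_of_gt hi))
  exact this ha

theorem mem_of_upper {P : Submodule K g} (k : I) (h1 : ∀ i ≤ k, liftVec h b i ∈ P)
    (h2 : upper h b k ≤ P) (a : g) : a ∈ P := by
  refine mem_of_liftVec h b (fun i => ?_) (fun x => h2 (Submodule.mem_sup_right x.2)) a
  by_cases hi : i ≤ k
  · exact h1 i hi
  · exact h2 (Submodule.mem_sup_left (Submodule.subset_span ⟨i, not_le.1 hi, rfl⟩))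

omit [LinearOrder I] in
theorem eq_zero_of_liftVec {V : Type*} [AddCommGroup V] [Module K V] (f : g →ₗ[K] V)
    (h1 : ∀ i, f (liftVec h b i) = 0) (h2 : ∀ x : h, f x = 0) (a : g) : f a = 0 :=
  mem_of_liftVec h b (P := LinearMap.ker f) h1 h2 a

theorem eq_zero_of_upper {V : Type*} [AddCommGroup V] [Module K V] (f : g →ₗ[K] V) (k : I)
    (h1 : ∀ i ≤ k, f (liftVec h b i) = 0) (h2 : ∀ x ∈ upper h b k, f x = 0) (a : g) : f a = 0 :=
  mem_of_upper h b (P := LinearMap.ker f) k h1 h2 a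

local notation "SN" => SymmetricAlgebra K (NormalMod h)

/-- Multiplication by the class of an element of `g`. -/
def mulN : g →ₗ[K] Module.End K SN :=
  LinearMap.mul K SN ∘ₗ SymmetricAlgebra.ι K (NormalMod h) ∘ₗ (normalMk h).toLinearMap

theorem mulN_apply (a : g) (w : SN) :
    mulN h a w = SymmetricAlgebra.ι K (NormalMod h) (normalMk h a) * w := rfl

/-- The right-hand side of the recursion for the lower order part of the action of `g`. -/
def stepVal (D : g →ₗ[K] Module.End K SN) (k : I) (w : SN) : g →ₗ[K] SN :=
  (mulN h (liftVec h b k) ∘ₗ D.flip w + D (liftVec h b k) ∘ₗ D.flip w +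
    ((mulN h).flip w + D.flip w) ∘ₗ (LieModule.toEnd K g g).toLinearMap.flip (liftVec h b k)) ∘ₗ
    upperProj h b k

/-- Let c be the lift of the k-th basis vector and let a act by ā + D(a). The action must satisfy
a·(c·w) = c·(a·w) + [a, c]·w. For a in `upper` and w an ordered monomial with indices at least k,
the leading term of c·(ā w) cancels against ā c̄ w, and what remains is the value prescribed for
D(a)(c̄ w). The projection discards the lifts with index at most k, which act on such a monomial by
plain multiplication. -/
theorem stepVal_apply (D : g →ₗ[K] Module.End K SN) (k : I) (w : SN) (a : g) :
    stepVal h b D k w a =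
      mulN h (liftVec h b k) (D (upperProj h b k a) w) +
      D (liftVec h b k) (D (upperProj h b k a) w) +
      (mulN h ⁅upperProj h b k a, liftVec h b k⁆ w + D ⁅upperProj h b k a, liftVec h b k⁆ w) := rfl

open Classical in
/-- One step of the recursion for the lower order part of the action of `g` on `S(n)`. -/
def stepD (D : g →ₗ[K] Module.End K SN) : g →ₗ[K] Module.End K SN :=
  ((monBasis b).constr K fun M => if hM : M = 0 then (0 : g →ₗ[K] SN) else
    stepVal h b D (exists_eq_min_cons hM).choose.1
      (mon b (exists_eq_min_cons hM).choose.2)).flip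

theorem stepD_one (D : g →ₗ[K] Module.End K SN) (a : g) : stepD h b D a 1 = 0 := by
  rw [← mon_zero b, ← monBasis_apply, stepD, LinearMap.flip_apply, Module.Basis.constr_basis,
    dif_pos rfl, LinearMap.zero_apply]

theorem stepD_cons (D : g →ₗ[K] Module.End K SN) (a : g) {k : I} {P : Multiset I}
    (hk : ∀ i ∈ P, k ≤ i) :
    stepD h b D a (mon b (k ::ₘ P)) = stepVal h b D k (mon b P) a := by
  have hM : k ::ₘ P ≠ 0 := Multiset.cons_ne_zero
  obtain ⟨h1, h2⟩ := (exists_eq_min_cons hM).choose_spec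
  obtain ⟨h3, h4⟩ := min_cons_inj h1 hk h2
  rw [← monBasis_apply, stepD, LinearMap.flip_apply, Module.Basis.constr_basis, dif_neg hM, ← h3,
    ← h4]

/-- The approximations to the lower order part of the action of `g`; the `m`-th is correct in
degrees at most `m`. -/
def approxD : ℕ → g →ₗ[K] Module.End K SN
  | 0 => 0
  | m + 1 => stepD h b (approxD m)

theorem approxD_one (m : ℕ) (a : g) : approxD h b m a 1 = 0 := by
  cases m with
  | zero => rfl
  | succ m => exact stepD_one h b _ a

theorem approxD_mem (m : ℕ) (a : g) {k : ℕ} {w : SN}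
    (hw : w ∈ belowDeg (SymmetricAlgebra.ι K (NormalMod h)) k) :
    approxD h b m a w ∈ belowDeg (SymmetricAlgebra.ι K (NormalMod h)) k := by
  induction m generalizing a k w with
  | zero => exact zero_mem _
  | succ m ih =>
    refine (belowDeg_le_of_mon b (P := (belowDeg _ k).comap (approxD h b (m + 1) a))
      fun M hM => ?_) hw
    rw [Submodule.mem_comap]
    by_cases hM0 : M = 0
    · rw [hM0, mon_zero, approxD_one]; exact zero_mem _
    · obtain ⟨⟨i, P⟩, rfl, hi⟩ := exists_eq_min_cons hM0
      rw [approxD, stepD_cons h b _ a hi, stepVal_apply]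
      have hP : mon b P ∈ belowDeg (SymmetricAlgebra.ι K (NormalMod h)) (P.card + 1) :=
        mon_mem_belowDeg b P.card.lt_succ_self
      -- The monomial has `P.card + 1` factors and `belowDeg` is a strict bound, hence the 2.
      have hk : P.card + 2 ≤ k := by simpa [Nat.succ_le_iff] using hM
      refine belowDeg_mono _ hk ?_
      have h1 := ih (upperProj h b i a) hP
      exact add_mem (add_mem (mul_mem_belowDeg _ _ h1)
          (belowDeg_mono _ (Nat.le_succ _) (ih _ h1)))
        (add_mem (mul_mem_belowDeg _ _ hP) (belowDeg_mono _ (Nat.le_succ _) (ih _ hP)))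

/-- On a monomial of degree m + 1 the step evaluates the previous approximation only on vectors of
degree at most m. This includes the nested application, because the approximations do not raise
degree (`approxD_mem`). -/
theorem approxD_succ (m : ℕ) (a : g) {w : SN}
    (hw : w ∈ belowDeg (SymmetricAlgebra.ι K (NormalMod h)) (m + 1)) :
    approxD h b (m + 1) a w = approxD h b m a w := by
  induction m generalizing a w with
  | zero =>
    refine (belowDeg_le_of_mon b
      (P := LinearMap.eqLocus (approxD h b 1 a) (approxD h b 0 a)) fun M hM => ?_) hw
    have : M = 0 := Multiset.card_eq_zero.1 (Nat.lt_one_iff.1 hM)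
    rw [LinearMap.mem_eqLocus, this, mon_zero, approxD_one, approxD_one]
  | succ m ih =>
    refine (belowDeg_le_of_mon b
      (P := LinearMap.eqLocus (approxD h b (m + 2) a) (approxD h b (m + 1) a)) fun M hM => ?_) hw
    rw [LinearMap.mem_eqLocus]
    by_cases hM0 : M = 0
    · rw [hM0, mon_zero, approxD_one, approxD_one]
    · obtain ⟨⟨i, P⟩, rfl, hi⟩ := exists_eq_min_cons hM0
      have hP : mon b P ∈ belowDeg (SymmetricAlgebra.ι K (NormalMod h)) (m + 1) :=
        mon_mem_belowDeg b (by simpa using hM)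
      rw [approxD, approxD, stepD_cons h b _ a hi, stepD_cons h b _ a hi, stepVal_apply,
        stepVal_apply]
      change mulN h _ (approxD h b (m + 1) _ _) + approxD h b (m + 1) _ (approxD h b (m + 1) _ _) +
        (_ + approxD h b (m + 1) _ _) = _
      rw [ih _ hP, ih _ (approxD_mem h b m _ hP), ih _ hP]

/-- The lower order part of the action of `g` on `S(n)`. -/
def lowD : g →ₗ[K] Module.End K SN :=
  ((monBasis b).constr K fun M => (approxD h b M.card).flip (mon b M)).flip

theorem lowD_eq {m : ℕ} (a : g) {w : SN}
    (hw : w ∈ belowDeg (SymmetricAlgebra.ι K (NormalMod h)) (m + 1)) :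
    lowD h b a w = approxD h b m a w := by
  refine (belowDeg_le_of_mon b
    (P := LinearMap.eqLocus (lowD h b a) (approxD h b m a)) fun M hM => ?_) hw
  have h1 : lowD h b a (mon b M) = approxD h b M.card a (mon b M) := by
    conv_lhs => rw [← monBasis_apply, lowD, LinearMap.flip_apply, Module.Basis.constr_basis]
    rfl
  rw [LinearMap.mem_eqLocus, h1]
  have hle : M.card ≤ m := Nat.lt_succ_iff.1 hM
  clear hM hw
  induction m, hle using Nat.le_induction with
  | base => rfl
  | succ n hn ih => rw [ih, approxD_succ h b n a (mon_mem_belowDeg b (Nat.lt_succ_of_le hn))]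

theorem lowD_one (a : g) : lowD h b a 1 = 0 := by
  rw [lowD_eq h b (m := 0) a (powDeg_le_belowDeg _ one_pos (one_mem_powDeg _)), approxD_one]

theorem lowD_mem (a : g) {k : ℕ} {w : SN}
    (hw : w ∈ belowDeg (SymmetricAlgebra.ι K (NormalMod h)) k) :
    lowD h b a w ∈ belowDeg (SymmetricAlgebra.ι K (NormalMod h)) k := by
  rw [lowD_eq h b a (belowDeg_mono _ k.le_succ hw)]
  exact approxD_mem h b k a hw

theorem lowD_cons (a : g) {k : I} {P : Multiset I} (hk : ∀ i ∈ P, k ≤ i) :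
    lowD h b a (mon b (k ::ₘ P)) = stepVal h b (lowD h b) k (mon b P) a := by
  have hP : mon b P ∈ belowDeg (SymmetricAlgebra.ι K (NormalMod h)) (P.card + 1) :=
    mon_mem_belowDeg b P.card.lt_succ_self
  rw [lowD_eq h b a (m := P.card + 1) (mon_mem_belowDeg b (by simp)), approxD,
    stepD_cons h b _ a hk, stepVal_apply, stepVal_apply, lowD_eq h b _ hP, lowD_eq h b _ hP,
    lowD_eq h b _ (approxD_mem h b _ _ hP)]

/-- The action of `g` on `S(n)`. -/
def symAct : g →ₗ[K] Module.End K SN := mulN h + lowD h b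

theorem symAct_apply (a : g) (w : SN) : symAct h b a w = mulN h a w + lowD h b a w := rfl

theorem symAct_coe_one (x : h) : symAct h b x 1 = 0 := by
  rw [symAct_apply, lowD_one, mulN_apply, normalMk_coe, map_zero, zero_mul, add_zero]

omit [LinearOrder I] in
theorem mulN_liftVec_mon (i : I) (M : Multiset I) :
    mulN h (liftVec h b i) (mon b M) = mon b (i ::ₘ M) := by
  rw [mulN_apply, normalMk_liftVec, mon_cons]

/-- The projection attached to the smallest index of `M` kills the lift of the k-th basis vector, so
its lower order part vanishes on the monomial. -/
theorem symAct_liftVec_mon {k : I} {M : Multiset I} (hk : ∀ i ∈ M, k ≤ i) :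
    symAct h b (liftVec h b k) (mon b M) = mon b (k ::ₘ M) := by
  rw [symAct_apply, mulN_liftVec_mon, add_eq_left]
  by_cases hM : M = 0
  · rw [hM, mon_zero, lowD_one]
  · obtain ⟨⟨i, P⟩, rfl, hi⟩ := exists_eq_min_cons hM
    rw [lowD_cons h b _ hi, stepVal_apply, upperProj_liftVec,
      if_pos (hk i (Multiset.mem_cons_self _ _))]
    simp

/-- Multiplying by the class of `a` produces monomials with all indices at least k, or zero when `a`
lies in h; `symAct_liftVec_mon` applies to each. -/
theorem symAct_liftVec_mulN {k : I} {M : Multiset I} (hk : ∀ i ∈ M, k ≤ i) {a : g}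
    (ha : a ∈ upper h b k) :
    symAct h b (liftVec h b k) (mulN h a (mon b M)) =
      mulN h (liftVec h b k) (mulN h a (mon b M)) := by
  have : upper h b k ≤ LinearMap.eqLocus (symAct h b (liftVec h b k) ∘ₗ (mulN h).flip (mon b M))
      (mulN h (liftVec h b k) ∘ₗ (mulN h).flip (mon b M)) := by
    refine sup_le (Submodule.span_le.2 ?_) fun x hx => ?_
    · rintro _ ⟨i, hi, rfl⟩
      change symAct h b (liftVec h b k) (mulN h (liftVec h b i) (mon b M)) =
        mulN h (liftVec h b k) (mulN h (liftVec h b i) (mon b M))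
      rw [mulN_liftVec_mon, mulN_liftVec_mon, symAct_liftVec_mon]
      intro l hl
      rcases Multiset.mem_cons.1 hl with rfl | hl
      exacts [le_of_lt hi, hk l hl]
    · change symAct h b (liftVec h b k) (mulN h x (mon b M)) =
        mulN h (liftVec h b k) (mulN h x (mon b M))
      have : mulN h x (mon b M) = 0 := by
        rw [mulN_apply, normalMk_coe h ⟨x, hx⟩, map_zero, zero_mul]
      rw [this, map_zero, map_zero]
  exact this ha

/-! ### Commutation relations for the action on S(n). -/

/-- The failure of `symAct` to be an action on the vector `w`. -/
def defect (w : SN) : g →ₗ[K] g →ₗ[K] SN :=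
  LinearMap.mk₂ K (fun a a' => symAct h b a (symAct h b a' w) - symAct h b a' (symAct h b a w) -
      symAct h b ⁅a, a'⁆ w)
    (fun a a' a'' => by simp only [map_add, LinearMap.add_apply, add_lie]; abel)
    (fun c a a' => by simp only [map_smul, LinearMap.smul_apply, smul_lie, smul_sub])
    (fun a a' a'' => by simp only [map_add, LinearMap.add_apply, lie_add]; abel)
    (fun c a a' => by simp only [map_smul, LinearMap.smul_apply, lie_smul, smul_sub])

theorem defect_apply (w : SN) (a a' : g) : defect h b w a a' =
    symAct h b a (symAct h b a' w) - symAct h b a' (symAct h b a w) - symAct h b ⁅a, a'⁆ w := rfl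

theorem defect_swap (w : SN) (a a' : g) : defect h b w a a' = - defect h b w a' a := by
  rw [defect_apply, defect_apply, ← lie_skew a' a, map_neg, LinearMap.neg_apply]; abel

theorem defect_eq_zero_swap {w : SN} {a a' : g} (h1 : defect h b w a a' = 0) :
    defect h b w a' a = 0 := by
  rw [defect_swap, h1, neg_zero]

theorem defect_add (w w' : SN) (a a' : g) :
    defect h b (w + w') a a' = defect h b w a a' + defect h b w' a a' := by
  simp only [defect_apply, map_add]; abel

theorem defect_smul (c : K) (w : SN) (a a' : g) :
    defect h b (c • w) a a' = c • defect h b w a a' := by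
  simp only [defect_apply, map_smul, smul_sub]

/-- This is the identity that the recursion `lowD_cons` was designed to impose. -/
theorem defect_upper_liftVec {k : I} {M : Multiset I} (hk : ∀ i ∈ M, k ≤ i) {a : g}
    (ha : a ∈ upper h b k) : defect h b (mon b M) a (liftVec h b k) = 0 := by
  rw [defect_apply, symAct_liftVec_mon h b hk, symAct_apply h b a (mon b (k ::ₘ M)),
    lowD_cons h b a hk, stepVal_apply, upperProj_of_mem h b ha, symAct_apply h b a (mon b M),
    map_add, symAct_liftVec_mulN h b hk ha, ← mulN_liftVec_mon,
    symAct_apply h b _ (lowD h b a (mon b M)), symAct_apply h b ⁅a, liftVec h b k⁆]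
  have : mulN h a (mulN h (liftVec h b k) (mon b M)) =
      mulN h (liftVec h b k) (mulN h a (mon b M)) := by
    simp only [mulN_apply]; ring
  rw [this]
  abel

theorem defect_liftVec {k : I} {M : Multiset I} (hk : ∀ i ∈ M, k ≤ i) (a : g) :
    defect h b (mon b M) a (liftVec h b k) = 0 := by
  rw [← LinearMap.flip_apply]
  refine eq_zero_of_upper h b _ k (fun i hi => ?_) (fun a ha => ?_) a
  swap
  · rw [LinearMap.flip_apply]
    exact defect_upper_liftVec h b hk ha
  rw [LinearMap.flip_apply]
  rcases hi.lt_or_eq with hi | rfl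
  -- For i < k exchange the roles: the lift with index k lies in `upper` for i, and i is below every
  -- index of `M`.
  · exact defect_eq_zero_swap h b (defect_upper_liftVec h b (fun l hl => hi.le.trans (hk l hl))
      (Submodule.mem_sup_left (Submodule.subset_span ⟨k, hi, rfl⟩)))
  · rw [defect_apply, lie_self, map_zero, sub_self, LinearMap.zero_apply, sub_zero]

theorem defect_mulN_mon {k : I} {P : Multiset I} (hk : ∀ i ∈ P, k ≤ i) {a a' : g}
    (ha : a ∈ upper h b k) (ha' : a' ∈ upper h b k) :
    defect h b (mulN h a' (mon b P)) a (liftVec h b k) = 0 := by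
  let f : SN →ₗ[K] SN :=
    { toFun := fun w => defect h b w a (liftVec h b k)
      map_add' := fun x y => defect_add h b x y a _
      map_smul' := fun r x => defect_smul h b r x a _ }
  have hf : ∀ w, f w = defect h b w a (liftVec h b k) := fun _ => rfl
  have : upper h b k ≤ (LinearMap.ker f).comap ((mulN h).flip (mon b P)) := by
    refine sup_le (Submodule.span_le.2 ?_) fun x hx => ?_
    · rintro _ ⟨i, hi, rfl⟩
      rw [SetLike.mem_coe, Submodule.mem_comap, LinearMap.mem_ker, LinearMap.flip_apply,
        mulN_liftVec_mon, hf]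
      refine defect_upper_liftVec h b (fun l hl => ?_) ha
      rcases Multiset.mem_cons.1 hl with rfl | hl
      exacts [le_of_lt hi, hk l hl]
    · rw [Submodule.mem_comap, LinearMap.mem_ker, LinearMap.flip_apply, mulN_apply,
        normalMk_coe h ⟨x, hx⟩, map_zero, zero_mul, map_zero]
  rw [← hf]
  have := this ha'
  rwa [Submodule.mem_comap, LinearMap.mem_ker, LinearMap.flip_apply] at this

/-- Write the monomial as c acting on the shorter monomial P and move c to the left of a and a'. On
P all commutation relations hold by induction. On a'·P the relation between a and c holds as well:
the leading term is covered by `defect_mulN_mon`, the rest has degree at most that of P. The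
remaining terms cancel by the Jacobi identity. -/
theorem defect_upper_upper {k : I} {P : Multiset I} (hk : ∀ i ∈ P, k ≤ i)
    (ih : ∀ w ∈ belowDeg (SymmetricAlgebra.ι K (NormalMod h)) (P.card + 1), ∀ a a',
      defect h b w a a' = 0) {a a' : g} (ha : a ∈ upper h b k) (ha' : a' ∈ upper h b k) :
    defect h b (mon b (k ::ₘ P)) a a' = 0 := by
  set c := liftVec h b k with hc
  have hP : mon b P ∈ belowDeg (SymmetricAlgebra.ι K (NormalMod h)) (P.card + 1) :=
    mon_mem_belowDeg b P.card.lt_succ_self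
  have comm : ∀ a a' : g, symAct h b a (symAct h b a' (mon b P)) =
      symAct h b a' (symAct h b a (mon b P)) + symAct h b ⁅a, a'⁆ (mon b P) := fun a a' => by
    have := ih _ hP a a'
    rwa [defect_apply, sub_sub, sub_eq_zero] at this
  have comm' : ∀ a ∈ upper h b k, ∀ a' ∈ upper h b k,
      symAct h b a (symAct h b c (symAct h b a' (mon b P))) =
      symAct h b c (symAct h b a (symAct h b a' (mon b P))) +
        symAct h b ⁅a, c⁆ (symAct h b a' (mon b P)) := fun a ha a' ha' => by
    have h1 : defect h b (symAct h b a' (mon b P)) a c = 0 := by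
      rw [symAct_apply, defect_add, ih _ (lowD_mem h b a' hP), add_zero]
      exact defect_mulN_mon h b hk ha ha'
    rwa [defect_apply, sub_sub, sub_eq_zero] at h1
  have e : mon b (k ::ₘ P) = symAct h b c (mon b P) := (symAct_liftVec_mon h b hk).symm
  have jac : symAct h b ⁅⁅a, a'⁆, c⁆ (mon b P) =
      symAct h b ⁅a, ⁅a', c⁆⁆ (mon b P) - symAct h b ⁅a', ⁅a, c⁆⁆ (mon b P) := by
    rw [lie_lie, map_sub, LinearMap.sub_apply]
  rw [defect_apply, e, comm a c, comm a' c, comm ⁅a, a'⁆ c, map_add, map_add,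
    comm' a ha a' ha', comm' a' ha' a ha, comm a ⁅a', c⁆, comm a' ⁅a, c⁆, comm a a', map_add, jac]
  abel

/-- Since g is spanned by `upper` for k and the lifts with index at most k, there are two cases. If
one argument is such a lift, `defect_liftVec` applies; if both lie in `upper`, `defect_upper_upper`
does. -/
theorem defect_mon (M : Multiset I) (a a' : g) : defect h b (mon b M) a a' = 0 := by
  induction hn : M.card using Nat.strong_induction_on generalizing M a a' with
  | _ n ih =>
  subst hn
  by_cases hM : M = 0
  · subst hM
    have hl : ∀ i (a : g), defect h b (mon b 0) a (liftVec h b i) = 0 := fun i a =>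
      defect_liftVec h b (by simp) a
    refine eq_zero_of_liftVec h b _ (fun i => hl i a) (fun x => ?_) a'
    rw [← LinearMap.flip_apply]
    refine eq_zero_of_liftVec h b _ (fun i => ?_) (fun y => ?_) a
    · rw [LinearMap.flip_apply]
      exact defect_eq_zero_swap h b (hl i x)
    -- Two elements of h remain: they kill 1, and so does their bracket.
    · rw [LinearMap.flip_apply, defect_apply, mon_zero, symAct_coe_one, symAct_coe_one, map_zero,
        map_zero, sub_self, zero_sub, neg_eq_zero]
      exact symAct_coe_one h b ⁅y, x⁆
  · obtain ⟨⟨k, P⟩, rfl, hk⟩ := exists_eq_min_cons hM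
    have hl : ∀ i ≤ k, ∀ a : g, defect h b (mon b (k ::ₘ P)) a (liftVec h b i) = 0 :=
      fun i hi a => defect_liftVec h b (fun l hl => by
        rcases Multiset.mem_cons.1 hl with rfl | hl
        exacts [hi, hi.trans (hk l hl)]) a
    have ih' : ∀ w ∈ belowDeg (SymmetricAlgebra.ι K (NormalMod h)) (P.card + 1), ∀ a a',
        defect h b w a a' = 0 := fun w hw a a' => by
      let f : SN →ₗ[K] SN :=
        { toFun := fun w => defect h b w a a'
          map_add' := fun x y => defect_add h b x y a a'
          map_smul' := fun r x => defect_smul h b r x a a' }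
      have hf : ∀ w, f w = defect h b w a a' := fun _ => rfl
      have hle := belowDeg_le_of_mon b (k := P.card + 1) (P := LinearMap.ker f) fun M hM => by
        rw [LinearMap.mem_ker, hf]
        exact ih M.card (by simpa using hM) M a a' rfl
      exact (hf w).symm.trans (LinearMap.mem_ker.1 (hle hw))
    refine eq_zero_of_upper h b _ k (fun i hi => hl i hi a) (fun x hx => ?_) a'
    rw [← LinearMap.flip_apply]
    refine eq_zero_of_upper h b _ k (fun i hi => ?_) (fun y hy => ?_) a
    · rw [LinearMap.flip_apply]
      exact defect_eq_zero_swap h b (hl i hi x)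
    · rw [LinearMap.flip_apply]
      exact defect_upper_upper h b hk ih' hy hx

theorem symAct_lie (a a' : g) : symAct h b ⁅a, a'⁆ = ⁅symAct h b a, symAct h b a'⁆ := by
  refine (monBasis b).ext fun M => ?_
  have := defect_mon h b M a a'
  rw [defect_apply, sub_eq_zero] at this
  rw [monBasis_apply]
  exact this.symm

theorem exists_isFilteredRetraction_toSN :
    ∃ π, IsFilteredRetraction h.incl LinearMap.id (SymmetricAlgebra.ι K (NormalMod h))
      (toSN h).toLinearMap π := by
  let b := Module.Basis.ofVectorSpace K (NormalMod h)
  -- Any linear order would do: only minima of finite multisets are taken.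
  let : LinearOrder (Module.Basis.ofVectorSpaceIndex K (NormalMod h)) :=
    IsWellOrder.linearOrder WellOrderingRel
  let B : g →ₗ⁅K⁆ Module.End K (SymmetricAlgebra K (NormalMod h)) :=
    { symAct h b with map_lie' := fun {a a'} => symAct_lie h b a a' }
  refine ⟨orbitMap h.incl B fun x => symAct_coe_one h b x, isFilteredRetraction_orbitMap _ _ _ _ _
    (normalMk h).toLinearMap _ (toSN_ι h) fun a k w hw => ?_⟩
  have : B a w - SymmetricAlgebra.ι K (NormalMod h) (normalMk h a) * w = lowD h b a w :=
    add_sub_cancel_left _ _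
  exact this ▸ lowD_mem h b a hw

end PBW

/-! ### Symmetrization -/

section Symmetrization

variable {K : Type u} [Field K] {M : Type v} [AddCommGroup M] [Module K M]

variable (K M) in
/-- Left multiplication by `c ∈ M` on `T(M)`, together with its effect on insertions. -/
def insStep : M →ₗ[K] Module.End K (TensorAlgebra K M × (M →ₗ[K] TensorAlgebra K M)) :=
  LinearMap.mk₂ K
    (fun c p => (TensorAlgebra.ι K c * p.1,
      LinearMap.mulRight K (TensorAlgebra.ι K c * p.1) ∘ₗ TensorAlgebra.ι K +
      LinearMap.mulLeft K (TensorAlgebra.ι K c) ∘ₗ p.2))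
    (fun c c' p => by ext <;> simp [add_mul, mul_add, mul_assoc]; abel)
    (fun a c p => by ext <;> simp [mul_assoc])
    (fun c p p' => by ext <;> simp [mul_add, mul_assoc]; abel)
    (fun a c p => by ext <;> simp [mul_assoc])

variable (K) in
/-- `insertVec K v w` is the sum of the tensors obtained from `w` by inserting `v` in all possible
positions. -/
def insertVec : M →ₗ[K] Module.End K (TensorAlgebra K M) :=
  (LinearMap.snd K _ _ ∘ₗ LinearMap.applyₗ ((1, TensorAlgebra.ι K) : TensorAlgebra K M ×
    (M →ₗ[K] TensorAlgebra K M)) ∘ₗ (TensorAlgebra.lift K (insStep K M)).toLinearMap).flip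

theorem lift_insStep_fst (w : TensorAlgebra K M) :
    (TensorAlgebra.lift K (insStep K M) w (1, TensorAlgebra.ι K)).1 = w := by
  refine isGradedBy_tensorAlgebra.induction
    (C := fun w => (TensorAlgebra.lift K (insStep K M) w (1, TensorAlgebra.ι K)).1 = w) ?_ ?_ ?_ ?_ w
  · rw [map_one]; rfl
  · intro c w hw
    rw [map_smul, LinearMap.smul_apply, Prod.smul_fst, hw]
  · intro w w' hw hw'
    rw [map_add, LinearMap.add_apply, Prod.fst_add, hw, hw']
  · intro v w hw
    rw [map_mul, TensorAlgebra.lift_ι_apply, Module.End.mul_apply]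
    exact congrArg (TensorAlgebra.ι K v * ·) hw

theorem insert_one (v : M) : insertVec K v (1 : TensorAlgebra K M) = TensorAlgebra.ι K v := by
  change (TensorAlgebra.lift K (insStep K M) 1 (1, TensorAlgebra.ι K)).2 v = _
  rw [map_one]; rfl

theorem insert_mul (v c : M) (w : TensorAlgebra K M) :
    insertVec K v (TensorAlgebra.ι K c * w) =
      TensorAlgebra.ι K v * (TensorAlgebra.ι K c * w) + TensorAlgebra.ι K c * insertVec K v w := by
  have h1 : insertVec K v (TensorAlgebra.ι K c * w) =
      (insStep K M c (TensorAlgebra.lift K (insStep K M) w (1, TensorAlgebra.ι K))).2 v := by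
    change (TensorAlgebra.lift K (insStep K M) (TensorAlgebra.ι K c * w) (1, TensorAlgebra.ι K)).2 v = _
    rw [map_mul, TensorAlgebra.lift_ι_apply, Module.End.mul_apply]
  have h2 : (insStep K M c (TensorAlgebra.lift K (insStep K M) w (1, TensorAlgebra.ι K))).2 v =
      TensorAlgebra.ι K v * (TensorAlgebra.ι K c *
        (TensorAlgebra.lift K (insStep K M) w (1, TensorAlgebra.ι K)).1) +
      TensorAlgebra.ι K c * insertVec K v w := rfl
  rw [h1, h2, lift_insStep_fst]

/-- Both sides sum over all ways to place u and v among the factors of w. Commutativity is what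
turns insertions into an action of S(M) on T(M). -/
theorem insert_comm (u v : M) (w : TensorAlgebra K M) :
    insertVec K u (insertVec K v w) = insertVec K v (insertVec K u w) := by
  refine isGradedBy_tensorAlgebra.induction
    (C := fun w : TensorAlgebra K M => insertVec K u (insertVec K v w) = insertVec K v (insertVec K u w))
    ?_ ?_ ?_ ?_ w
  · have h1 : ∀ u v : M, insertVec K u (insertVec K v (1 : TensorAlgebra K M)) =
        TensorAlgebra.ι K u * TensorAlgebra.ι K v + TensorAlgebra.ι K v * TensorAlgebra.ι K u :=
      fun u v => by
        rw [insert_one, ← mul_one (TensorAlgebra.ι K v), insert_mul, insert_one, mul_one]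
    rw [h1, h1, add_comm]
  · intro c w hw
    simp only [map_smul, hw]
  · intro w w' hw hw'
    simp only [map_add, hw, hw']
  · intro c w hw
    simp only [insert_mul, map_add, hw, mul_add]
    abel

theorem derT_insert (f : M →ₗ[K] M) (v : M) (w : TensorAlgebra K M) :
    derT f (insertVec K v w) = insertVec K (f v) w + insertVec K v (derT f w) := by
  refine isGradedBy_tensorAlgebra.induction
    (C := fun w : TensorAlgebra K M =>
      derT f (insertVec K v w) = insertVec K (f v) w + insertVec K v (derT f w)) ?_ ?_ ?_ ?_ w
  · rw [insert_one, insert_one, derT_ι, ← map_one (algebraMap K _), derT_algebraMap, map_zero,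
      add_zero]
  · intro c w hw
    simp only [map_smul, hw, smul_add]
  · intro w w' hw hw'
    simp only [map_add, hw, hw']
    abel
  · intro c w hw
    simp only [insert_mul, map_add, derT_mul, derT_ι, hw, mul_add]
    abel

theorem insert_mem (v : M) {k : ℕ} {w : TensorAlgebra K M}
    (hw : w ∈ powDeg (TensorAlgebra.ι K : M →ₗ[K] _) k) :
    insertVec K v w ∈ powDeg (TensorAlgebra.ι K : M →ₗ[K] _) (k + 1) := by
  refine powDeg_induction (j := (TensorAlgebra.ι K : M →ₗ[K] TensorAlgebra K M))
    (C := fun k w => insertVec K v w ∈ powDeg (TensorAlgebra.ι K : M →ₗ[K] _) (k + 1)) ?_ ?_ ?_ ?_ hw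
  · rw [insert_one]; simp [powDeg]
  · intro k c w hw
    rw [map_smul]; exact Submodule.smul_mem _ c hw
  · intro k w w' hw hw'
    rw [map_add]; exact add_mem hw hw'
  · intro k c w hw1 hw
    rw [insert_mul]
    exact add_mem (mul_mem_powDeg _ _ (mul_mem_powDeg _ _ hw1)) (mul_mem_powDeg _ _ hw)

/-- There are k + 1 positions for v, and they all agree once the factors commute. -/
theorem algHom_insert (v : M) {k : ℕ} {w : TensorAlgebra K M}
    (hw : w ∈ powDeg (TensorAlgebra.ι K : M →ₗ[K] _) k) :
    SymmetricAlgebra.algHom K M (insertVec K v w) =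
      (k + 1 : K) • (SymmetricAlgebra.ι K M v * SymmetricAlgebra.algHom K M w) := by
  have hι : ∀ c, SymmetricAlgebra.algHom K M (TensorAlgebra.ι K c) = SymmetricAlgebra.ι K M c :=
    fun _ => rfl
  refine powDeg_induction (j := (TensorAlgebra.ι K : M →ₗ[K] TensorAlgebra K M))
    (C := fun k w => SymmetricAlgebra.algHom K M (insertVec K v w) =
      (k + 1 : K) • (SymmetricAlgebra.ι K M v * SymmetricAlgebra.algHom K M w)) ?_ ?_ ?_ ?_ hw
  · rw [insert_one, hι, map_one]; simp
  · intro k c w hw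
    simp only [map_smul, hw, mul_smul_comm]
    exact smul_comm _ _ _
  · intro k w w' hw hw'
    simp only [map_add, hw, hw', mul_add, smul_add]
  · intro k c w _ hw
    rw [insert_mul, map_add, map_mul, map_mul, map_mul, hw, hι, hι, mul_smul_comm, mul_left_comm]
    push_cast
    rw [add_smul (k + 1 : K) 1, one_smul, add_comm]

/-- The algebra morphism out of `S(M)` induced by a linear map with commuting values. -/
def commLift {A : Type*} [Ring A] [Algebra K A] (f : M →ₗ[K] A)
    (hf : ∀ a b, f a * f b = f b * f a) : SymmetricAlgebra K M →ₐ[K] A :=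
  RingCon.liftₐ (TensorAlgebra.symRingCon K M) (TensorAlgebra.lift K f) <| by
    refine RingCon.ringConGen_le.2 ?_
    rintro _ _ ⟨a, b⟩
    rw [RingCon.ker_apply]
    simpa using hf a b

theorem commLift_ι {A : Type*} [Ring A] [Algebra K A] (f : M →ₗ[K] A)
    (hf : ∀ a b, f a * f b = f b * f a) (v : M) :
    commLift f hf (SymmetricAlgebra.ι K M v) = f v :=
  TensorAlgebra.lift_ι_apply f v

/-- The action of `S(M)` on `T(M)` by insertions. -/
def insertHom : SymmetricAlgebra K M →ₐ[K] Module.End K (TensorAlgebra K M) :=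
  commLift (insertVec K) fun a b => LinearMap.ext (insert_comm a b)

theorem insertHom_ι (v : M) : insertHom (SymmetricAlgebra.ι K M v) = insertVec K v :=
  commLift_ι _ _ v

theorem derT_insertHom (f : M →ₗ[K] M) (p : SymmetricAlgebra K M) (w : TensorAlgebra K M) :
    derT f (insertHom p w) = insertHom (derS f p) w + insertHom p (derT f w) := by
  induction p using SymmetricAlgebra.induction generalizing w with
  | algebraMap r => simp [derS_algebraMap, Module.algebraMap_end_apply]
  | ι v => rw [derS_ι, insertHom_ι, insertHom_ι, derT_insert]
  | mul a b ha hb =>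
    simp only [map_mul, Module.End.mul_apply, derS_mul, map_add, LinearMap.add_apply, ha, hb]
    abel
  | add a b ha hb =>
    simp only [map_add, LinearMap.add_apply, ha, hb]
    abel

/-- The sum over all permutations of the factors, as a map `S(M) → T(M)`. -/
def symmetrize : SymmetricAlgebra K M →ₗ[K] TensorAlgebra K M :=
  LinearMap.applyₗ (1 : TensorAlgebra K M) ∘ₗ insertHom.toLinearMap

theorem symmetrize_one : symmetrize (1 : SymmetricAlgebra K M) = 1 :=
  LinearMap.congr_fun (map_one (insertHom (K := K) (M := M))) 1

theorem symmetrize_mul (v : M) (p : SymmetricAlgebra K M) :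
    symmetrize (SymmetricAlgebra.ι K M v * p) = insertVec K v (symmetrize p) := by
  change insertHom (SymmetricAlgebra.ι K M v * p) 1 = insertVec K v (insertHom p 1)
  rw [map_mul, insertHom_ι, Module.End.mul_apply]

theorem symmetrize_derS (f : M →ₗ[K] M) (p : SymmetricAlgebra K M) :
    symmetrize (derS f p) = derT f (symmetrize p) := by
  change insertHom (derS f p) 1 = derT f (insertHom p 1)
  rw [derT_insertHom, ← map_one (algebraMap K _), derT_algebraMap, map_zero, add_zero]

theorem symmetrize_mem {k : ℕ} {p : SymmetricAlgebra K M}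
    (hp : p ∈ powDeg (SymmetricAlgebra.ι K M) k) :
    symmetrize p ∈ powDeg (TensorAlgebra.ι K : M →ₗ[K] _) k := by
  refine powDeg_induction (j := SymmetricAlgebra.ι K M)
    (C := fun k p => symmetrize p ∈ powDeg (TensorAlgebra.ι K : M →ₗ[K] _) k) ?_ ?_ ?_ ?_ hp
  · rw [symmetrize_one]; exact one_mem_powDeg _
  · intro k c w hw
    rw [map_smul]; exact Submodule.smul_mem _ c hw
  · intro k w w' hw hw'
    rw [map_add]; exact add_mem hw hw'
  · intro k v w _ hw
    rw [symmetrize_mul]; exact insert_mem v hw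

theorem algHom_symmetrize {k : ℕ} {p : SymmetricAlgebra K M}
    (hp : p ∈ powDeg (SymmetricAlgebra.ι K M) k) :
    SymmetricAlgebra.algHom K M (symmetrize p) = (k.factorial : K) • p := by
  refine powDeg_induction (j := SymmetricAlgebra.ι K M)
    (C := fun k p => SymmetricAlgebra.algHom K M (symmetrize p) = (k.factorial : K) • p)
    ?_ ?_ ?_ ?_ hp
  · rw [symmetrize_one, map_one]; simp
  · intro k c w hw
    rw [map_smul, map_smul, hw, smul_comm]
  · intro k w w' hw hw'
    rw [map_add, map_add, hw, hw', smul_add]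
  · intro k v w hw1 hw
    rw [symmetrize_mul, algHom_insert v (symmetrize_mem hw1), hw, mul_smul_comm, smul_smul,
      Nat.factorial_succ]
    push_cast
    rfl

theorem scale_derT (c : ℕ → K) (f : M →ₗ[K] M) (t : TensorAlgebra K M) :
    isGradedBy_tensorAlgebra.scale c (derT f t) = derT f (isGradedBy_tensorAlgebra.scale c t) := by
  have : isGradedBy_tensorAlgebra.scale c ∘ₗ derT f =
      derT f ∘ₗ isGradedBy_tensorAlgebra.scale c := by
    refine isGradedBy_tensorAlgebra.linearMap_ext fun k w hw => ?_
    have h1 : derT f w ∈ powDeg (TensorAlgebra.ι K : M →ₗ[K] _) k := derT_mem f hw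
    simp only [LinearMap.comp_apply, isGradedBy_tensorAlgebra.scale_apply c hw,
      isGradedBy_tensorAlgebra.scale_apply c h1, map_smul]
  exact LinearMap.congr_fun this t

/-- In degree one symmetrization involves no factorial, so it returns the vector itself in every
characteristic. -/
theorem ι_symmetricAlgebra_injective : Function.Injective (SymmetricAlgebra.ι K M) := by
  have : ∀ v : M, symmetrize (SymmetricAlgebra.ι K M v) = TensorAlgebra.ι K v := fun v => by
    rw [← mul_one (SymmetricAlgebra.ι K M v), symmetrize_mul, symmetrize_one, insert_one]
  intro v w hvw
  refine TensorAlgebra.ι_leftInverse.injective (?_ : TensorAlgebra.ι K v = TensorAlgebra.ι K w)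
  rw [← this, ← this, hvw]

theorem exists_isGradedSection [CharZero K] {g : Type*} [LieRing g] [LieAlgebra K g]
    (h : LieSubalgebra K g) : ∃ σ, IsGradedSection h σ := by
  have hT := isGradedBy_tensorAlgebra (K := K) (N := NormalMod h)
  have hS := isGradedBy_symmetricAlgebra (K := K) (N := NormalMod h)
  -- Dividing by k! averages over the permutations; inverting it is where characteristic zero
  -- enters.
  let c : ℕ → K := fun k => (k.factorial : K)⁻¹
  let σ : SymmetricAlgebra K (NormalMod h) →ₗ⁅K,h⁆ TensorAlgebra K (NormalMod h) :=
    { hT.scale c ∘ₗ symmetrize with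
      map_lie' := fun {x p} => by
        change hT.scale c (symmetrize (derS _ p)) = derT _ (hT.scale c (symmetrize p))
        rw [symmetrize_derS, scale_derT] }
  have hσ : ∀ k, ∀ p ∈ powDeg (SymmetricAlgebra.ι K (NormalMod h)) k,
      σ p = c k • symmetrize p := fun k p hp => hT.scale_apply c (symmetrize_mem hp)
  refine ⟨σ, ⟨fun x => ?_, fun k p hp => ?_⟩⟩
  · have : (SymmetricAlgebra.algHom K (NormalMod h)).toLinearMap ∘ₗ σ.toLinearMap =
        LinearMap.id := by
      refine hS.linearMap_ext fun k p hp => ?_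
      change SymmetricAlgebra.algHom K (NormalMod h) (σ p) = p
      rw [hσ k p hp, map_smul, algHom_symmetrize hp, smul_smul,
        inv_mul_cancel₀ (Nat.cast_ne_zero.2 k.factorial_ne_zero), one_smul]
    exact LinearMap.congr_fun this x
  · rw [hσ k p hp]
    exact Submodule.smul_mem _ _ (symmetrize_mem hp)

end Symmetrization

/-! ### The extension class -/

section ExtClass

attribute [local instance] CategoryStruct.toQuiver

open scoped TensorProduct

variable {K : Type u} [Field K] {g : Type v} [LieRing g] [LieAlgebra K g] (h : LieSubalgebra K g)

theorem envObj_ι_smul {L : Type v} [LieRing L] [LieAlgebra K L] (E : Type w) [AddCommGroup E]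
    [Module K E] [LieRingModule L E] [LieModule K L E] (x : L) (e : E) :
    UniversalEnvelopingAlgebra.lift K (LieModule.toEnd K L E)
      (UniversalEnvelopingAlgebra.ι K x) e = ⁅x, e⁆ := by
  rw [UniversalEnvelopingAlgebra.lift_ι_apply]; rfl

/-- Every morphism of `U(L)`-modules between Lie modules comes from a morphism of Lie modules. -/
theorem envHom_surjective {L : Type v} [LieRing L] [LieAlgebra K L]
    {E : Type w} [AddCommGroup E] [Module K E] [LieRingModule L E] [LieModule K L E]
    {E' : Type w} [AddCommGroup E'] [Module K E'] [LieRingModule L E'] [LieModule K L E']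
    (F : envObj K L E ⟶ envObj K L E') : ∃ f : E →ₗ⁅K,L⁆ E', envHom f = F := by
  let := envModule K L E
  let := envModule K L E'
  let F' : E →ₗ[UniversalEnvelopingAlgebra K L] E' := ModuleCat.Hom.hom F
  have hF : ∀ (a : UniversalEnvelopingAlgebra K L) (e : E),
      F' (UniversalEnvelopingAlgebra.lift K (LieModule.toEnd K L E) a e) =
        UniversalEnvelopingAlgebra.lift K (LieModule.toEnd K L E') a (F' e) :=
    fun a e => F'.map_smul a e
  refine ⟨{ toFun := F'
            map_add' := F'.map_add
            map_smul' := fun c e => ?_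
            map_lie' := fun {x e} => ?_ }, rfl⟩
  · have := hF (algebraMap K _ c) e
    simpa only [AlgHom.commutes, Module.algebraMap_end_apply, RingHom.id_apply] using this
  · have := hF (UniversalEnvelopingAlgebra.ι K x) e
    rwa [envObj_ι_smul, envObj_ι_smul] at this

theorem envHom_apply_eq {L : Type v} [LieRing L] [LieAlgebra K L]
    {E : Type w} [AddCommGroup E] [Module K E] [LieRingModule L E] [LieModule K L E]
    {E' : Type w} [AddCommGroup E'] [Module K E'] [LieRingModule L E'] [LieModule K L E']
    {f f' : E →ₗ⁅K,L⁆ E'} (hf : envHom f = envHom f') (e : E) : f e = f' e :=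
  congrArg (fun F : envObj K L E ⟶ envObj K L E' => ModuleCat.Hom.hom F e) hf

/-- By the long exact sequence of Ext into E, the connecting map kills the action map h ⊗ E → E
exactly when that map extends along h ⊗ E → g ⊗ E. Morphisms over U(h) are morphisms of Lie modules
(`envHom_surjective`). -/
theorem alphaClass_eq_zero_iff (E : Type v) [AddCommGroup E] [Module K E] [LieRingModule h E]
    [LieModule K h E] : alphaClass h E = 0 ↔
      ∃ f : g ⊗[K] E →ₗ⁅K,h⁆ E, ∀ (x : h) (e : E), f ((x : g) ⊗ₜ[K] e) = ⁅x, e⁆ := by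
  have := HasExt.standard (ModuleCat.{v} (UniversalEnvelopingAlgebra K h))
  constructor
  · intro h0
    obtain ⟨x₂, hx₂⟩ := Abelian.Ext.contravariant_sequence_exact₁ (tensorSeq_shortExact h E) _
      (Abelian.Ext.mk₀ (envHom (LieModule.toModuleHom K h E))) (add_zero 1) h0
    obtain ⟨F, rfl⟩ := (Abelian.Ext.mk₀_bijective _ _).2 x₂
    rw [Abelian.Ext.mk₀_comp_mk₀] at hx₂
    have h1 := (Abelian.Ext.mk₀_bijective _ _).1 hx₂
    obtain ⟨f, hf⟩ := envHom_surjective (L := h) (E := g ⊗[K] E) (E' := E) F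
    refine ⟨f, fun x e => ?_⟩
    have h2 : envHom (f.comp (inclTensor h E)) = envHom (LieModule.toModuleHom K h E) := by
      rw [← h1, ← hf]; rfl
    exact (envHom_apply_eq h2 (x ⊗ₜ[K] e)).trans (LieModule.toModuleHom_apply K h E x e)
  · rintro ⟨f, hf⟩
    have h2 : envHom (LieModule.toModuleHom K h E) = (tensorSeq h E).f ≫ envHom f := by
      have : LieModule.toModuleHom K h E = f.comp (inclTensor h E) := by
        ext t
        induction t using TensorProduct.induction_on with
        | zero => simp
        | tmul x e => exact (LieModule.toModuleHom_apply K h E x e).trans (hf x e).symm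
        | add s t hs ht => rw [map_add, map_add, hs, ht]
      rw [this]; rfl
    have h3 := (congrArg Abelian.Ext.mk₀ h2).trans
      (Abelian.Ext.mk₀_comp_mk₀ (tensorSeq h E).f (envHom f)).symm
    exact (congrArg (fun z => (tensorSeq_shortExact h E).extClass.comp z (add_zero 1)) h3).trans
      ((tensorSeq_shortExact h E).extClass_comp_assoc _)

/-- A bilinear map `g × E → E` that is compatible with the action of `h` and extends the action of
`h`. -/
def IsBilinearExtension {E : Type*} [AddCommGroup E] [Module K E] [LieRingModule h E]
    [LieModule K h E] (f : g →ₗ[K] E →ₗ[K] E) : Prop :=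
  (∀ (x : h) (a : g) (e : E), f ⁅x, a⁆ e = ⁅x, f a e⁆ - f a ⁅x, e⁆) ∧
    ∀ (x : h) (e : E), f x e = ⁅x, e⁆

theorem alphaClass_eq_zero_iff_exists_bilinear (E : Type v) [AddCommGroup E] [Module K E]
    [LieRingModule h E] [LieModule K h E] : alphaClass h E = 0 ↔
      ∃ f : g →ₗ[K] E →ₗ[K] E, IsBilinearExtension h f := by
  rw [alphaClass_eq_zero_iff]
  constructor
  · rintro ⟨f, hf⟩
    refine ⟨TensorProduct.curry f.toLinearMap, fun x a e => ?_, fun x e => hf x e⟩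
    have := f.map_lie x (a ⊗ₜ[K] e)
    rw [TensorProduct.LieModule.lie_tmul_right, map_add] at this
    exact eq_sub_of_add_eq this
  · rintro ⟨f, hf, hf'⟩
    refine ⟨{ TensorProduct.lift f with
              map_lie' := fun {x t} => ?_ }, fun x e => (TensorProduct.lift.tmul _ _).trans (hf' x e)⟩
    change TensorProduct.lift f ⁅x, t⁆ = ⁅x, TensorProduct.lift f t⁆
    induction t using TensorProduct.induction_on with
    | zero => simp
    | tmul a e =>
      rw [TensorProduct.LieModule.lie_tmul_right, map_add, TensorProduct.lift.tmul,
        TensorProduct.lift.tmul, TensorProduct.lift.tmul, hf, sub_add_cancel]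
    | add s t hs ht => rw [lie_add, map_add, map_add, lie_add, hs, ht]

/-- As f(x) is the action of x for x in h, equivariance of f says f([x, a]) = [f(x), f(a)], which is
the defining relation of h⁽¹⁾. -/
theorem exists_bilinear_iff_exists_rep {E : Type*} [AddCommGroup E] [Module K E]
    [LieRingModule h E] [LieModule K h E] :
    (∃ f : g →ₗ[K] E →ₗ[K] E, IsBilinearExtension h f) ↔
      ∃ ρ : NbhdRep h E, IsExtension h ρ := by
  constructor
  · rintro ⟨f, hf, hf'⟩
    have hx : ∀ x : h, f x = LieModule.toEnd K h E x := fun x => LinearMap.ext (hf' x)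
    refine ⟨nbhdLift h (f : g →ₗ[K] Module.End K E) fun x a => ?_, fun x e => ?_⟩
    · rw [hx]
      exact LinearMap.ext (hf x a)
    · exact (LinearMap.congr_fun (nbhdLift_of h (L' := Module.End K E) f _ (x : g)) e).trans (hf' x e)
  · rintro ⟨ρ, hρ⟩
    refine ⟨ρ.toLinearMap ∘ₗ nbhdOf h, fun x a e => ?_, hρ⟩
    change ρ (nbhdOf h ⁅(x : g), a⁆) e = ⁅x, ρ (nbhdOf h a) e⁆ - ρ (nbhdOf h a) ⁅x, e⁆
    rw [nbhdOf_lie, LieHom.map_lie, ← hρ, ← hρ]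
    rfl

end ExtClass

/-! ### From splittings of the filtration to the extension class -/

section SplitsToBilinear

variable {K : Type u} [Field K] {g : Type v} [LieRing g] [LieAlgebra K g] (h : LieSubalgebra K g)
variable {L : Type*} [LieRing L] [LieAlgebra K L] {φ : h →ₗ⁅K⁆ L} {θ : g →ₗ[K] L}
  (hθ : ∀ (x : h) (y : g), θ ⁅x, y⁆ = ⁅φ x, θ y⁆) (hφ : ∀ x : h, θ x = φ x)
variable {G : Type*} [Ring G] [Algebra K G] [LieRingModule h G] [LieModule K h G]
variable {j : NormalMod h →ₗ[K] G} {q : TensorAlgebra K g →ₗ[K] G}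

include hφ in
theorem ofTensor_mul_coe (t : TensorAlgebra K g) (x : h) :
    ofTensor φ θ (t * TensorAlgebra.ι K (x : g)) = 0 := by
  refine (Submodule.Quotient.mk_eq_zero _).2 ?_
  rw [AlgHom.toLinearMap_apply, map_mul, TensorAlgebra.lift_ι_apply]
  refine Ideal.mul_mem_left _ _ (Ideal.subset_span ⟨x, ?_⟩)
  exact congrArg (UniversalEnvelopingAlgebra.ι K) (hφ x).symm

theorem mul_mem_tensorDeg_two (a c : g) :
    TensorAlgebra.ι K a * TensorAlgebra.ι K c ∈ tensorDeg K g 2 :=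
  mul_mem_powDeg (TensorAlgebra.ι K) a (k := 1) (by simp [powDeg])

/-- The map `g ⊗ n → F²`, `a ⊗ c̄ ↦ a c`. -/
def quadMap : g →ₗ[K] NormalMod h →ₗ[K] degFil φ θ hθ 2 :=
  LinearMap.mk₂ K
    (fun a c => ⟨ofTensor φ θ (TensorAlgebra.ι K a * TensorAlgebra.ι K (normalSection h c)),
      ofTensor_mem_degFil φ θ hθ (mul_mem_tensorDeg_two _ _)⟩)
    (fun a a' c => Subtype.ext (by simp only [map_add, add_mul]; rfl))
    (fun r a c => Subtype.ext (by simp only [map_smul, smul_mul_assoc]; rfl))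
    (fun a c c' => Subtype.ext (by simp only [map_add, mul_add]; rfl))
    (fun r a c => Subtype.ext (by simp only [map_smul, mul_smul_comm]; rfl))

theorem coe_quadMap (a : g) (c : NormalMod h) : (quadMap h hθ a c : Ind φ) =
    ofTensor φ θ (TensorAlgebra.ι K a * TensorAlgebra.ι K (normalSection h c)) := rfl

-- Right multiplication by h vanishes in the quotient, so the last factor matters only modulo h.
include hφ in
theorem ofTensor_mul_normalSection (t : TensorAlgebra K g) (a : g) :
    ofTensor φ θ (t * TensorAlgebra.ι K (normalSection h (normalMk h a))) =
      ofTensor φ θ (t * TensorAlgebra.ι K a) := by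
  have := ofTensor_mul_coe h hφ t ⟨_, sub_normalSection_mem h a⟩
  rw [map_sub, mul_sub, map_sub, sub_eq_zero] at this
  exact this.symm

theorem normalMk_lie_normalSection (x : h) (c : NormalMod h) :
    normalMk h ⁅x, normalSection h c⁆ = ⁅x, c⁆ := by
  rw [LieModuleHom.map_lie, normalMk_normalSection]

include hφ in
theorem lie_quadMap (x : h) (a : g) (c : NormalMod h) :
    ⁅x, quadMap h hθ a c⁆ = quadMap h hθ ⁅x, a⁆ c + quadMap h hθ a ⁅x, c⁆ := by
  refine Subtype.ext ?_
  change ⁅x, ofTensor φ θ _⁆ = ofTensor φ θ _ + ofTensor φ θ _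
  rw [lie_ofTensor φ θ hθ, ← normalMk_lie_normalSection, ofTensor_mul_normalSection h hφ,
    ← map_add]
  congr 1
  change derT _ _ = _
  rw [derT_mul, derT_ι, derT_ι]
  rfl

-- Since c x lies in the left ideal, x c equals [x, c] in the quotient.
include hφ in
theorem coe_quadMap_coe (x : h) (c : NormalMod h) : (quadMap h hθ (x : g) c : Ind φ) =
    ofTensor φ θ (TensorAlgebra.ι K ⁅x, normalSection h c⁆) := by
  have h1 : ⁅x, ofTensor φ θ (TensorAlgebra.ι K (normalSection h c))⁆ = ofTensor φ θ
      (derT (LieModule.toEnd K h g x) (TensorAlgebra.ι K (normalSection h c))) :=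
    lie_ofTensor φ θ hθ x (TensorAlgebra.ι K (normalSection h c))
  rw [derT_ι, LieModule.toEnd_apply_apply] at h1
  rw [coe_quadMap, ← h1, ← smul_ofTensor, hφ]
  rfl

-- The splitting gives an h-linear projection of F² onto F¹; follow it by the symbol F¹ → n and
-- apply the result to a ⊗ c̄ ↦ a c. For x in h the product x c = [x, c] already lies in F¹ and has
-- symbol [x, c̄], so the map extends the action.
include hφ in
theorem exists_bilinear_of_splits (hj : IsGradedBy j) (hjinj : Function.Injective j)
    (hq : IsSymbolMap φ θ hθ j q) (hqj : ∀ a, q (TensorAlgebra.ι K a) = j (normalMk h a))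
    (hqH : ∀ (x : h) t, q ⁅x, t⁆ = ⁅x, q t⁆) {π : Ind φ →ₗ[K] G}
    (hπ : IsFilteredRetraction φ θ j q π) (hs : Splits (degFil φ θ hθ)) :
    ∃ f : g →ₗ[K] NormalMod h →ₗ[K] NormalMod h, IsBilinearExtension h f := by
  -- Only the splitting of the second step is used.
  obtain ⟨s, hs⟩ := hs 2
  obtain ⟨ji, hji⟩ := j.exists_leftInverse_of_injective (LinearMap.ker_eq_bot.2 hjinj)
  have hji : ∀ v, ji (j v) = v := fun v => LinearMap.congr_fun hji v
  have hjlie : ∀ (x : h) v, j ⁅x, v⁆ = ⁅x, j v⁆ := fun x v => by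
    obtain ⟨a, rfl⟩ := normalMk_surjective h v
    rw [← LieModuleHom.map_lie, ← hqj, ← hqj, ← hqH]
    exact congrArg q (derT_ι (LieModule.toEnd K h g x) a).symm
  -- The projection of F² onto F¹ along the image of the splitting.
  let D : degFil φ θ hθ 2 →ₗ⁅K,h⁆ degFil φ θ hθ 2 :=
    LieModuleHom.id - s.comp (grMk (degFil φ θ hθ) 2)
  have hD : ∀ y, D y = y - s (grMk (degFil φ θ hθ) 2 y) := fun _ => rfl
  have hD1 : ∀ y, (D y : Ind φ) ∈ degFil φ θ hθ 1 := fun y => by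
    have : grMk (degFil φ θ hθ) 2 (D y) = 0 := by rw [hD, map_sub, hs, sub_self]
    exact (LieSubmodule.Quotient.mk_eq_zero
      ((prev (degFil φ θ hθ) 2).comap (degFil φ θ hθ 2).incl)).1 this
  let R : degFil φ θ hθ 2 →ₗ[K] NormalMod h :=
    ji ∘ₗ hj.comp 1 ∘ₗ π ∘ₗ (degFil φ θ hθ 2).toSubmodule.subtype ∘ₗ D.toLinearMap
  have hR : ∀ y, R y = ji (hj.comp 1 (π (D y))) := fun _ => rfl
  have hRlie : ∀ (x : h) y, R ⁅x, y⁆ = ⁅x, R y⁆ := fun x y => by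
    have h1 : ((D ⁅x, y⁆ : degFil φ θ hθ 2) : Ind φ) = ⁅x, (D y : Ind φ)⁆ := by
      rw [LieModuleHom.map_lie]; rfl
    have h2 : hj.comp 1 (π (D y)) ∈ LinearMap.range j := by
      simpa [powDeg] using hj.comp_mem 1 (π (D y))
    obtain ⟨v, hv⟩ := h2
    rw [hR, hR, h1, hπ.comp_lie hj hq hqH x (hD1 y), ← hv, ← hjlie, hji, hji]
  refine ⟨(quadMap h hθ).compr₂ R, fun x a c => ?_, fun x c => ?_⟩
  · change R (quadMap h hθ ⁅x, a⁆ c) = ⁅x, R (quadMap h hθ a c)⁆ - R (quadMap h hθ a ⁅x, c⁆)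
    rw [← hRlie, lie_quadMap h hθ hφ, map_add, add_sub_cancel_right]
  · change R (quadMap h hθ x c) = _
    have h1 : TensorAlgebra.ι K ⁅x, normalSection h c⁆ ∈ tensorDeg K g 1 := by simp [tensorDeg]
    -- The product lies in F¹, where `D` is the identity.
    have h2 : grMk (degFil φ θ hθ) 2 (quadMap h hθ (x : g) c) = 0 := by
      refine (LieSubmodule.Quotient.mk_eq_zero _).2 ?_
      change (quadMap h hθ (x : g) c : Ind φ) ∈ degFil φ θ hθ 1
      rw [coe_quadMap_coe h hθ hφ]
      exact ofTensor_mem_degFil φ θ hθ h1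
    have h3 := hj.comp_below (hπ 1 _ h1)
    rw [map_sub, hj.comp_self (hq.apply_mem h1), sub_eq_zero, hqj, normalMk_lie_normalSection]
      at h3
    rw [hR, hD, h2, map_zero, sub_zero, coe_quadMap_coe h hθ hφ, h3, hji]

end SplitsToBilinear

/-! ### The induced splitting of the filtration of the quotient of `U(g)` -/

section InducedSplitting

variable {K : Type u} [Field K] {g : Type v} [LieRing g] [LieAlgebra K g] (h : LieSubalgebra K g)

theorem indMap_projF (t : TensorAlgebra K g) : indMap h (projF h t) = projR h t := by
  change indMk h.incl (envMap h (TensorAlgebra.lift K _ t)) =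
    indMk h.incl (TensorAlgebra.lift K _ t)
  congr 1
  rw [← AlgHom.comp_apply]
  refine AlgHom.congr_fun (TensorAlgebra.hom_ext (LinearMap.ext fun a => ?_)) t
  change envMap h (TensorAlgebra.lift K _ (TensorAlgebra.ι K a)) =
    TensorAlgebra.lift K _ (TensorAlgebra.ι K a)
  rw [TensorAlgebra.lift_ι_apply, TensorAlgebra.lift_ι_apply]
  change envMap h (UniversalEnvelopingAlgebra.ι K (nbhdOf h a)) = UniversalEnvelopingAlgebra.ι K a
  rw [envMap, UniversalEnvelopingAlgebra.lift_ι_apply, LieHom.comp_apply, nbhdProj_of]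

theorem indMap_mem_prev {k : ℕ} {y : UNbhd h} (hy : y ∈ prev (filF h) k) :
    indMap h y ∈ prev (filR h) k := by
  obtain ⟨t, ht, rfl⟩ := (mem_prev_degFil (nbhdIncl h) (nbhdOf h) _).1 hy
  exact (mem_prev_degFil h.incl LinearMap.id _).2 ⟨t, ht, (indMap_projF h t).symm⟩

theorem exists_symEquiv {σ : SymmetricAlgebra K (NormalMod h) →ₗ⁅K,h⁆ TensorAlgebra K (NormalMod h)}
    (hσ : IsGradedSection h σ) {s : TensorAlgebra K (NormalMod h) →ₗ⁅K,h⁆ UNbhd h}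
    (hs : SplitsF h s) :
    ∃ I : SymmetricAlgebra K (NormalMod h) ≃ₗ⁅K,h⁆ UQuot h,
      (∀ x, I x = indMap h (s (σ x))) ∧ SplitsR h I := by
  let I₀ : SymmetricAlgebra K (NormalMod h) →ₗ⁅K,h⁆ UQuot h := (indMap h).comp (s.comp σ)
  have hI : SplitsR h I₀.toLinearMap := fun k t ht => by
    have h1 : toSN h t ∈ symDeg K (NormalMod h) k := (isSymbolMap_toSN h).apply_mem ht
    -- The tensor `t'` lifts the image under σ of the class of `t`. Both tensors have the same image
    -- in S(n), so their classes in U(g)/U(g)h differ by an element of R^{k-1}, and `SplitsF` can be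
    -- applied to `t'`.
    obtain ⟨t', ht', e⟩ := (isSymbolMap_toTN h).exists_lift (hσ.graded k _ h1)
    have e : toTN h t' = σ (toSN h t) := e
    have h2 : toSN h (t' - t) = 0 := by
      rw [map_sub, sub_eq_zero, toSN, AlgHom.comp_apply, e, hσ.section_apply]
      rfl
    have h3 := (isSymbolMap_toSN h).mem_prev k (t' - t) (sub_mem ht' ht) h2
    have h4 := add_mem (indMap_mem_prev h (hs k t' ht')) h3
    have h5 : indMap h (s (toTN h t') - projF h t') + ofTensor h.incl LinearMap.id (t' - t) =
        I₀ (toSN h t) - projR h t := by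
      change _ = indMap h (s (σ (toSN h t))) - projR h t
      rw [map_sub, map_sub, indMap_projF, e]
      change _ - projR h t' + (projR h t' - projR h t) = _
      abel
    exact h5 ▸ h4
  obtain ⟨π, hπ⟩ := exists_isFilteredRetraction_toSN h
  have hb : Function.Bijective I₀ :=
    IsFilteredSection.bijective (hθ := fun _ _ => rfl) isGradedBy_symmetricAlgebra
      (isSymbolMap_toSN h) (s := I₀.toLinearMap) hI (projR_surjective h) hπ
  exact ⟨{ I₀, LinearEquiv.ofBijective I₀.toLinearMap hb with }, fun _ => rfl, hI⟩

end InducedSplitting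

end LiePBW

end

/-! ### Assembly of the theorem. -/

open LiePBW
theorem theorem1p3 {K : Type*} [Field K] {g : Type*} [LieRing g] [LieAlgebra K g]
    (h : LieSubalgebra K g) :
    Function.Injective (nbhdIncl h) ∧
    (∃ e : ∀ k, Gr (filF h) k ≃ₗ⁅K,h⁆ tensorPow K h (NormalMod h) k,
      ∀ k, ∀ t ∈ tensorDeg K g k, ∀ y : filF h k, projF h t = y →
        (e k (grMk (filF h) k y) : TensorAlgebra K (NormalMod h)) = toTN h t) ∧
    (∃ e : ∀ k, Gr (filR h) k ≃ₗ⁅K,h⁆ symPow K h (NormalMod h) k,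
      ∀ k, ∀ t ∈ tensorDeg K g k, ∀ y : filR h k, projR h t = y →
        (e k (grMk (filR h) k y) : SymmetricAlgebra K (NormalMod h)) = toSN h t) ∧
    (CharZero K →
      [alpha h = 0,
        Splits (filF h),
        Splits (filR h),
        ∃ ρ : NbhdRep h (NormalMod h), IsExtension h ρ].TFAE ∧
      (∃ σ, IsGradedSection h σ) ∧
      (∀ ρ : NbhdRep h (NormalMod h), IsExtension h ρ →
        ∃ s : TensorAlgebra K (NormalMod h) ≃ₗ⁅K,h⁆ UNbhd h, IsPBWMap h ρ s ∧ SplitsF h s) ∧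
      (∀ σ, IsGradedSection h σ →
        ∀ s : TensorAlgebra K (NormalMod h) →ₗ⁅K,h⁆ UNbhd h, SplitsF h s →
          ∃ I : SymmetricAlgebra K (NormalMod h) ≃ₗ⁅K,h⁆ UQuot h,
            (∀ x, I x = indMap h (s (σ x))) ∧ SplitsR h I)) := by
  have hT := isGradedBy_tensorAlgebra (K := K) (N := NormalMod h)
  have hS := isGradedBy_symmetricAlgebra (K := K) (N := NormalMod h)
  have hTq := isSymbolMap_toTN h
  have hSq := isSymbolMap_toSN h
  obtain ⟨πT, hπT⟩ := exists_isFilteredRetraction_toTN h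
  obtain ⟨πS, hπS⟩ := exists_isFilteredRetraction_toSN h
  have eF := exists_symbolEquiv (hθ := fun x y => nbhdOf_lie h x y) hT hTq (toTN_lie h)
    (tensorPow K h (NormalMod h)) (fun _ => rfl) hπT
  have eR := exists_symbolEquiv (hθ := fun _ _ => rfl) hS hSq (toSN_lie h)
    (symPow K h (NormalMod h)) (fun _ => rfl) hπS
  refine ⟨nbhdIncl_injective h, eF, eR, fun _ => ?_⟩
  have hσ := exists_isGradedSection h
  have hI : ∀ σ, IsGradedSection h σ →
      ∀ s : TensorAlgebra K (NormalMod h) →ₗ⁅K,h⁆ UNbhd h, SplitsF h s →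
        ∃ I : SymmetricAlgebra K (NormalMod h) ≃ₗ⁅K,h⁆ UQuot h,
          (∀ x, I x = indMap h (s (σ x))) ∧ SplitsR h I :=
    fun σ hσ s hs => exists_symEquiv h hσ hs
  refine ⟨?_, hσ, fun ρ hρ => exists_isPBWMap hρ, hI⟩
  have hα : alpha h = 0 ↔ ∃ f : g →ₗ[K] NormalMod h →ₗ[K] NormalMod h,
      IsBilinearExtension h f := alphaClass_eq_zero_iff_exists_bilinear h (NormalMod h)
  tfae_have 1 ↔ 4 := hα.trans (exists_bilinear_iff_exists_rep h)
  tfae_have 4 → 2 := by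
    rintro ⟨ρ, hρ⟩
    obtain ⟨s, -, hs⟩ := exists_isPBWMap hρ
    obtain ⟨e, he⟩ := eF
    exact IsFilteredSection.splits (s := s.toLieModuleHom) hTq (tensorPow K h (NormalMod h))
      (fun _ => rfl) hs e he
  tfae_have 4 → 3 := by
    rintro ⟨ρ, hρ⟩
    obtain ⟨s, -, hs⟩ := exists_isPBWMap hρ
    obtain ⟨σ, hσ⟩ := hσ
    obtain ⟨I, -, hI⟩ := hI σ hσ s.toLieModuleHom hs
    obtain ⟨e, he⟩ := eR
    exact IsFilteredSection.splits (s := I.toLieModuleHom) hSq (symPow K h (NormalMod h))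
      (fun _ => rfl) hI e he
  tfae_have 2 → 1 := fun hs => hα.2 <|
    exists_bilinear_of_splits h (φ := nbhdIncl h) (θ := nbhdOf h) _ (fun _ => rfl) hT
      TensorAlgebra.ι_leftInverse.injective hTq (toTN_ι h) (toTN_lie h) hπT hs
  tfae_have 3 → 1 := fun hs => hα.2 <|
    exists_bilinear_of_splits h (φ := h.incl) (θ := LinearMap.id) _ (fun _ => rfl) hS
      ι_symmetricAlgebra_injective hSq (toSN_ι h) (toSN_lie h) hπS hs
  tfae_finish
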